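/- Let $\omega=e^{2\pi i/3}$, let $\Gamma=4\pi i\,\omega(\mathbb Z\oplus\omega\mathbb Z)\subset\mathbb C$, and let $$U(z)=\sum_{k=0}^{2}\omega^k e^{\frac12(z\bar\omega^k-\bar z\omega^k)}$$ be the Bistritzer–MacDonald tunnelling potential. Let $D_{\bar z}=-i\partial_{\bar z}$, and let $L^2_1=L^2_1(\mathbb C/\Gamma;\mathbb C^2)$ be the closed subspace of all $u\in L^2(\mathbb C/\Gamma;\mathbb C^2)$ such that, for all $m,n\in\mathbb Z$ and $\mathbf a=\tfrac{4\pi i}{3}(m\omega+n\omega^2)$, $$u(z)=\omega^{m+n}\begin{pmatrix}\omega^{m+n}&0\\0&1\end{pmatrix}u(z+\mathbf a)\quad\text{for almost every } z.$$ Then $$T=T_0=(2D_{\bar z})^{-1}\begin{pmatrix}0&U(z)\\U(-z)&0\end{pmatrix}:L^2_1\to L^2_1$$ is a well-defined bounded operator: for every $u\in L^2_1$, $v=Tu$ is the unique element of $H^1\cap L^2_1$ with $2D_{\bar z}v=(U(z)u_2,\,U(-z)u_1)$. Let $\alpha\in\mathbb C$ with $1\notin\mathrm{Spec}_{L^2_1}(\alpha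 T)$. Then the regularized determinant $$\det\nolimits_4(1-\alpha T)=\prod_{\lambda\in\mathrm{Spec}(-\alpha T)}(1+\lambda)\,e^{-\lambda+\lambda^2/2-\lambda^3/3}$$ (eigenvalues repeated according to algebraic multiplicity) converges and is non-zero, and $$\|(1-\alpha T)^{-1}\|\le(1+3|\alpha|)^2+\frac{e^{3(4|\alpha|+1)^4/4}}{|\det_4(1-\alpha T)|}.$$ -/

import Mathlib

open MeasureTheory Complex
open scoped ContDiff

noncomputable section

namespace Moire

/-- The primitive third root of unity `ω = e^{2πi/3}`. -/
def omega : ℂ := exp (2 * Real.pi * I / 3)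

/-- The generators `4πi ω`, `4πi ω²` of the moiré lattice. -/
def gen : Fin 2 → ℂ := ![4 * Real.pi * I * omega, 4 * Real.pi * I * omega ^ 2]

lemma omega_eq : omega = -(1 / 2) + (Real.sqrt 3 / 2 : ℝ) * I := by
  have h : (2 * Real.pi * I / 3 : ℂ) = ((Real.pi - Real.pi / 3 : ℝ) : ℂ) * I := by
    push_cast; ring
  rw [omega, h, exp_mul_I, ← ofReal_cos, ← ofReal_sin, Real.cos_pi_sub, Real.sin_pi_sub,
    Real.cos_pi_div_three, Real.sin_pi_div_three]
  push_cast; ring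

lemma linearIndependent_gen : LinearIndependent ℝ gen := by
  have hs : Real.sqrt 3 * Real.sqrt 3 = 3 := Real.mul_self_sqrt (by norm_num)
  have hs0 : 0 < Real.sqrt 3 := Real.sqrt_pos.2 (by norm_num)
  have hpi := Real.pi_pos
  rw [gen, LinearIndependent.pair_iff]
  intro s t h
  rw [omega_eq] at h
  have h1 := congrArg Complex.re h
  have h2 := congrArg Complex.im h
  simp [pow_two] at h1 h2
  have e1 : (Real.pi * Real.sqrt 3) * (t - s) = 0 := by linear_combination h1 / 2
  have e2 : Real.pi * (s + t) = 0 := by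
    linear_combination -h2 / 2 - (t * Real.pi / 2) * hs
  have f1 := (mul_eq_zero.1 e1).resolve_left (by positivity)
  have f2 := (mul_eq_zero.1 e2).resolve_left (by positivity)
  constructor <;> linarith

/-- The generators as a real basis of `ℂ`. -/
def basis : Module.Basis (Fin 2) ℝ ℂ :=
  basisOfLinearIndependentOfCardEqFinrank linearIndependent_gen (by simp)

/-- The moiré lattice `Γ = 4πi ω (ℤ ⊕ ω ℤ)`. -/
def lattice : AddSubgroup ℂ := (Submodule.span ℤ (Set.range basis)).toAddSubgroup

/-- The half-open fundamental parallelogram `{4πi (ω s + ω² t) : s, t ∈ [0, 1)}` of `Γ`. -/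
def cell : Set ℂ := ZSpan.fundamentalDomain basis

/-- The torus `ℂ / Γ`. -/
abbrev Torus : Type := ℂ ⧸ lattice

/-- The projection `ℂ → ℂ / Γ`. -/
def proj (z : ℂ) : Torus := QuotientAddGroup.mk z

/-- The area measure of `ℂ / Γ`: Lebesgue measure on a fundamental cell, pushed forward. -/
def area : Measure Torus := (volume.restrict cell).map proj

/-- The Hilbert space `L²(ℂ / Γ; ℂ²)`. -/
abbrev L2 : Type := Lp (EuclideanSpace ℂ (Fin 2)) 2 area

lemma measurable_proj : Measurable proj := measurable_quot_mk

/-- A property that holds almost everywhere on `ℂ / Γ` holds at almost every `z ∈ ℂ`. -/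
lemma ae_proj {P : Torus → Prop} (h : ∀ᵐ x ∂area, P x) : ∀ᵐ z : ℂ, P (proj z) := by
  have hF : IsAddFundamentalDomain lattice cell (volume : Measure ℂ) :=
    ZSpan.isAddFundamentalDomain' basis volume
  have h1 : ∀ᵐ z ∂(volume.restrict cell), P (proj z) :=
    ae_of_ae_map measurable_proj.aemeasurable h
  have : Countable lattice := inferInstanceAs
    (Countable (Submodule.span ℤ (Set.range basis)))
  rw [ae_iff, Measure.restrict_apply₀' hF.nullMeasurableSet] at h1
  refine hF.measure_zero_of_invariant _ (fun g => ?_) h1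
  ext z
  have key : proj (-g +ᵥ z) = proj z := by
    refine QuotientAddGroup.eq.2 ?_
    have : -(-g +ᵥ z) + z = (g : ℂ) := by
      change -((-g : lattice) + z) + z = (g : ℂ)
      push_cast; ring
    rw [this]
    exact g.2
  rw [Set.mem_vadd_set_iff_neg_vadd_mem]
  change ¬ P (proj (-g +ᵥ z)) ↔ ¬ P (proj z)
  rw [key]

/-- Almost every `z ∈ ℂ` has a property once almost every `z` has it after a fixed translation. -/
lemma ae_add {P : ℂ → Prop} (a : ℂ) (h : ∀ᵐ z : ℂ, P z) : ∀ᵐ z : ℂ, P (z + a) :=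
  (measurePreserving_add_right (volume : Measure ℂ) a).quasiMeasurePreserving.ae h

/-- The vector `m · 4πi ω / 3 + n · 4πi ω² / 3` of the lattice `Γ₃ = Γ / 3`. -/
def third (m n : ℤ) : ℂ := m * (4 * Real.pi * I * omega / 3) + n * (4 * Real.pi * I * omega ^ 2 / 3)

/-- The space `L²_p(ℂ / Γ; ℂ²)` of the `u` with `u(z) = ω^{p (m + n)} (𝓛_a u)(z)` for all
`a = third m n ∈ Γ₃`, where `(𝓛_a u)(z) = diag (ω^{m + n}, 1) u(z + a)`. -/
def L2sub (p : ℤ) : Submodule ℂ L2 where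
  carrier := {u | ∀ m n : ℤ, ∀ᵐ z : ℂ,
    u (proj z) 0 = omega ^ (p * (m + n)) * (omega ^ (m + n) * u (proj (z + third m n)) 0) ∧
    u (proj z) 1 = omega ^ (p * (m + n)) * u (proj (z + third m n)) 1}
  zero_mem' := by
    intro m n
    have h0 := ae_proj (Lp.coeFn_zero (EuclideanSpace ℂ (Fin 2)) 2 area)
    filter_upwards [h0, ae_add (third m n) h0] with z h1 h2
    rw [h1, h2]
    simp
  add_mem' := by
    intro u v hu hv m n
    have h0 := ae_proj (Lp.coeFn_add u v)
    filter_upwards [h0, ae_add (third m n) h0, hu m n, hv m n] with z h1 h2 h3 h4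
    rw [h1, h2]
    simp only [Pi.add_apply, PiLp.add_apply]
    rw [h3.1, h3.2, h4.1, h4.2]
    constructor <;> ring
  smul_mem' := by
    intro c u hu m n
    have h0 := ae_proj (Lp.coeFn_smul c u)
    filter_upwards [h0, ae_add (third m n) h0, hu m n] with z h1 h2 h3
    rw [h1, h2]
    simp only [Pi.smul_apply, PiLp.smul_apply, smul_eq_mul]
    rw [h3.1, h3.2]
    constructor <;> ring

/-- The Hilbert space `L²₁(ℂ / Γ; ℂ²)`. -/
abbrev L2one : Type := L2sub 1

/-- The Bistritzer–MacDonald tunnelling potential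
`U(z) = ∑_{k = 0}^{2} ω^k exp ((z ω̄^k - z̄ ω^k) / 2)`. -/
def potential (z : ℂ) : ℂ :=
  ∑ k ∈ Finset.range 3, omega ^ k *
    exp ((z * (starRingEnd ℂ) omega ^ k - (starRingEnd ℂ) z * omega ^ k) / 2)

/-- `f(z) = (U(z) u₂(z), U(-z) u₁(z))`. -/
def IsPotentialMul (u f : L2) : Prop :=
  ∀ᵐ z : ℂ, f (proj z) 0 = potential z * u (proj z) 1 ∧
    f (proj z) 1 = potential (-z) * u (proj z) 0

/-- `w` is the weak derivative of `v` on `ℂ / Γ` in the real direction `e ∈ ℂ = ℝ²`, tested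
against smooth `Γ`-periodic functions. -/
def HasWeakDeriv (e : ℂ) (v w : L2) : Prop :=
  ∀ φ : ℂ → ℂ, ContDiff ℝ ∞ φ → (∀ γ ∈ lattice, ∀ z, φ (z + γ) = φ z) → ∀ j : Fin 2,
    ∫ z in cell, v (proj z) j * fderiv ℝ φ z e = -∫ z in cell, w (proj z) j * φ z

/-- `v ∈ H¹(ℂ / Γ; ℂ²)` and `2 D_{z̄} v = f`, where `2 D_{z̄} = -2i ∂_{z̄} = -i (∂_x + i ∂_y)`. -/
def IsTwoDbar (v f : L2) : Prop :=
  ∃ vx vy : L2, HasWeakDeriv 1 v vx ∧ HasWeakDeriv I v vy ∧ f = (-I) • (vx + I • vy)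

/-- `T` is the operator `T₀ = (2 D_{z̄})⁻¹ (0, U(z); U(-z), 0)` on `L²₁(ℂ / Γ; ℂ²)`: its graph is
the set of all pairs `(u, v)` with `v ∈ H¹` and `2 D_{z̄} v = (U(z) u₂, U(-z) u₁)`. -/
def IsT0 (T : L2one →L[ℂ] L2one) : Prop :=
  ∀ u v : L2one, T u = v ↔ ∃ f : L2, IsPotentialMul (u : L2) f ∧ IsTwoDbar (v : L2) f

section Det

variable {H : Type*} [NormedAddCommGroup H] [NormedSpace ℂ H]

/-- The algebraic multiplicity of `μ` as an eigenvalue of `S`. -/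
def algMult (S : H →L[ℂ] H) (μ : ℂ) : ℕ :=
  Module.finrank ℂ (Module.End.maxGenEigenspace (S : Module.End ℂ H) μ)

/-- The factor `((1 + μ) e^{-μ + μ²/2 - μ³/3})^{m(μ)}` of `det₄ (1 + S)`. At `μ = 0` it is `1`
whatever the multiplicity. -/
def detFactor (S : H →L[ℂ] H) (μ : spectrum ℂ S) : ℂ :=
  ((1 + (μ : ℂ)) * exp (-(μ : ℂ) + (μ : ℂ) ^ 2 / 2 - (μ : ℂ) ^ 3 / 3)) ^ algMult S (μ : ℂ)

/-- `det₄ (1 + S) = ∏_{μ ∈ Spec S} (1 + μ) e^{-μ + μ²/2 - μ³/3}`, with eigenvalues repeated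
according to algebraic multiplicity. -/
def det4OneAdd (S : H →L[ℂ] H) : ℂ := ∏' μ : spectrum ℂ S, detFactor S μ

end Det

end Moire

end

/-! Put `N = -α T`. If `(1 + N) z = x`, then `z = x - N x + N² x - N³ z`. Since `‖T‖ ≤ 3`, the first
three terms contribute at most `1 + r + r² ≤ (1 + r)²` with `r = 3 |α|`. What remains is to bound
`‖N³ (1 + N)⁻¹‖ · |det₄ (1 + N)|` by `exp (3 (s + 1)⁴ / 4)` with `s = 4 |α|`.

Schatten norms are replaced by `DiagBound p`, a bound in `ℓᵖ` on the diagonal in every orthonormal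
family. It passes to compressions, is subadditive for `p = 4`, and controls eigenvalues because a
triangularizing orthonormal basis has the eigenvalues on its diagonal.

In finite dimension (`norm_detFour_mul_norm_le`) perturb `K` by the rank-one operator `c ⟨y, ·⟩ x`,
where `x = (1 + K) z` and `y = K³ z`. The determinant `det₄` is entire in `c`, with derivative
`-det₄ (1 + K) ‖y‖²` at `0`. The scalar bound `|(1 + μ) e^{-μ + μ²/2 - μ³/3}| ≤ e^{3 |μ|⁴ / 4}`
(`norm_elemFactor_le`) bounds it by `exp (3 (s + 1)⁴ / 4)` on the circle where the perturbation has
norm `1`, and Cauchy's estimate gives the claim.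

For compact `N` (`norm_prod_mul_norm_le`), let `E` be the sum of the generalized eigenspaces of a
finite set of nonzero numbers containing every eigenvalue of modulus at least `ε`. Compress `N` to a
large finite-dimensional `F ⊇ E`. Since `E` is invariant, `det₄` splits into the partial product
over that set and a product over eigenvalues of modulus less than `ε`. The latter product is at
least `exp (-ε c³)` in modulus by the `ℓ³` bound, uniformly in `F`. Letting the set grow and then `ε
→ 0` gives `norm_det4OneAdd_mul_le`, with no trace theorem needed.

For the tunnelling operator, Fourier series turn `2 D_{z̄}` into multiplication by `i q` and each
term of `U` into a unimodular weighted permutation of the modes. The symmetry defining `L²₁` selects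
frequencies with fixed residues mod 3, for which `|q| ≥ 1`. Hence `T` is a sum of three permutations
followed by a diagonal contraction, and `‖T‖ ≤ 3`. The constant `4` comes from the Hilbert–Schmidt
norm of `T T*`, which satisfies `‖T T*‖² ≤ 15 ∑ |q|⁻⁴ ≤ 4⁴` (`diagBound_hopping`,
`exists_hasSum_norm_multiplier_pow_four`). -/

noncomputable section

namespace Moire

/-! ### Growth of the elementary factor of `det₄`. -/

/-- The elementary factor `(1 + μ) e^{-μ + μ²/2 - μ³/3}` of `det₄`. -/
def elemFactor (μ : ℂ) : ℂ := (1 + μ) * exp (-μ + μ ^ 2 / 2 - μ ^ 3 / 3)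

lemma logTaylor_four (μ : ℂ) : logTaylor 4 μ = μ - μ ^ 2 / 2 + μ ^ 3 / 3 := by
  simp [logTaylor, Finset.sum_range_succ]
  ring

lemma elemFactor_eq_exp {μ : ℂ} (h : 1 + μ ≠ 0) :
    elemFactor μ = exp (log (1 + μ) - logTaylor 4 μ) := by
  rw [elemFactor, logTaylor_four, sub_eq_add_neg (log _), exp_add, exp_log h]
  congr 2
  ring

/-- Along `t ↦ t μ` the remainder of the logarithm has derivative `(-t μ)³ (1 + t μ)⁻¹ μ`, of norm
at most `t³ ‖μ‖⁴ / δ`; integrate over `[0, 1]`. -/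
lemma norm_log_sub_logTaylor_four_le {μ : ℂ} {δ : ℝ} (hδ : 0 < δ)
    (hs : ∀ t ∈ Set.Icc (0 : ℝ) 1, 1 + t * μ ∈ slitPlane)
    (h : ∀ t ∈ Set.Icc (0 : ℝ) 1, δ ≤ ‖1 + t * μ‖) :
    ‖log (1 + μ) - logTaylor 4 μ‖ ≤ ‖μ‖ ^ 4 / (4 * δ) := by
  set g : ℂ → ℂ := fun z => log (1 + z) - logTaylor 4 z
  have hd : ∀ t ∈ Set.Icc (0 : ℝ) 1,
      HasDerivAt (fun t : ℝ => g (t * μ)) ((-(t * μ)) ^ 3 * (1 + t * μ)⁻¹ * μ) t := by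
    intro t ht
    have h1 : HasDerivAt (fun t : ℝ => (t : ℂ) * μ) μ t := by
      simpa using (ofRealCLM.hasDerivAt (x := t)).mul_const μ
    exact (hasDerivAt_log_sub_logTaylor 3 (hs t ht)).comp t h1
  have key := image_norm_le_of_norm_deriv_right_le_deriv_boundary (a := 0) (b := 1)
    (f := fun t : ℝ => g (t * μ)) (f' := fun t : ℝ => (-(t * μ)) ^ 3 * (1 + t * μ)⁻¹ * μ)
    (B := fun t => ‖μ‖ ^ 4 / (4 * δ) * t ^ 4) (B' := fun t => ‖μ‖ ^ 4 / δ * t ^ 3)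
    (fun t ht => (hd t ht).continuousAt.continuousWithinAt)
    (fun t ht => (hd t ⟨ht.1, ht.2.le⟩).hasDerivWithinAt)
    (by simp [g, logTaylor_at_zero])
    (fun t => by
      convert! (hasDerivAt_pow 4 t).const_mul (‖μ‖ ^ 4 / (4 * δ)) using 1
      push_cast
      field_simp)
    (fun t ht => by
      have h0 := h t ⟨ht.1, ht.2.le⟩
      rw [norm_mul, norm_mul, norm_pow, norm_neg, norm_mul, norm_inv, norm_real,
        Real.norm_of_nonneg ht.1]
      have : ‖1 + (t : ℂ) * μ‖⁻¹ ≤ δ⁻¹ := inv_anti₀ hδ h0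
      calc (t * ‖μ‖) ^ 3 * ‖1 + (t : ℂ) * μ‖⁻¹ * ‖μ‖ ≤ (t * ‖μ‖) ^ 3 * δ⁻¹ * ‖μ‖ := by
            have := ht.1
            gcongr
        _ = _ := by rw [div_eq_mul_inv]; ring)
  simpa [g] using key (Set.right_mem_Icc.2 zero_le_one)

lemma one_add_mul_mem_slitPlane {μ : ℂ} (h : 1 + μ ∈ slitPlane) {t : ℝ}
    (ht : t ∈ Set.Icc (0 : ℝ) 1) : 1 + t * μ ∈ slitPlane := by
  simpa using StarConvex.add_smul_mem starConvex_one_slitPlane h ht.1 ht.2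

/-- The value `δ = 1 / 3` is exactly what turns the constant `1 / (4 δ)` into `3 / 4`. -/
lemma norm_elemFactor_le_of_segment {μ : ℂ} (hs : 1 + μ ∈ slitPlane)
    (h : ∀ t ∈ Set.Icc (0 : ℝ) 1, 1 / 3 ≤ ‖1 + t * μ‖) :
    ‖elemFactor μ‖ ≤ Real.exp (3 / 4 * ‖μ‖ ^ 4) := by
  rw [elemFactor_eq_exp (slitPlane_ne_zero hs), norm_exp]
  refine Real.exp_le_exp.2 ((re_le_norm _).trans ?_)
  refine (norm_log_sub_logTaylor_four_le (by norm_num)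
    (fun t ht => one_add_mul_mem_slitPlane hs ht) h).trans (le_of_eq (by ring))

lemma le_norm_elemFactor {μ : ℂ} (h : ‖μ‖ ≤ 1 / 2) :
    Real.exp (-‖μ‖ ^ 4) ≤ ‖elemFactor μ‖ := by
  have hs : 1 + μ ∈ slitPlane := by
    have := mem_slitPlane_of_norm_lt_one (z := μ) (by linarith)
    simpa using this
  rw [elemFactor_eq_exp (slitPlane_ne_zero hs), norm_exp]
  refine Real.exp_le_exp.2 ?_
  have h1 := norm_log_sub_logTaylor_four_le (δ := 1 / 2) (by norm_num)
    (fun t ht => one_add_mul_mem_slitPlane hs ht) (fun t ht => by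
      have h2 : ‖(t : ℂ) * μ‖ ≤ 1 / 2 := by
        rw [norm_mul, norm_real, Real.norm_of_nonneg ht.1]
        nlinarith [norm_nonneg μ, ht.1, ht.2]
      have h3 := norm_sub_norm_le (1 : ℂ) (-(t * μ))
      rw [norm_neg, sub_neg_eq_add, norm_one] at h3
      linarith)
  have h2 := (abs_le.1 (abs_re_le_norm (log (1 + μ) - logTaylor 4 μ))).1
  have h3 : 0 ≤ ‖μ‖ ^ 4 := by positivity
  linarith

lemma normSq_one_add_mul (μ : ℂ) (t : ℝ) :
    ‖1 + t * μ‖ ^ 2 = 1 + 2 * t * μ.re + t ^ 2 * (μ.re ^ 2 + μ.im ^ 2) := by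
  rw [← normSq_eq_norm_sq, normSq_apply]
  simp
  ring

/-- This is the tangent line of `log` at `2 / 7`, slightly weakened by replacing `log (7 / 2)` with
`5 / 4`. -/
lemma le_exp_tangent (t : ℝ) : t ≤ Real.exp (7 / 2 * t - 9 / 4) := by
  have h1 : 7 / 2 * t ≤ Real.exp (7 / 2 * t - 1) := by
    linarith [Real.add_one_le_exp (7 / 2 * t - 1)]
  have h2 : Real.exp (5 / 4) ≤ 7 / 2 := by
    refine le_of_pow_le_pow_left₀ (n := 4) (by norm_num) (by norm_num) ?_
    rw [← Real.exp_nat_mul, show ((4 : ℕ) : ℝ) * (5 / 4) = ((5 : ℕ) : ℝ) * 1 by norm_num,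
      Real.exp_nat_mul]
    refine (pow_le_pow_left₀ (Real.exp_pos 1).le Real.exp_one_lt_d9.le 5).trans (by norm_num)
  have h3 : Real.exp (7 / 2 * t - 1) = Real.exp (7 / 2 * t - 9 / 4) * Real.exp (5 / 4) := by
    rw [← Real.exp_add]
    congr 1
    ring
  have h4 := Real.exp_pos (7 / 2 * t - 9 / 4)
  nlinarith

/-- Here `x = -Re μ` and `w = (Im μ)²`. At `w = 0` the right side exceeds the left by `(x - 1)² (3
x² / 4 + 7 x / 6 - 2 / 3) + 1 / 24`. The slack `1 / 24`, attained at `x = 1`, absorbs the term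
linear in `w`. -/
lemma elemFactor_exponent_le {x w : ℝ} (hx : 0.62 ≤ x) (hw : 0 ≤ w) (hxw : 8 * w ≤ x ^ 2) :
    7 / 4 * ((1 - x) ^ 2 + w) - 9 / 8 + x + (x ^ 2 - w) / 2 + (x ^ 3 - 3 * x * w) / 3 ≤
      3 / 4 * (x ^ 2 + w) ^ 2 := by
  have h1 : 0 ≤ (x - 1) ^ 2 * (3 / 4 * x ^ 2 + 7 / 6 * x - 2 / 3) :=
    mul_nonneg (sq_nonneg _) (by nlinarith)
  have h2 : (5 / 4 - x - 3 / 2 * x ^ 2) * w ≤ 1 / 24 := by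
    rcases le_total x 1 with h | h
    · have : w ≤ 1 / 8 := by nlinarith
      have : 5 / 4 - x - 3 / 2 * x ^ 2 ≤ 1 / 10 := by nlinarith
      nlinarith
    · have : 5 / 4 - x - 3 / 2 * x ^ 2 ≤ 0 := by nlinarith
      nlinarith
  nlinarith [sq_nonneg w]

/-- The logarithmic estimate applies whenever the segment from `1` to `1 + μ` stays at distance `1 /
3` from `0`. That fails only in a thin cone around the negative axis away from `0`, where `log` is
singular at `μ = -1`; there `|1 + μ|` is bounded directly by an exponential. -/
theorem norm_elemFactor_le (μ : ℂ) : ‖elemFactor μ‖ ≤ Real.exp (3 / 4 * ‖μ‖ ^ 4) := by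
  have hr : ‖μ‖ ^ 2 = μ.re ^ 2 + μ.im ^ 2 := by
    rw [← normSq_eq_norm_sq, normSq_apply]
    ring
  have hseg : (∀ t ∈ Set.Icc (0 : ℝ) 1,
      1 / 9 ≤ 1 + 2 * t * μ.re + t ^ 2 * (μ.re ^ 2 + μ.im ^ 2)) →
      ∀ t ∈ Set.Icc (0 : ℝ) 1, 1 / 3 ≤ ‖1 + t * μ‖ := by
    intro h t ht
    refine le_of_pow_le_pow_left₀ two_ne_zero (norm_nonneg _) ?_
    rw [normSq_one_add_mul]
    exact (by norm_num : ((1 : ℝ) / 3) ^ 2 = 1 / 9).le.trans (h t ht)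
  by_cases h1 : 0 ≤ μ.re
  · refine norm_elemFactor_le_of_segment (Or.inl (by simp; linarith)) (hseg fun t ht => ?_)
    have := mul_nonneg ht.1 h1
    nlinarith [mul_nonneg (sq_nonneg t) (add_nonneg (sq_nonneg μ.re) (sq_nonneg μ.im))]
  push Not at h1
  -- The condition says that the line through `0` and `μ` has distance at least `1 / 3` from `-1`.
  by_cases h2 : μ.re ^ 2 ≤ 8 * μ.im ^ 2
  · have him : μ.im ≠ 0 := by
      intro h
      rw [h] at h2
      nlinarith
    refine norm_elemFactor_le_of_segment (Or.inr (by simpa using him)) (hseg fun t ht => ?_)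
    nlinarith [sq_nonneg (9 * t * μ.re + 8), mul_nonneg (sq_nonneg t) (sub_nonneg.2 h2)]
  push Not at h2
  by_cases h3 : μ.re ^ 2 + μ.im ^ 2 ≤ 4 / 9
  · have h4 : -(2 / 3) ≤ μ.re := by nlinarith [sq_nonneg μ.im]
    refine norm_elemFactor_le_of_segment (Or.inl (by simp; linarith)) (fun t ht => ?_)
    have h5 : ‖μ‖ ≤ 2 / 3 := by
      refine le_of_pow_le_pow_left₀ two_ne_zero (by norm_num) ?_
      rw [hr]
      linarith
    have h2 : ‖(t : ℂ) * μ‖ ≤ 2 / 3 := by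
      rw [norm_mul, norm_real, Real.norm_of_nonneg ht.1]
      nlinarith [norm_nonneg μ, ht.1, ht.2]
    have h3 := norm_sub_norm_le (1 : ℂ) (-(t * μ))
    rw [norm_neg, sub_neg_eq_add, norm_one] at h3
    linarith
  push Not at h3
  have hx : 0.62 ≤ -μ.re := by nlinarith
  have key := elemFactor_exponent_le hx (sq_nonneg μ.im) (by nlinarith)
  have h5 : ‖1 + μ‖ ^ 2 = (1 - -μ.re) ^ 2 + μ.im ^ 2 := by
    have := normSq_one_add_mul μ 1
    simp only [ofReal_one, one_mul] at this
    rw [this]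
    ring
  have h6 : ‖1 + μ‖ ≤ Real.exp (7 / 4 * ((1 - -μ.re) ^ 2 + μ.im ^ 2) - 9 / 8) := by
    refine le_of_pow_le_pow_left₀ two_ne_zero (Real.exp_pos _).le ?_
    rw [h5, ← Real.exp_nat_mul]
    refine (le_exp_tangent _).trans (le_of_eq ?_)
    congr 1
    push_cast
    ring
  have h7 : (-μ + μ ^ 2 / 2 - μ ^ 3 / 3).re =
      -μ.re + ((-μ.re) ^ 2 - μ.im ^ 2) / 2 + ((-μ.re) ^ 3 - 3 * (-μ.re) * μ.im ^ 2) / 3 := by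
    have e2 : (μ ^ 2 / 2).re = (μ ^ 2).re / 2 := by
      rw [show (2 : ℂ) = ((2 : ℝ) : ℂ) by norm_num, div_ofReal_re]
    have e3 : (μ ^ 3 / 3).re = (μ ^ 3).re / 3 := by
      rw [show (3 : ℂ) = ((3 : ℝ) : ℂ) by norm_num, div_ofReal_re]
    rw [sub_re, add_re, neg_re, e2, e3]
    simp only [pow_succ, pow_zero, one_mul, mul_re, mul_im]
    ring
  rw [elemFactor, norm_mul, norm_exp, h7]
  refine (mul_le_mul_of_nonneg_right h6 (Real.exp_pos _).le).trans ?_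
  rw [← Real.exp_add]
  refine Real.exp_le_exp.2 ?_
  rw [show ‖μ‖ ^ 4 = ((-μ.re) ^ 2 + μ.im ^ 2) ^ 2 by rw [neg_sq, ← hr]; ring]
  linarith

/-! ### Schur triangularization, `det₄` and its rank-one perturbations in finite dimension. -/

section FiniteDim

variable {F : Type*} [NormedAddCommGroup F] [InnerProductSpace ℂ F]

/-- Every endomorphism of a finite-dimensional complex inner product space is upper triangular
in some orthonormal basis. -/
theorem exists_orthonormalBasis_triangular (n : ℕ) :
    ∀ {F : Type*} [NormedAddCommGroup F] [InnerProductSpace ℂ F] [FiniteDimensional ℂ F]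
      (_ : Module.finrank ℂ F = n) (K : Module.End ℂ F),
      ∃ e : OrthonormalBasis (Fin n) ℂ F, ∀ i j, j < i → inner ℂ (e i) (K (e j)) = 0 := by
  induction n with
  | zero =>
    intro F _ _ _ hn K
    exact ⟨(stdOrthonormalBasis ℂ F).reindex (finCongr hn), fun i => i.elim0⟩
  | succ n ih =>
    intro F _ _ _ hn K
    have : Nontrivial F := Module.nontrivial_of_finrank_pos (R := ℂ) (by omega)
    obtain ⟨c, hc⟩ := Module.End.exists_eigenvalue K
    obtain ⟨v, hv⟩ := hc.exists_hasEigenvector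
    set u : F := ((‖v‖⁻¹ : ℝ) : ℂ) • v
    have hu : ‖u‖ = 1 := by
      have := norm_ne_zero_iff.2 hv.2
      simp only [u, norm_smul, norm_real, norm_inv, norm_norm]
      field_simp
    have hKu : K u = c • u := by
      simp only [u, map_smul, hv.apply_eq_smul]
      rw [smul_comm]
    have hu0 : u ≠ 0 := norm_ne_zero_iff.1 (by rw [hu]; norm_num)
    set W : Submodule ℂ F := (ℂ ∙ u)ᗮ
    have hW : Module.finrank ℂ W = n := by
      have h1 := Submodule.finrank_add_finrank_orthogonal (ℂ ∙ u)
      rw [finrank_span_singleton hu0] at h1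
      change Module.finrank ℂ (ℂ ∙ u)ᗮ = n
      omega
    -- The orthogonal complement of an eigenvector need not be invariant, so the induction uses the
    -- compression to it. The discarded component along `u` lies above the diagonal.
    let K' : Module.End ℂ W := W.orthogonalProjectionOnto.toLinearMap ∘ₗ K ∘ₗ W.subtype
    obtain ⟨e, he⟩ := ih hW K'
    have huW : ∀ w : W, inner ℂ u (w : F) = 0 := fun w =>
      Submodule.mem_orthogonal_singleton_iff_inner_right.1 w.2
    have hWu : ∀ w : W, inner ℂ (w : F) u = 0 := fun w =>
      Submodule.mem_orthogonal_singleton_iff_inner_left.1 w.2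
    have hon : Orthonormal ℂ (Fin.cons u (fun i => (e i : F)) : Fin (n + 1) → F) := by
      rw [orthonormal_iff_ite]
      intro i j
      refine Fin.cases ?_ (fun i => ?_) i <;> refine Fin.cases ?_ (fun j => ?_) j
      · simp [inner_self_eq_norm_sq_to_K, hu]
      · simpa [(Fin.succ_ne_zero j).symm] using huW (e j)
      · simpa using hWu (e i)
      · simpa using orthonormal_iff_ite.1 e.orthonormal i j
    let b := basisOfOrthonormalOfCardEqFinrank hon (by simp [hn])
    have hb : ⇑b = Fin.cons u (fun i => (e i : F)) := coe_basisOfOrthonormalOfCardEqFinrank _ _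
    refine ⟨b.toOrthonormalBasis (by rw [hb]; exact hon), ?_⟩
    intro i j
    rw [Module.Basis.coe_toOrthonormalBasis, hb]
    refine Fin.cases ?_ (fun i => ?_) i <;> refine Fin.cases ?_ (fun j => ?_) j
    · simp
    · simp
    · intro _
      simp only [Fin.cons_succ, Fin.cons_zero, hKu, inner_smul_right, hWu, mul_zero]
    · intro hij
      have h1 := he i j (by simpa using hij)
      simp only [Fin.cons_succ]
      rw [← h1]
      simp only [K', LinearMap.comp_apply, Submodule.subtype_apply, ContinuousLinearMap.coe_coe]
      rw [Submodule.coe_inner]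
      exact (Submodule.inner_orthogonalProjectionOnto_eq_of_mem_left (e i) _).symm

/-- The regularized determinant `det₄ (1 + M)` of a matrix. -/
def matrixDetFour {n : Type*} [Fintype n] [DecidableEq n] (M : Matrix n n ℂ) : ℂ :=
  (1 + M).det * exp (-M.trace + (M ^ 2).trace / 2 - (M ^ 3).trace / 3)

/-- The regularized determinant `det₄ (1 + K)` of an endomorphism. -/
def detFour (K : Module.End ℂ F) : ℂ :=
  LinearMap.det (1 + K) * exp (-LinearMap.trace ℂ F K + LinearMap.trace ℂ F (K ^ 2) / 2 -
    LinearMap.trace ℂ F (K ^ 3) / 3)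

lemma detFour_eq_matrixDetFour {n : Type*} [Fintype n] [DecidableEq n]
    (e : OrthonormalBasis n ℂ F) (K : Module.End ℂ F) :
    detFour K = matrixDetFour (Matrix.of fun i j => inner ℂ (e i) (K (e j))) := by
  have h : (Matrix.of fun i j => inner ℂ (e i) (K (e j))) =
      LinearMap.toMatrixAlgEquiv e.toBasis K := by
    ext i j
    rw [LinearMap.toMatrixAlgEquiv_apply]
    simp [OrthonormalBasis.repr_apply_apply]
  rw [h, detFour, matrixDetFour, ← map_one (LinearMap.toMatrixAlgEquiv e.toBasis), ← map_add,
    ← map_pow, ← map_pow]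
  simp only [LinearMap.trace_eq_matrix_trace ℂ e.toBasis]
  congr 1
  exact (LinearMap.det_toMatrix e.toBasis _).symm

lemma trace_pow_fromBlocks {m n : Type*} [Fintype m] [Fintype n] [DecidableEq m] [DecidableEq n]
    (A : Matrix m m ℂ) (B : Matrix m n ℂ) (D : Matrix n n ℂ) (k : ℕ) :
    ((Matrix.fromBlocks A B 0 D) ^ k).trace = (A ^ k).trace + (D ^ k).trace := by
  have : ∃ B', (Matrix.fromBlocks A B 0 D) ^ k = Matrix.fromBlocks (A ^ k) B' 0 (D ^ k) := by
    induction k with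
    | zero => exact ⟨0, by simp [Matrix.fromBlocks_one]⟩
    | succ k ih =>
      obtain ⟨B', hB'⟩ := ih
      exact ⟨A ^ k * B + B' * D, by rw [pow_succ, hB', Matrix.fromBlocks_multiply]; simp [pow_succ]⟩
  obtain ⟨B', hB'⟩ := this
  rw [hB']
  simp [Matrix.trace, Fintype.sum_sum_type]

lemma matrixDetFour_fromBlocks {m n : Type*} [Fintype m] [Fintype n] [DecidableEq m]
    [DecidableEq n] (A : Matrix m m ℂ) (B : Matrix m n ℂ) (D : Matrix n n ℂ) :
    matrixDetFour (Matrix.fromBlocks A B 0 D) = matrixDetFour A * matrixDetFour D := by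
  have h1 : 1 + Matrix.fromBlocks A B 0 D = Matrix.fromBlocks (1 + A) B 0 (1 + D) := by
    rw [← Matrix.fromBlocks_one, Matrix.fromBlocks_add]
    simp
  have h2 : (Matrix.fromBlocks A B 0 D).trace = A.trace + D.trace := by
    simpa using trace_pow_fromBlocks A B D 1
  rw [matrixDetFour, matrixDetFour, matrixDetFour, h1, Matrix.det_fromBlocks_zero₂₁,
    trace_pow_fromBlocks, trace_pow_fromBlocks, h2, mul_mul_mul_comm,
    ← exp_add]
  congr 2
  ring

lemma trace_pow_of_triangular {n : Type*} [Fintype n] [LinearOrder n] {M : Matrix n n ℂ}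
    (h : M.BlockTriangular id) (k : ℕ) : (M ^ k).trace = ∑ i, M i i ^ k := by
  have : (M ^ k).BlockTriangular id ∧ ∀ i, (M ^ k) i i = M i i ^ k := by
    induction k with
    | zero => exact ⟨by rw [pow_zero]; exact Matrix.blockTriangular_one, by simp⟩
    | succ k ih =>
      refine ⟨by rw [pow_succ]; exact ih.1.mul h, fun i => ?_⟩
      rw [pow_succ, Matrix.mul_apply, pow_succ, ← ih.2 i]
      refine Finset.sum_eq_single i (fun j _ hj => ?_) (by simp)
      rcases lt_or_gt_of_ne hj with h1 | h1
      · rw [ih.1 h1, zero_mul]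
      · rw [h h1, mul_zero]
  exact Finset.sum_congr rfl fun i _ => this.2 i

lemma matrixDetFour_of_triangular {n : Type*} [Fintype n] [LinearOrder n] {M : Matrix n n ℂ}
    (h : M.BlockTriangular id) : matrixDetFour M = ∏ i, elemFactor (M i i) := by
  have h1 : (1 + M).BlockTriangular id := Matrix.blockTriangular_one.add h
  have h2 := trace_pow_of_triangular h 1
  simp only [pow_one] at h2
  simp only [matrixDetFour, elemFactor]
  rw [Matrix.det_of_isUpperTriangular h1, trace_pow_of_triangular h, trace_pow_of_triangular h, h2,
    Finset.prod_mul_distrib, ← exp_sum]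
  congr 1
  · simp
  · congr 1
    simp [Finset.sum_add_distrib, Finset.sum_sub_distrib, Finset.sum_div]

lemma exists_detFour_eq_prod [FiniteDimensional ℂ F] (K : Module.End ℂ F) :
    ∃ e : OrthonormalBasis (Fin (Module.finrank ℂ F)) ℂ F,
      detFour K = ∏ i, elemFactor (inner ℂ (e i) (K (e i))) := by
  obtain ⟨e, he⟩ := exists_orthonormalBasis_triangular _ rfl K
  refine ⟨e, ?_⟩
  rw [detFour_eq_matrixDetFour e]
  exact matrixDetFour_of_triangular (fun i j h => he i j h)

/-- `s` bounds the `ℓᵖ` norm of the diagonal of `A` in every orthonormal family. -/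
def DiagBound {H : Type*} [NormedAddCommGroup H] [InnerProductSpace ℂ H] (p : ℕ) (A : H → H)
    (s : ℝ) : Prop :=
  ∀ (n : ℕ) (e : Fin n → H), Orthonormal ℂ e → ∑ i, ‖inner ℂ (e i) (A (e i))‖ ^ p ≤ s ^ p

/-- In a triangularizing orthonormal basis `det₄` is the product of the elementary factors of the
diagonal, so the scalar bound and the diagonal bound combine. No inequality between eigenvalues and
singular values is needed. -/
lemma norm_detFour_le [FiniteDimensional ℂ F] {K : Module.End ℂ F} {s : ℝ} (h : DiagBound 4 K s) :
    ‖detFour K‖ ≤ Real.exp (3 / 4 * s ^ 4) := by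
  obtain ⟨e, he⟩ := exists_detFour_eq_prod K
  rw [he, norm_prod]
  refine (Finset.prod_le_prod (fun i _ => norm_nonneg _) fun i _ => norm_elemFactor_le _).trans ?_
  rw [← Real.exp_sum, ← Finset.mul_sum]
  exact Real.exp_le_exp.2 (mul_le_mul_of_nonneg_left (h _ e e.orthonormal) (by norm_num))

/-- This is Minkowski's inequality in `ℓ⁴`, applied to the diagonals in each family. -/
lemma DiagBound.add {H : Type*} [NormedAddCommGroup H] [InnerProductSpace ℂ H] {A B : H → H}
    {s t : ℝ} (hs : 0 ≤ s) (ht : 0 ≤ t) (hA : DiagBound 4 A s) (hB : DiagBound 4 B t) :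
    DiagBound 4 (A + B) (s + t) := by
  intro n e he
  have h1 := Real.Lp_add_le_of_nonneg (p := 4) (s := Finset.univ)
    (f := fun i => ‖inner ℂ (e i) (A (e i))‖) (g := fun i => ‖inner ℂ (e i) (B (e i))‖)
    (by norm_num) (fun i _ => norm_nonneg _) (fun i _ => norm_nonneg _)
  have h2 : ∀ {a : ℝ} {c : Fin n → ℝ}, 0 ≤ a → ∑ i, c i ^ 4 ≤ a ^ 4 →
      (∑ i, c i ^ (4 : ℝ)) ^ (1 / (4 : ℝ)) ≤ a := by
    intro a c ha hc
    have h3 : ∑ i, c i ^ (4 : ℝ) = ∑ i, c i ^ 4 :=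
      Finset.sum_congr rfl fun i _ => by exact_mod_cast Real.rpow_natCast (c i) 4
    rw [h3]
    refine (Real.rpow_le_rpow (Finset.sum_nonneg fun i _ => by positivity) hc
      (by norm_num)).trans (le_of_eq ?_)
    rw [one_div]
    exact_mod_cast Real.pow_rpow_inv_natCast ha (by norm_num : (4 : ℕ) ≠ 0)
  have h4 := h1.trans (add_le_add (h2 hs (hA n e he)) (h2 ht (hB n e he)))
  set S := ∑ i, (‖inner ℂ (e i) (A (e i))‖ + ‖inner ℂ (e i) (B (e i))‖) ^ (4 : ℝ)
  have hS : 0 ≤ S := Finset.sum_nonneg fun i _ => by positivity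
  have h5 : S ≤ (s + t) ^ 4 := by
    have h6 := pow_le_pow_left₀ (by positivity) h4 4
    rwa [one_div, ← Real.rpow_natCast, ← Real.rpow_mul hS,
      show (4 : ℝ)⁻¹ * ((4 : ℕ) : ℝ) = 1 by norm_num, Real.rpow_one] at h6
  refine le_trans (Finset.sum_le_sum fun i _ => ?_) h5
  have h7 : (‖inner ℂ (e i) (A (e i))‖ + ‖inner ℂ (e i) (B (e i))‖) ^ (4 : ℝ) =
      (‖inner ℂ (e i) (A (e i))‖ + ‖inner ℂ (e i) (B (e i))‖) ^ 4 := by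
    exact_mod_cast Real.rpow_natCast _ 4
  rw [h7]
  refine pow_le_pow_left₀ (norm_nonneg _) ?_ 4
  rw [Pi.add_apply, inner_add_right]
  exact norm_add_le _ _

/-- Cauchy–Schwarz and Bessel bound the diagonal even in `ℓ¹`, which dominates `ℓ⁴`. -/
lemma diagBound_rankOne {H : Type*} [NormedAddCommGroup H] [InnerProductSpace ℂ H] (x y : H) :
    DiagBound 4 (fun v => inner ℂ y v • x) (‖x‖ * ‖y‖) := by
  intro n e he
  have h1 : ∑ i, ‖inner ℂ (e i) x‖ * ‖inner ℂ (e i) y‖ ≤ ‖x‖ * ‖y‖ := by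
    refine (Real.sum_mul_le_sqrt_mul_sqrt _ _ _).trans ?_
    exact mul_le_mul (Real.sqrt_le_iff.2 ⟨norm_nonneg _, he.sum_inner_products_le x⟩)
      (Real.sqrt_le_iff.2 ⟨norm_nonneg _, he.sum_inner_products_le y⟩) (Real.sqrt_nonneg _)
      (norm_nonneg _)
  have h2 : ∀ i, ‖inner ℂ (e i) (inner ℂ y (e i) • x)‖ =
      ‖inner ℂ (e i) x‖ * ‖inner ℂ (e i) y‖ := fun i => by
    rw [inner_smul_right, norm_mul, norm_inner_symm y, mul_comm]
  simp only [h2]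
  refine le_trans ?_ (pow_le_pow_left₀ (Finset.sum_nonneg fun i _ => by positivity) h1 4)
  rw [pow_succ _ 3, Finset.mul_sum]
  refine Finset.sum_le_sum fun i hi => ?_
  rw [pow_succ _ 3]
  refine mul_le_mul_of_nonneg_right (pow_le_pow_left₀ (by positivity) ?_ 3) (by positivity)
  exact Finset.single_le_sum (f := fun i => ‖inner ℂ (e i) x‖ * ‖inner ℂ (e i) y‖)
    (fun i _ => by positivity) hi

/-- Because the range vector is `(1 + K) z`, the perturbed `1 + K` factors as `(1 + K)` times a
transvection, so no inverse appears. The traces are polynomials in `c`; the formula shows that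
`det₄` is entire in `c` and gives its derivative. -/
lemma detFour_add_rankOne_eq [FiniteDimensional ℂ F] (K : Module.End ℂ F) (y z : F) (c : ℂ) :
    detFour (K + c • (innerSL ℂ y).toLinearMap.smulRight (z + K z)) =
      LinearMap.det (1 + K) * (1 + c * inner ℂ y z) *
      exp (-(LinearMap.trace ℂ F K + c * inner ℂ y (z + K z)) +
        (LinearMap.trace ℂ F (K ^ 2) + 2 * c * inner ℂ y (K (z + K z)) +
          c ^ 2 * inner ℂ y (z + K z) ^ 2) / 2 -
        (LinearMap.trace ℂ F (K ^ 3) + 3 * c * inner ℂ y (K (K (z + K z))) +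
          3 * c ^ 2 * inner ℂ y (z + K z) * inner ℂ y (K (z + K z)) +
          c ^ 3 * inner ℂ y (z + K z) ^ 3) / 3) := by
  set x := z + K z with hx
  set B : Module.End ℂ F := (innerSL ℂ y).toLinearMap.smulRight x with hB
  have hBv : ∀ v, B v = inner ℂ y v • x := fun v => by simp [hB]
  have hdet : LinearMap.det (1 + (K + c • B)) = LinearMap.det (1 + K) * (1 + c * inner ℂ y z) := by
    have h1 : 1 + (K + c • B) =
        (1 + K) * LinearMap.transvection (c • (innerSL ℂ y).toLinearMap) z := by
      ext v
      simp [LinearMap.transvection.apply, hBv, hx, smul_smul]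
      abel
    rw [h1, map_mul, LinearMap.transvection.det]
    simp
  have htr : ∀ A : Module.End ℂ F, LinearMap.trace ℂ F (A * B) = inner ℂ y (A x) := by
    intro A
    have : A * B = (innerSL ℂ y).toLinearMap.smulRight (A x) := by
      ext v
      simp [hBv]
    rw [this, LinearMap.trace_smulRight]
    simp
  have hBB : B * B = inner ℂ y x • B := by
    ext v
    simp [hBv, smul_smul, mul_comm]
  have t1 : LinearMap.trace ℂ F B = inner ℂ y x := by simpa using htr 1
  have t2 : LinearMap.trace ℂ F (B * K) = inner ℂ y (K x) := by
    rw [LinearMap.trace_mul_comm]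
    exact htr K
  have t3 : ∀ A : Module.End ℂ F, LinearMap.trace ℂ F (B * A) = inner ℂ y (A x) := fun A => by
    rw [LinearMap.trace_mul_comm]
    exact htr A
  have e2 : LinearMap.trace ℂ F ((K + c • B) ^ 2) = LinearMap.trace ℂ F (K ^ 2) +
      2 * c * inner ℂ y (K x) + c ^ 2 * inner ℂ y x ^ 2 := by
    have : (K + c • B) ^ 2 = K ^ 2 + c • (K * B) + c • (B * K) + c ^ 2 • (B * B) := by
      simp only [pow_two, add_mul, mul_add, smul_mul_assoc, mul_smul_comm, smul_smul, smul_add]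
      abel
    rw [this, hBB]
    simp only [map_add, map_smul, htr, t2, t1, smul_eq_mul]
    ring
  have e3 : LinearMap.trace ℂ F ((K + c • B) ^ 3) = LinearMap.trace ℂ F (K ^ 3) +
      3 * c * inner ℂ y (K (K x)) + 3 * c ^ 2 * inner ℂ y x * inner ℂ y (K x) +
      c ^ 3 * inner ℂ y x ^ 3 := by
    have h2 : (K + c • B) ^ 3 = K ^ 3 + c • (K * K * B) + c • (K * B * K) + c • (B * (K * K)) +
        c ^ 2 • (K * (B * B)) + c ^ 2 • (B * K * B) + c ^ 2 • (B * B * K) +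
        c ^ 3 • (B * B * B) := by
      simp only [pow_succ, pow_zero, one_mul, add_mul, mul_add, smul_mul_assoc, mul_smul_comm,
        smul_smul, smul_add, mul_assoc]
      abel
    have h3 : LinearMap.trace ℂ F (K * B * K) = inner ℂ y (K (K x)) := by
      rw [mul_assoc, LinearMap.trace_mul_comm, mul_assoc, t3]
      rfl
    have h4 : LinearMap.trace ℂ F (B * K * B) = inner ℂ y x * inner ℂ y (K x) := by
      rw [mul_assoc, LinearMap.trace_mul_comm, mul_assoc, hBB]
      simp [htr]
    rw [h2, hBB]
    simp only [map_add, map_smul, smul_eq_mul, mul_smul_comm, smul_mul_assoc, hBB, h3, h4, htr, t3,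
      t1, Module.End.mul_apply]
    ring
  rw [detFour, hdet, e2, e3, map_add (LinearMap.trace ℂ F), map_smul, t1, smul_eq_mul]

/-- If the diagonals of `K` are bounded by `s` in `ℓ⁴`, then `K³ (1 + K)⁻¹ det₄ (1 + K)` has norm
at most `e^{3 (s + 1)⁴ / 4}`. -/
theorem norm_detFour_mul_norm_le [FiniteDimensional ℂ F] {K : Module.End ℂ F} {s : ℝ} (hs : 0 ≤ s)
    (h : DiagBound 4 K s) (z : F) :
    ‖detFour K‖ * ‖K (K (K z))‖ ≤ Real.exp (3 / 4 * (s + 1) ^ 4) * ‖z + K z‖ := by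
  set x := z + K z with hx
  set y := K (K (K z)) with hy
  rcases eq_or_ne y 0 with h0 | hy0
  · rw [h0, norm_zero, mul_zero]
    positivity
  by_cases hd : LinearMap.det (1 + K) = 0
  · rw [detFour, hd, zero_mul, norm_zero, zero_mul]
    positivity
  have hx0 : x ≠ 0 := by
    intro hx0
    have h1 := LinearMap.bot_lt_ker_of_det_eq_zero (f := (1 + K))
    have h2 : LinearMap.ker (1 + K) = ⊥ := by
      by_contra h3
      refine hd ?_
      by_contra h4
      exact h3 (LinearMap.ker_eq_bot.2
        (LinearMap.equivOfDetNeZero (1 + K) h4).injective)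
    have h3 : z = 0 := by
      rw [← Submodule.mem_bot ℂ, ← h2]
      simpa using hx0
    exact hy0 (by rw [hy, h3]; simp)
  have hny : 0 < ‖y‖ := norm_pos_iff.2 hy0
  have hnx : 0 < ‖x‖ := norm_pos_iff.2 hx0
  set B : Module.End ℂ F := (innerSL ℂ y).toLinearMap.smulRight x with hB
  set f : ℂ → ℂ := fun c => detFour (K + c • B) with hf
  have hfeq : f = fun c => LinearMap.det (1 + K) * (1 + c * inner ℂ y z) *
      exp (-(LinearMap.trace ℂ F K + c * inner ℂ y x) +
        (LinearMap.trace ℂ F (K ^ 2) + 2 * c * inner ℂ y (K x) +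
          c ^ 2 * inner ℂ y x ^ 2) / 2 -
        (LinearMap.trace ℂ F (K ^ 3) + 3 * c * inner ℂ y (K (K x)) +
          3 * c ^ 2 * inner ℂ y x * inner ℂ y (K x) + c ^ 3 * inner ℂ y x ^ 3) / 3) :=
    funext fun c => detFour_add_rankOne_eq K y z c
  have hdiff : Differentiable ℂ f := by
    rw [hfeq]
    fun_prop
  have hf0 : f 0 = detFour K := by simp [hf]
  have hderiv : deriv f 0 = -(detFour K * inner ℂ y y) := by
    have h1 : HasDerivAt f (LinearMap.det (1 + K) * inner ℂ y z *
        exp (-LinearMap.trace ℂ F K + LinearMap.trace ℂ F (K ^ 2) / 2 -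
          LinearMap.trace ℂ F (K ^ 3) / 3) + LinearMap.det (1 + K) *
        (exp (-LinearMap.trace ℂ F K + LinearMap.trace ℂ F (K ^ 2) / 2 -
          LinearMap.trace ℂ F (K ^ 3) / 3) * (-inner ℂ y x + inner ℂ y (K x) -
            inner ℂ y (K (K x))))) 0 := by
      rw [hfeq]
      have d1 : ∀ a b c d : ℂ, HasDerivAt (fun t : ℂ => a + b * t + c * t ^ 2 + d * t ^ 3) b 0 := by
        intro a b c d
        have := ((((hasDerivAt_id (0 : ℂ)).const_mul b).const_add a).add
          ((hasDerivAt_pow 2 (0 : ℂ)).const_mul c)).add ((hasDerivAt_pow 3 (0 : ℂ)).const_mul d)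
        convert! this using 1
        simp
      have d2 := d1 (LinearMap.det (1 + K)) (LinearMap.det (1 + K) * inner ℂ y z) 0 0
      have d3 := (d1 (-LinearMap.trace ℂ F K + LinearMap.trace ℂ F (K ^ 2) / 2 -
          LinearMap.trace ℂ F (K ^ 3) / 3) (-inner ℂ y x + inner ℂ y (K x) - inner ℂ y (K (K x)))
          (inner ℂ y x ^ 2 / 2 - inner ℂ y x * inner ℂ y (K x)) (-(inner ℂ y x ^ 3 / 3))).cexp
      convert! d2.mul d3 using 1
      · funext c
        simp only [Pi.mul_apply]
        congr 1
        · ring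
        · congr 1
          ring
      · simp
    rw [h1.deriv, detFour]
    -- With `x = z + K z`, the sum `z - x + K x - K² x` telescopes to `-K³ z = -y`. The three trace
    -- corrections of `det₄` are what leave the cube of `K`.
    have h2 : (inner ℂ y y : ℂ) = -(inner ℂ y z - inner ℂ y x + inner ℂ y (K x) -
        inner ℂ y (K (K x))) := by
      rw [← inner_sub_right, ← inner_add_right, ← inner_sub_right, ← inner_neg_right]
      congr 1
      simp only [hx, hy, map_add]
      abel
    rw [h2]
    ring
  -- On this circle the rank-one perturbation has norm exactly `1`, which is the `1` in `s + 1`.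
  have hR : 0 < 1 / (‖x‖ * ‖y‖) := by positivity
  have hbound : ∀ c ∈ Metric.sphere (0 : ℂ) (1 / (‖x‖ * ‖y‖)),
      ‖f c‖ ≤ Real.exp (3 / 4 * (s + 1) ^ 4) := by
    intro c hc
    rw [mem_sphere_zero_iff_norm] at hc
    refine norm_detFour_le ?_
    have h1 := h.add hs zero_le_one (B := fun v => inner ℂ y v • (c • x)) (by
      have := diagBound_rankOne (c • x) y
      rwa [norm_smul, hc, show 1 / (‖x‖ * ‖y‖) * ‖x‖ * ‖y‖ = 1 by field_simp] at this)
    convert! h1 using 1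
    funext v
    simp only [hB, Pi.add_apply, LinearMap.add_apply, LinearMap.smul_apply,
      LinearMap.smulRight_apply]
    rw [smul_comm]
    rfl
  have key := Complex.norm_deriv_le_of_forall_mem_sphere_norm_le hR hdiff.diffContOnCl hbound
  rw [hderiv, norm_neg, norm_mul, inner_self_eq_norm_sq_to_K] at key
  simp only [coe_algebraMap, norm_pow, norm_real, norm_norm, div_div_eq_mul_div, div_one] at key
  have : ‖detFour K‖ * ‖y‖ * ‖y‖ ≤ Real.exp (3 / 4 * (s + 1) ^ 4) * ‖x‖ * ‖y‖ := by
    linarith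
  exact le_of_mul_le_mul_right this hny

end FiniteDim

/-! ### Generalized eigenspaces and the eigenvalue count forced by a diagonal bound. -/

section InvariantSubspace

variable {F : Type*} [NormedAddCommGroup F] [InnerProductSpace ℂ F]

lemma roots_charpoly_of_triangular [FiniteDimensional ℂ F] {n : ℕ}
    (e : OrthonormalBasis (Fin n) ℂ F)
    (K : Module.End ℂ F) (he : ∀ i j, j < i → inner ℂ (e i) (K (e j)) = 0) :
    K.charpoly.roots = Finset.univ.val.map fun i => inner ℂ (e i) (K (e i)) := by
  have h : LinearMap.toMatrix e.toBasis e.toBasis K =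
      (Matrix.of fun i j => inner ℂ (e i) (K (e j))) := by
    ext i j
    rw [LinearMap.toMatrix_apply]
    simp [OrthonormalBasis.repr_apply_apply]
  have h2 := Matrix.charpoly_of_isUpperTriangular
    (Matrix.of fun i j => inner ℂ (e i) (K (e j))) (fun i j hij => he i j hij)
  rw [← LinearMap.charpoly_toMatrix K e.toBasis, h, h2]
  simp only [Matrix.of_apply]
  rw [Finset.prod_eq_multiset_prod]
  exact (congrArg Polynomial.roots (by rw [Multiset.map_map]; rfl)).trans
    (Polynomial.roots_multiset_prod_X_sub_C _)

variable {H : Type*} [NormedAddCommGroup H] [InnerProductSpace ℂ H]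

/-- Triangularize `N` on `W`. Every diagonal entry is an eigenvalue with an eigenvector in `W`,
hence equals `μ`, and the diagonal bound counts the entries. -/
lemma finrank_mul_le_of_le_maxGenEigenspace {N : Module.End ℂ H} {s : ℝ} (hN : DiagBound 4 N s)
    (W : Submodule ℂ H) [FiniteDimensional ℂ W] (hW : ∀ x ∈ W, N x ∈ W) (μ : ℂ)
    (hμ : W ≤ N.maxGenEigenspace μ) : Module.finrank ℂ W * ‖μ‖ ^ 4 ≤ s ^ 4 := by
  set K : Module.End ℂ W := N.restrict hW with hK
  obtain ⟨e, he⟩ := exists_orthonormalBasis_triangular _ rfl K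
  have hroots := roots_charpoly_of_triangular e K he
  have hdiag : ∀ i, inner ℂ (e i : H) (N (e i)) = μ := by
    intro i
    have h1 : inner ℂ (e i : H) (N (e i)) ∈ K.charpoly.roots := by
      rw [hroots]
      exact Multiset.mem_map.2 ⟨i, Finset.mem_univ_val i, rfl⟩
    have h2 := (Polynomial.mem_roots'.1 h1).2
    rw [← Module.End.hasEigenvalue_iff_isRoot_charpoly] at h2
    obtain ⟨v, hv⟩ := h2.exists_hasEigenvector
    by_contra hne
    refine hv.2 (Subtype.ext ?_)
    have h3 : N v = inner ℂ (e i : H) (N (e i)) • (v : H) := congrArg Subtype.val hv.apply_eq_smul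
    have h4 : (v : H) ∈ N.genEigenspace (inner ℂ (e i : H) (N (e i))) 1 := by
      rw [Module.End.mem_genEigenspace_one]
      exact h3
    have h5 := (N.disjoint_genEigenspace hne 1 ⊤).le_bot ⟨h4, hμ v.2⟩
    simpa using h5
  have h6 := hN _ (fun i => (e i : H)) (e.orthonormal.comp_linearIsometry W.subtypeₗᵢ)
  simpa [hdiag] using h6

/-- The generalized eigenspace is not yet known to be finite-dimensional. The orbits of the finitely
many vectors of `t` under `N - μ` are finite up to zeros, so they span a finite-dimensional
invariant subspace to which the previous count applies. -/
lemma card_mul_le_of_linearIndependent {N : Module.End ℂ H} {s : ℝ} (hN : DiagBound 4 N s) (μ : ℂ)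
    (t : Finset H) (ht : ∀ x ∈ t, x ∈ N.maxGenEigenspace μ)
    (hli : LinearIndependent ℂ (fun x : t => (x : H))) : t.card * ‖μ‖ ^ 4 ≤ s ^ 4 := by
  classical
  set A : Module.End ℂ H := N - μ • 1 with hA
  have hk : ∀ x : H, ∃ k : ℕ, x ∈ t → (A ^ k) x = 0 := by
    intro x
    by_cases hx : x ∈ t
    · obtain ⟨k, hk⟩ := (Module.End.mem_maxGenEigenspace _ _ _).1 (ht x hx)
      exact ⟨k, fun _ => hk⟩
    · exact ⟨0, fun h => absurd h hx⟩
  choose k hk using hk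
  set m := t.sup k
  have hm : ∀ x ∈ t, ∀ i, m ≤ i → (A ^ i) x = 0 := by
    intro x hx i hi
    obtain ⟨j, rfl⟩ := Nat.exists_eq_add_of_le ((Finset.le_sup hx).trans hi)
    rw [add_comm, pow_add, Module.End.mul_apply, hk x hx, map_zero]
  set W : Submodule ℂ H :=
    Submodule.span ℂ (((Finset.range (m + 1) ×ˢ t).image fun p => (A ^ p.1) p.2 : Finset H) : Set H)
    with hW
  have hmem : ∀ x ∈ t, ∀ i, (A ^ i) x ∈ W := by
    intro x hx i
    by_cases hi : m ≤ i
    · rw [hm x hx i hi]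
      exact W.zero_mem
    · refine Submodule.subset_span ?_
      simp only [Finset.coe_image, Set.mem_image, Finset.mem_coe, Finset.mem_product]
      exact ⟨(i, x), ⟨Finset.mem_range.2 (by omega), hx⟩, rfl⟩
  have hind : ∀ (P : H → Prop), (∀ x ∈ t, ∀ i, P ((A ^ i) x)) → P 0 →
      (∀ x y, P x → P y → P (x + y)) → (∀ (a : ℂ) x, P x → P (a • x)) → ∀ x ∈ W, P x := by
    intro P h1 h2 h3 h4 x hx
    refine Submodule.span_induction (p := fun x _ => P x) ?_ h2 (fun x y _ _ => h3 x y)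
      (fun a x _ => h4 a x) hx
    intro y hy
    simp only [Finset.coe_image, Set.mem_image, Finset.mem_coe, Finset.mem_product] at hy
    obtain ⟨p, hp, rfl⟩ := hy
    exact h1 _ hp.2 _
  have hAW : ∀ x ∈ W, A x ∈ W := by
    refine hind _ (fun x hx i => ?_) (by simp) (fun x y hx hy => ?_) (fun a x hx => ?_)
    · rw [← Module.End.mul_apply, ← pow_succ']
      exact hmem x hx _
    · rw [map_add]
      exact W.add_mem hx hy
    · rw [map_smul]
      exact W.smul_mem a hx
  have hNW : ∀ x ∈ W, N x ∈ W := by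
    intro x hx
    have h1 : N x = A x + μ • x := by simp [hA]
    rw [h1]
    exact W.add_mem (hAW x hx) (W.smul_mem μ hx)
  have hWμ : W ≤ N.maxGenEigenspace μ := by
    refine hind _ (fun x hx i => ?_) (Submodule.zero_mem _) (fun x y => Submodule.add_mem _)
      (fun a x => Submodule.smul_mem _ a)
    rw [Module.End.mem_maxGenEigenspace]
    exact ⟨m, by rw [← hA, ← Module.End.mul_apply, ← pow_add]; exact hm x hx _ (by omega)⟩
  have hcard : t.card ≤ Module.finrank ℂ W := by
    have h1 : LinearIndependent ℂ (fun x : t => (⟨x, by simpa using hmem x x.2 0⟩ : W)) :=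
      LinearIndependent.of_comp W.subtype hli
    simpa using h1.fintype_card_le_finrank
  refine le_trans ?_ (finrank_mul_le_of_le_maxGenEigenspace hN W hNW μ hWμ)
  gcongr

lemma finiteDimensional_maxGenEigenspace {N : Module.End ℂ H} {s : ℝ} (hN : DiagBound 4 N s)
    {μ : ℂ} (hμ : μ ≠ 0) : FiniteDimensional ℂ (N.maxGenEigenspace μ) := by
  classical
  obtain ⟨n, hn⟩ := exists_nat_ge (s ^ 4 / ‖μ‖ ^ 4)
  have h : Module.rank ℂ (N.maxGenEigenspace μ) ≤ n := by
    refine rank_le fun t ht => ?_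
    have h1 := card_mul_le_of_linearIndependent hN μ (t.map ⟨_, Subtype.val_injective⟩)
      (fun x hx => by
        obtain ⟨y, _, rfl⟩ := Finset.mem_map.1 hx
        exact y.2) (by
        have h2 := ht.map' (N.maxGenEigenspace μ).subtype (Submodule.ker_subtype _)
        let φ : (t.map ⟨((↑) : N.maxGenEigenspace μ → H), Subtype.val_injective⟩ : Finset H) ≃ t :=
          { toFun := fun x => ⟨⟨x, by
              obtain ⟨y, _, hy⟩ := Finset.mem_map.1 x.2
              rw [← hy]
              exact y.2⟩, by
              obtain ⟨y, hy, hyx⟩ := Finset.mem_map.1 x.2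
              have h3 : x.1 = y.1 := hyx.symm
              simp only [h3]
              exact hy⟩
            invFun := fun y => ⟨y.1, Finset.mem_map.2 ⟨y.1, y.2, rfl⟩⟩
            left_inv := fun x => rfl
            right_inv := fun y => rfl }
        exact h2.comp φ φ.injective)
    rw [Finset.card_map] at h1
    have h3 : (0 : ℝ) < ‖μ‖ ^ 4 := by positivity
    have h4 : (t.card : ℝ) ≤ s ^ 4 / ‖μ‖ ^ 4 := by rwa [le_div_iff₀ h3]
    exact_mod_cast h4.trans hn
  exact Module.rank_lt_aleph0_iff.1 (h.trans_lt Cardinal.natCast_lt_aleph0)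

/-- The sum of the generalized eigenspaces for the eigenvalues in a finite set. -/
def eigenSum (N : Module.End ℂ H) (S : Finset ℂ) : Submodule ℂ H :=
  S.sup fun μ => N.maxGenEigenspace μ

lemma maxGenEigenspace_le_eigenSum (N : Module.End ℂ H) {S : Finset ℂ} {μ : ℂ} (h : μ ∈ S) :
    N.maxGenEigenspace μ ≤ eigenSum N S :=
  Finset.le_sup (f := fun μ => N.maxGenEigenspace μ) h

lemma map_mem_maxGenEigenspace (N : Module.End ℂ H) {μ : ℂ} {x : H}
    (hx : x ∈ N.maxGenEigenspace μ) : N x ∈ N.maxGenEigenspace μ :=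
  N.mapsTo_maxGenEigenspace_of_comm (Commute.refl N) μ hx

lemma map_mem_eigenSum (N : Module.End ℂ H) (S : Finset ℂ) :
    ∀ x ∈ eigenSum N S, N x ∈ eigenSum N S := by
  suffices h : eigenSum N S ≤ (eigenSum N S).comap N from h
  refine Finset.sup_le fun μ hμ x hx => ?_
  exact maxGenEigenspace_le_eigenSum N hμ (map_mem_maxGenEigenspace N hx)

lemma finiteDimensional_eigenSum {N : Module.End ℂ H} {s : ℝ} (hN : DiagBound 4 N s)
    {S : Finset ℂ} (hS : (0 : ℂ) ∉ S) : FiniteDimensional ℂ (eigenSum N S) := by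
  classical
  have : ∀ μ : S, FiniteDimensional ℂ (N.maxGenEigenspace (μ : ℂ)) := fun μ =>
    finiteDimensional_maxGenEigenspace hN (fun h => hS (h ▸ μ.2))
  have h : eigenSum N S = ⨆ μ : S, N.maxGenEigenspace (μ : ℂ) := by
    rw [eigenSum, Finset.sup_eq_iSup, iSup_subtype]
  rw [h]
  exact Submodule.finiteDimensional_iSup _

lemma disjoint_eigenSum (N : Module.End ℂ H) {S : Finset ℂ} {μ : ℂ} (hμ : μ ∉ S) :
    Disjoint (N.maxGenEigenspace μ) (eigenSum N S) := by
  refine (N.independent_maxGenEigenspace μ).mono_right (Finset.sup_le fun ν hν => ?_)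
  exact le_iSup₂_of_le (f := fun ν (_ : ν ≠ μ) => N.maxGenEigenspace ν) ν
    (fun h => hμ (h ▸ hν)) le_rfl

/-- The eigenvalues on the sum of finitely many generalized eigenspaces, with multiplicity. -/
lemma roots_charpoly_eigenSum (N : Module.End ℂ H) (S : Finset ℂ)
    [FiniteDimensional ℂ (eigenSum N S)] :
    (N.restrict (map_mem_eigenSum N S)).charpoly.roots =
      ∑ μ ∈ S, Module.finrank ℂ (N.maxGenEigenspace μ) • {μ} := by
  classical
  ext μ
  have h0 : Module.End.maxGenEigenspace (N.restrict (map_mem_eigenSum N S)) μ =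
      (N.maxGenEigenspace μ).comap (eigenSum N S).subtype :=
    N.genEigenspace_restrict _ ⊤ μ (map_mem_eigenSum N S)
  rw [Polynomial.count_roots, ← LinearMap.finrank_maxGenEigenspace_eq, h0, Multiset.count_sum']
  simp only [Multiset.count_nsmul, Multiset.count_singleton, mul_ite, mul_one,
    mul_zero, Finset.sum_ite_eq]
  split_ifs with hμ
  · exact (Submodule.comapSubtypeEquivOfLe (maxGenEigenspace_le_eigenSum N hμ)).finrank_eq
  · have h1 : (N.maxGenEigenspace μ).comap (eigenSum N S).subtype = ⊥ := by
      refine (Submodule.eq_bot_iff _).2 fun x hx => Subtype.ext ?_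
      simpa using (disjoint_eigenSum N hμ).le_bot ⟨hx, x.2⟩
    rw [h1, finrank_bot]

/-- An orthonormal basis of the sum of finitely many generalized eigenspaces in which the diagonal
lists the eigenvalues with algebraic multiplicity. -/
lemma exists_basis_eigenSum (N : Module.End ℂ H) (S : Finset ℂ)
    [FiniteDimensional ℂ (eigenSum N S)] :
    ∃ (n : ℕ) (e : OrthonormalBasis (Fin n) ℂ (eigenSum N S)),
      (∀ i j, j < i → inner ℂ (e i : H) (N (e j)) = 0) ∧
      (∀ g : ℂ → ℂ, ∏ i, g (inner ℂ (e i : H) (N (e i))) =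
        ∏ μ ∈ S, g μ ^ Module.finrank ℂ (N.maxGenEigenspace μ)) ∧
      ∀ g : ℂ → ℝ, ∑ i, g (inner ℂ (e i : H) (N (e i))) =
        ∑ μ ∈ S, Module.finrank ℂ (N.maxGenEigenspace μ) * g μ := by
  obtain ⟨e, he⟩ := exists_orthonormalBasis_triangular _ rfl
    (N.restrict (map_mem_eigenSum N S))
  have h1 := roots_charpoly_of_triangular e _ he
  rw [roots_charpoly_eigenSum] at h1
  refine ⟨_, e, he, fun g => ?_, fun g => ?_⟩
  · have h2 := congrArg (fun m => (m.map g).prod) h1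
    simp only [Multiset.map_map] at h2
    refine (h2.symm.trans ?_ : (Multiset.map _ Finset.univ.val).prod = _)
    rw [← Multiset.coe_mapAddMonoidHom, map_sum, Multiset.prod_sum]
    simp [map_nsmul, Multiset.prod_nsmul]
  · have h2 := congrArg (fun m => (m.map g).sum) h1
    simp only [Multiset.map_map] at h2
    refine (h2.symm.trans ?_ : (Multiset.map _ Finset.univ.val).sum = _)
    rw [← Multiset.coe_mapAddMonoidHom, map_sum, Multiset.sum_sum]
    simp [map_nsmul, Multiset.sum_nsmul]

/-- This plays the role of Weyl's inequality: the diagonal in a triangularizing basis of the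
invariant subspace lists the eigenvalues with multiplicity. -/
lemma sum_finrank_mul_le {N : Module.End ℂ H} {s : ℝ} (hN : DiagBound 4 N s) {S : Finset ℂ}
    (hS : (0 : ℂ) ∉ S) :
    ∑ μ ∈ S, Module.finrank ℂ (N.maxGenEigenspace μ) * ‖μ‖ ^ 4 ≤ s ^ 4 := by
  have := finiteDimensional_eigenSum hN hS
  obtain ⟨n, e, -, -, h⟩ := exists_basis_eigenSum N S
  rw [← h fun μ => ‖μ‖ ^ 4]
  exact hN _ (fun i => (e i : H))
    (e.orthonormal.comp_linearIsometry (eigenSum N S).subtypeₗᵢ)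

/-- An operator has no further eigenvectors modulo a sum of generalized eigenspaces. -/
lemma hasEigenvalue_of_sub_mem_eigenSum {N : Module.End ℂ H} {S : Finset ℂ}
    (hfin : ∀ μ ∈ S, FiniteDimensional ℂ (N.maxGenEigenspace μ)) {lam : ℂ} {v : H}
    (hv : v ∉ eigenSum N S) (h : N v - lam • v ∈ eigenSum N S) :
    lam ∉ S ∧ N.HasEigenvalue lam := by
  set A : Module.End ℂ H := N - lam • 1 with hA
  -- On each generalized eigenspace with `μ ≠ lam`, the map `A = N - lam` is injective, hence
  -- surjective by finite dimension. So `A v` can be corrected by `A u` with `u` in the sum until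
  -- only a generalized eigenvector for `lam` remains, and `v - u` is then one too.
  have hle : eigenSum N S ≤ N.maxGenEigenspace lam ⊔ (eigenSum N S).map A := by
    refine Finset.sup_le fun μ hμ => ?_
    by_cases hlm : μ = lam
    · rw [hlm]
      exact le_sup_left
    refine le_trans ?_ (le_trans (Submodule.map_mono (maxGenEigenspace_le_eigenSum N hμ))
      le_sup_right)
    have hAm : ∀ x ∈ N.maxGenEigenspace μ, A x ∈ N.maxGenEigenspace μ := fun x hx => by
      simpa [hA] using Submodule.sub_mem _ (map_mem_maxGenEigenspace N hx)
        (Submodule.smul_mem _ lam hx)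
    have := hfin μ hμ
    have hinj : Function.Injective (A.restrict hAm) := by
      rw [← LinearMap.ker_eq_bot, Submodule.eq_bot_iff]
      intro x hx
      refine Subtype.ext ?_
      have h1 : A x = 0 := congrArg Subtype.val (LinearMap.mem_ker.1 hx)
      have h2 : (x : H) ∈ N.genEigenspace lam 1 := by
        rw [Module.End.mem_genEigenspace_one]
        simpa [hA, sub_eq_zero] using h1
      simpa using (N.disjoint_genEigenspace hlm ⊤ 1).le_bot ⟨x.2, h2⟩
    intro x hx
    obtain ⟨y, hy⟩ := (LinearMap.injective_iff_surjective.1 hinj) ⟨x, hx⟩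
    exact ⟨y, y.2, congrArg Subtype.val hy⟩
  obtain ⟨a, ha, b, ⟨u, hu, rfl⟩, hab⟩ := Submodule.mem_sup.1 (hle h)
  have h1 : A (v - u) = a := by
    have : A v = a + A u := by rw [hab]; simp [hA]
    rw [map_sub, this, add_sub_cancel_right]
  have h2 : v - u ∈ N.maxGenEigenspace lam := by
    rw [← h1, Module.End.mem_maxGenEigenspace] at ha
    obtain ⟨k, hk⟩ := ha
    rw [Module.End.mem_maxGenEigenspace]
    exact ⟨k + 1, by rw [pow_succ]; exact hk⟩
  have h3 : v - u ∉ eigenSum N S := fun h => hv (by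
    simpa using Submodule.add_mem _ h hu)
  refine ⟨fun hlam => h3 (maxGenEigenspace_le_eigenSum N hlam h2), ?_⟩
  have h4 : N.maxGenEigenspace lam ≠ ⊥ := fun h => h3 (by
    rw [h, Submodule.mem_bot] at h2
    rw [h2]
    exact Submodule.zero_mem _)
  rw [Module.End.hasEigenvalue_iff]
  intro h5
  rw [Module.End.mem_maxGenEigenspace] at h2
  obtain ⟨k, hk⟩ := h2
  have h6 : ∀ k : ℕ, ∀ x, ((N - lam • 1) ^ k) x = 0 → x = 0 := by
    intro k
    induction k with
    | zero => intro x hx; simpa using hx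
    | succ k ih =>
      intro x hx
      rw [pow_succ] at hx
      have h7 := ih _ hx
      have h8 : x ∈ N.eigenspace lam := by
        rw [Module.End.mem_eigenspace_iff]
        simpa [sub_eq_zero] using h7
      rw [h5] at h8
      simpa using h8
  exact h3 (by rw [h6 k _ hk]; exact Submodule.zero_mem _)

end InvariantSubspace

/-! ### Finite-dimensional compressions of a compact operator. -/

section Hilbert

variable {H : Type*} [NormedAddCommGroup H] [InnerProductSpace ℂ H]

/-- Take `W` spanned by a finite `η`-net of the image of the unit ball. For `y` in the net, `C x - P
C x` is the projection of `C x - y` to the complement of `W`. -/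
lemma exists_finiteDimensional_approx {C : H →L[ℂ] H} (hC : IsCompactOperator C) {η : ℝ}
    (hη : 0 < η) : ∃ W : Submodule ℂ H, ∃ _ : FiniteDimensional ℂ W,
      ‖C - W.starProjection ∘L C‖ ≤ η := by
  obtain ⟨t, htf, ht⟩ := Metric.totallyBounded_iff.1
    (hC.isCompact_closure_image_closedBall 1).totallyBounded η hη
  have hW : FiniteDimensional ℂ (Submodule.span ℂ t) := FiniteDimensional.span_of_finite ℂ htf
  refine ⟨Submodule.span ℂ t, hW, ?_⟩
  refine ContinuousLinearMap.opNorm_le_of_unit_norm hη.le fun x hx => ?_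
  have h1 : C x ∈ closure (C '' Metric.closedBall 0 1) :=
    subset_closure ⟨x, by simp [hx], rfl⟩
  obtain ⟨y, hy, hxy⟩ := Set.mem_iUnion₂.1 (ht h1)
  have h2 : (Submodule.span ℂ t).starProjection y = y :=
    Submodule.starProjection_eq_self_iff.2 (Submodule.subset_span hy)
  have h3 : (C - (Submodule.span ℂ t).starProjection ∘L C) x =
      (Submodule.span ℂ t)ᗮ.starProjection (C x - y) := by
    rw [Submodule.starProjection_orthogonal]
    simp [h2]
  rw [h3]
  refine (ContinuousLinearMap.le_of_opNorm_le _ (Submodule.starProjection_norm_le _) _).trans ?_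
  rw [one_mul, ← dist_eq_norm]
  exact (Metric.mem_ball.1 hxy).le

lemma norm_starProjection_comp_comp_le (F : Submodule ℂ H) [F.HasOrthogonalProjection]
    (C : H →L[ℂ] H) : ‖F.starProjection ∘L C ∘L F.starProjection‖ ≤ ‖C‖ := by
  have h := F.starProjection_norm_le
  calc _ ≤ ‖F.starProjection‖ * (‖C‖ * ‖F.starProjection‖) :=
        (ContinuousLinearMap.opNorm_comp_le _ _).trans
          (mul_le_mul_of_nonneg_left (ContinuousLinearMap.opNorm_comp_le _ _) (norm_nonneg _))
    _ ≤ 1 * (‖C‖ * 1) := by gcongr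
    _ = _ := by ring

/-- A compact operator is close in norm to its compressions to large finite-dimensional
subspaces. -/
lemma exists_forall_le_norm_compression_sub_lt [CompleteSpace H] {C : H →L[ℂ] H} (hC : IsCompactOperator C) {η : ℝ}
    (hη : 0 < η) : ∃ W : Submodule ℂ H, FiniteDimensional ℂ W ∧
      ∀ (F : Submodule ℂ H) [F.HasOrthogonalProjection], W ≤ F →
        ‖F.starProjection ∘L C ∘L F.starProjection - C‖ < η := by
  obtain ⟨W₀, hW₀, hR⟩ := exists_finiteDimensional_approx hC (η := η / 3) (by linarith)
  set R : H →L[ℂ] H := W₀.starProjection ∘L C with hRdef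
  have hclosed : IsClosed (LinearMap.ker R.toLinearMap : Set H) := R.isClosed_ker
  have : CompleteSpace (LinearMap.ker R.toLinearMap) := hclosed.completeSpace_coe
  have hK : FiniteDimensional ℂ (LinearMap.ker R.toLinearMap)ᗮ := by
    have hmem : ∀ x, R x ∈ W₀ := fun x => W₀.starProjection_apply_mem _
    let φ : (LinearMap.ker R.toLinearMap)ᗮ →ₗ[ℂ] W₀ :=
      (R.toLinearMap.codRestrict W₀ hmem) ∘ₗ (LinearMap.ker R.toLinearMap)ᗮ.subtype
    refine FiniteDimensional.of_injective φ ?_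
    rw [← LinearMap.ker_eq_bot, Submodule.eq_bot_iff]
    intro x hx
    have h1 : R x = 0 := congrArg Subtype.val (LinearMap.mem_ker.1 hx)
    have h2 : inner ℂ (x : H) (x : H) = 0 :=
      (Submodule.mem_orthogonal _ _).1 x.2 x (LinearMap.mem_ker.2 h1)
    exact Subtype.ext (inner_self_eq_zero.1 h2)
  -- For `F` containing the range and the co-kernel of the finite-rank `R`, compression to `F` fixes
  -- `R`. Only `C - R` contributes to the error, at most `2 η / 3`.
  refine ⟨W₀ ⊔ (LinearMap.ker R.toLinearMap)ᗮ, inferInstance, fun F _ hF => ?_⟩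
  have h1 : F.starProjection ∘L R ∘L F.starProjection = R := by
    ext x
    have h2 : R (F.starProjection x) = R x := by
      have h3 : x - F.starProjection x ∈ (LinearMap.ker R.toLinearMap)ᗮᗮ :=
        Submodule.orthogonal_le (le_sup_right.trans hF)
          (Submodule.sub_starProjection_mem_orthogonal x)
      rw [Submodule.orthogonal_orthogonal] at h3
      have h4 : R (x - F.starProjection x) = 0 := LinearMap.mem_ker.1 h3
      rw [map_sub, sub_eq_zero] at h4
      exact h4.symm
    simp only [ContinuousLinearMap.comp_apply, h2]
    exact Submodule.starProjection_eq_self_iff.2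
      (hF (Submodule.mem_sup_left (W₀.starProjection_apply_mem _)))
  have h2 : F.starProjection ∘L C ∘L F.starProjection - C =
      F.starProjection ∘L (C - R) ∘L F.starProjection - (C - R) := by
    rw [ContinuousLinearMap.sub_comp, ContinuousLinearMap.comp_sub, h1]
    abel
  rw [h2]
  refine (norm_sub_le _ _).trans_lt ?_
  have h3 := norm_starProjection_comp_comp_le F (C - R)
  linarith

/-- Upper semicontinuity of the spectrum: operators close to `C` have no eigenvalue in a closed
exterior domain that does not meet the spectrum of `C`. -/
lemma exists_forall_norm_sub_lt_eq_zero [CompleteSpace H] {C : H →L[ℂ] H} {ε : ℝ}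
    (h : ∀ lam ∈ spectrum ℂ C, ‖lam‖ < ε) :
    ∃ η > 0, ∀ C' : H →L[ℂ] H, ‖C' - C‖ < η → ∀ lam : ℂ, ε ≤ ‖lam‖ → ∀ v, C' v = lam • v →
      v = 0 := by
  -- Eigenvalues of `C'` are bounded by `‖C'‖ ≤ ‖C‖ + 1`, so only a compact set of `lam` matters,
  -- and invertibility is an open condition.
  have hK : IsCompact (Metric.closedBall (0 : ℂ) (‖C‖ + 1) ∩ {lam | ε ≤ ‖lam‖}) :=
    (isCompact_closedBall _ _).inter_right (isClosed_le continuous_const continuous_norm)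
  have h1 := hK.eventually_forall_of_forall_eventually (x₀ := C)
    (P := fun C' lam => IsUnit (algebraMap ℂ (H →L[ℂ] H) lam - C')) (by
      intro lam hlam
      have h2 : IsUnit (algebraMap ℂ (H →L[ℂ] H) lam - C) := by
        by_contra h3
        exact absurd (h lam h3) (not_lt.2 hlam.2)
      have h3 : Continuous fun z : (H →L[ℂ] H) × ℂ => algebraMap ℂ (H →L[ℂ] H) z.2 - z.1 :=
        ((algebraMapCLM ℂ (H →L[ℂ] H)).continuous.comp continuous_snd).sub continuous_fst
      exact h3.continuousAt.eventually (Units.isOpen.mem_nhds h2))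
  obtain ⟨η, hη, hb⟩ := Metric.eventually_nhds_iff.1 h1
  refine ⟨min η 1, lt_min hη one_pos, fun C' hC' lam hlam v hv => ?_⟩
  by_contra hv0
  have hn : ‖lam‖ ≤ ‖C'‖ := by
    have h2 := C'.le_opNorm v
    rw [hv, norm_smul] at h2
    exact le_of_mul_le_mul_right h2 (norm_pos_iff.2 hv0)
  have hn2 : ‖C'‖ ≤ ‖C‖ + 1 := by
    have h3 := norm_le_norm_add_norm_sub' C' C
    have h4 := hC'.trans_le (min_le_right _ _)
    linarith
  have h2 := hb (y := C') (by rw [dist_eq_norm]; exact hC'.trans_le (min_le_left _ _)) lam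
    ⟨by simpa using hn.trans hn2, hlam⟩
  obtain ⟨u, hu⟩ := h2
  refine hv0 ?_
  have h3 : (u : H →L[ℂ] H) v = 0 := by
    rw [hu]
    simp [Algebra.algebraMap_eq_smul_one, hv]
  have h4 : ((↑u⁻¹ : H →L[ℂ] H) * u) v = 0 := by
    rw [mul_apply_eq_comp, h3, map_zero]
  simpa using h4

/-- After compression to the complement of a sum of generalized eigenspaces, only the remaining
eigenvalues are left. -/
lemma norm_lt_of_mem_spectrum_compression [CompleteSpace H] {N : H →L[ℂ] H} (hN : IsCompactOperator N) {s : ℝ}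
    (hs : DiagBound 4 N s) {S : Finset ℂ} (hS : (0 : ℂ) ∉ S) {ε : ℝ} (hε : 0 < ε)
    (hSε : ∀ μ ∈ spectrum ℂ N, ε ≤ ‖μ‖ → μ ∈ S)
    [FiniteDimensional ℂ (eigenSum (N : Module.End ℂ H) S)] :
    ∀ lam ∈ spectrum ℂ ((eigenSum (N : Module.End ℂ H) S)ᗮ.starProjection ∘L N ∘L
      (eigenSum (N : Module.End ℂ H) S)ᗮ.starProjection), ‖lam‖ < ε := by
  set E := eigenSum (N : Module.End ℂ H) S
  intro lam hlam
  rcases eq_or_ne lam 0 with rfl | h0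
  · simpa using hε
  have hc : IsCompactOperator (Eᗮ.starProjection ∘L N ∘L Eᗮ.starProjection) :=
    (hN.comp_clm Eᗮ.starProjection).clm_comp Eᗮ.starProjection
  rw [← hc.hasEigenvalue_iff_mem_spectrum h0] at hlam
  obtain ⟨v, hv⟩ := hlam.exists_hasEigenvector
  have h1 : Eᗮ.starProjection (N (Eᗮ.starProjection v)) = lam • v := hv.apply_eq_smul
  have hvE : v ∈ Eᗮ := by
    have h2 : lam • v ∈ Eᗮ := by
      rw [← h1]
      exact Eᗮ.starProjection_apply_mem _
    simpa [smul_smul, h0] using Eᗮ.smul_mem lam⁻¹ h2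
  rw [Submodule.starProjection_eq_self_iff.2 hvE] at h1
  -- An eigenvector of the compression is an eigenvector of `N` modulo `E`, so `lam` is an
  -- eigenvalue of `N` outside `S`.
  have h2 : N v - lam • v ∈ E := by
    rw [← h1, Submodule.starProjection_orthogonal]
    simp only [sub_apply, ContinuousLinearMap.id_apply, sub_sub_cancel]
    exact E.starProjection_apply_mem _
  have hvE' : v ∉ E := fun h =>
    hv.2 (inner_self_eq_zero.1 ((Submodule.mem_orthogonal _ _).1 hvE v h))
  obtain ⟨h3, h4⟩ := hasEigenvalue_of_sub_mem_eigenSum (N := (N : Module.End ℂ H))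
    (fun μ hμ => finiteDimensional_maxGenEigenspace hs (fun h => hS (h ▸ hμ))) hvE' h2
  rw [hN.hasEigenvalue_iff_mem_spectrum h0] at h4
  by_contra h5
  exact h3 (hSε lam h4 (not_lt.1 h5))

/-- The compression of an operator to a subspace. -/
def compression (N : H →L[ℂ] H) (F : Submodule ℂ H) [F.HasOrthogonalProjection] :
    Module.End ℂ F :=
  F.orthogonalProjectionOnto.toLinearMap ∘ₗ N.toLinearMap ∘ₗ F.subtype

lemma coe_compression (N : H →L[ℂ] H) (F : Submodule ℂ H) [F.HasOrthogonalProjection] (x : F) :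
    (compression N F x : H) = F.starProjection (N x) := rfl

lemma inner_compression (N : H →L[ℂ] H) (F : Submodule ℂ H) [F.HasOrthogonalProjection]
    (x y : F) : inner ℂ x (compression N F y) = inner ℂ (x : H) (N y) := by
  rw [Submodule.coe_inner, coe_compression, ← Submodule.inner_starProjection_left_eq_right,
    Submodule.starProjection_eq_self_iff.2 x.2]

lemma DiagBound.compression {p : ℕ} {N : H →L[ℂ] H} {s : ℝ} (hs : DiagBound p N s)
    (F : Submodule ℂ H) [F.HasOrthogonalProjection] : DiagBound p (compression N F) s := by
  intro n e he
  simp only [inner_compression]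
  exact hs n (fun i => (e i : H)) (he.comp_linearIsometry F.subtypeₗᵢ)

/-- The regularized determinant of a compression that contains an invariant subspace. -/
lemma detFour_compression_eq (N : H →L[ℂ] H) (E F : Submodule ℂ H) [FiniteDimensional ℂ E]
    [FiniteDimensional ℂ F] (hEF : E ≤ F) (hE : ∀ x ∈ E, N x ∈ E) {m n : ℕ}
    (e : OrthonormalBasis (Fin m) ℂ E) (f : OrthonormalBasis (Fin n) ℂ (Eᗮ ⊓ F : Submodule ℂ H))
    (he : ∀ i j, j < i → inner ℂ (e i : H) (N (e j)) = 0)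
    (hf : ∀ i j, j < i → inner ℂ (f i : H) (N (f j)) = 0) :
    detFour (compression N F) = (∏ i, elemFactor (inner ℂ (e i : H) (N (e i)))) *
      ∏ i, elemFactor (inner ℂ (f i : H) (N (f i))) := by
  have horth : ∀ (i : Fin n) (x : H), x ∈ E → inner ℂ (f i : H) x = 0 := fun i x hx => by
    rw [inner_eq_zero_symm]
    exact (Submodule.mem_orthogonal _ _).1 (f i).2.1 x hx
  set g : Fin m ⊕ Fin n → F := Sum.elim (fun i => ⟨e i, hEF (e i).2⟩) (fun i => ⟨f i, (f i).2.2⟩)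
    with hg
  have hon : Orthonormal ℂ g := by
    rw [orthonormal_iff_ite]
    rintro (i | i) (j | j)
    · simpa [hg, Submodule.coe_inner] using orthonormal_iff_ite.1 e.orthonormal i j
    · simpa [hg, Submodule.coe_inner] using inner_eq_zero_symm.1 (horth j (e i) (e i).2)
    · simpa [hg, Submodule.coe_inner] using horth i (e j) (e j).2
    · simpa [hg, Submodule.coe_inner] using orthonormal_iff_ite.1 f.orthonormal i j
  have hcard : Fintype.card (Fin m ⊕ Fin n) = Module.finrank ℂ F := by
    rw [← Submodule.finrank_add_inf_finrank_orthogonal hEF,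
      Module.finrank_eq_card_basis e.toBasis, Module.finrank_eq_card_basis f.toBasis]
    simp
  let b := OrthonormalBasis.mk hon
    (hon.linearIndependent.span_eq_top_of_card_eq_finrank' hcard).ge
  have hb : ∀ i, b i = g i := fun i => by simp [b]
  rw [detFour_eq_matrixDetFour b]
  -- Invariance of `E` makes the lower left block zero.
  have hM : (Matrix.of fun i j => inner ℂ (b i) (compression N F (b j))) =
      Matrix.fromBlocks (Matrix.of fun i j => inner ℂ (e i : H) (N (e j)))
        (Matrix.of fun i j => inner ℂ (e i : H) (N (f j))) 0
        (Matrix.of fun i j => inner ℂ (f i : H) (N (f j))) := by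
    ext i j
    rw [Matrix.of_apply, inner_compression, hb, hb]
    rcases i with i | i <;> rcases j with j | j
    · rfl
    · rfl
    · exact horth i _ (hE _ (e j).2)
    · rfl
  rw [hM, matrixDetFour_fromBlocks,
    matrixDetFour_of_triangular (M := Matrix.of fun i j => inner ℂ (e i : H) (N (e j)))
      (fun i j hij => he i j hij),
    matrixDetFour_of_triangular (M := Matrix.of fun i j => inner ℂ (f i : H) (N (f j)))
      (fun i j hij => hf i j hij)]
  rfl

/-- The resolvent bound with the determinant replaced by a finite partial product. -/
theorem norm_prod_mul_norm_le [CompleteSpace H] {N : H →L[ℂ] H} (hN : IsCompactOperator N) {s c : ℝ} (hs0 : 0 ≤ s)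
    (hs : DiagBound 4 N s) (hc : DiagBound 3 N c) {S : Finset ℂ} (hS : (0 : ℂ) ∉ S) {ε : ℝ}
    (hε : 0 < ε) (hε2 : ε ≤ 1 / 2) (hSε : ∀ μ ∈ spectrum ℂ N, ε ≤ ‖μ‖ → μ ∈ S) (z : H) :
    ‖∏ μ ∈ S, elemFactor μ ^ algMult N μ‖ * Real.exp (-(ε * c ^ 3)) * ‖N (N (N z))‖ ≤
      Real.exp (3 / 4 * (s + 1) ^ 4) * ‖z + N z‖ := by
  classical
  have hfin := finiteDimensional_eigenSum (N := (N : Module.End ℂ H)) hs hS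
  set E := eigenSum (N : Module.End ℂ H) S with hEdef
  obtain ⟨m, e, he, heprod, -⟩ := exists_basis_eigenSum (N : Module.End ℂ H) S
  set C : H →L[ℂ] H := Eᗮ.starProjection ∘L N ∘L Eᗮ.starProjection with hC
  have hCc : IsCompactOperator C := (hN.comp_clm Eᗮ.starProjection).clm_comp Eᗮ.starProjection
  obtain ⟨η, hη, hηC⟩ := exists_forall_norm_sub_lt_eq_zero
    (norm_lt_of_mem_spectrum_compression hN hs hS hε hSε)
  obtain ⟨W, hW, hWF⟩ := exists_forall_le_norm_compression_sub_lt hCc hη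
  -- Including the first iterates of `z` makes the compression to `F` agree with `N` along them, so
  -- the finite-dimensional estimate for `z` is already about `N³ z`.
  set Z : Submodule ℂ H := Submodule.span ℂ ({z, N z, N (N z), N (N (N z))} : Finset H) with hZ
  set F : Submodule ℂ H := E ⊔ W ⊔ Z with hF
  have hEF : E ≤ F := le_sup_left.trans le_sup_left
  have hWleF : W ≤ F := le_sup_right.trans le_sup_left
  have hZF : ∀ y ∈ ({z, N z, N (N z), N (N (N z))} : Finset H), y ∈ F := fun y hy =>
    Submodule.mem_sup_right (Submodule.subset_span hy)
  have hFfin : FiniteDimensional ℂ F := inferInstance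
  have hGfin : FiniteDimensional ℂ (Eᗮ ⊓ F : Submodule ℂ H) :=
    Submodule.finiteDimensional_of_le inf_le_right
  obtain ⟨f, hf⟩ := exists_orthonormalBasis_triangular _ rfl (compression N (Eᗮ ⊓ F))
  have hroots := roots_charpoly_of_triangular f _ hf
  simp only [inner_compression] at hf hroots
  -- Each diagonal entry is an eigenvalue of the compression to `Eᗮ ⊓ F`, hence of `F.starProjection
  -- ∘L C ∘L F.starProjection`. That operator is within `η` of `C`, so it has no eigenvalue of
  -- modulus at least `ε`.
  have hlam : ∀ i, ‖inner ℂ (f i : H) (N (f i))‖ < ε := by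
    intro i
    by_contra hi
    have h1 : inner ℂ (f i : H) (N (f i)) ∈ (compression N (Eᗮ ⊓ F)).charpoly.roots := by
      rw [hroots]
      exact Multiset.mem_map.2 ⟨i, Finset.mem_univ_val i, rfl⟩
    have h2 := (Polynomial.mem_roots'.1 h1).2
    rw [← Module.End.hasEigenvalue_iff_isRoot_charpoly] at h2
    obtain ⟨v, hv⟩ := h2.exists_hasEigenvector
    have hQv : Eᗮ.starProjection (v : H) = v := Submodule.starProjection_eq_self_iff.2 v.2.1
    have hPv : F.starProjection (v : H) = v := Submodule.starProjection_eq_self_iff.2 v.2.2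
    have key : (F.starProjection ∘L C ∘L F.starProjection) v =
        inner ℂ (f i : H) (N (f i)) • (v : H) := by
      simp only [hC, ContinuousLinearMap.comp_apply, hQv, hPv]
      refine Submodule.eq_starProjection_of_mem_of_inner_eq_zero (F.smul_mem _ v.2.2) ?_
      intro w hw
      -- The difference is orthogonal to `Eᗮ ⊓ F` by this step and to `E` by construction; together
      -- these span `F` because `E ≤ F`.
      have h3 : ∀ u ∈ Eᗮ ⊓ F, inner ℂ (Eᗮ.starProjection (N v) -
          inner ℂ (f i : H) (N (f i)) • (v : H)) u = 0 := by
        intro u hu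
        have h4 : (inner ℂ (f i : H) (N (f i)) • (v : H)) =
            (compression N (Eᗮ ⊓ F) v : H) := (congrArg Subtype.val hv.apply_eq_smul).symm
        rw [h4, inner_sub_left, Submodule.inner_starProjection_left_eq_right,
          Submodule.starProjection_eq_self_iff.2 hu.1, coe_compression,
          Submodule.inner_starProjection_left_eq_right,
          Submodule.starProjection_eq_self_iff.2 hu, sub_self]
      have h5 : w = E.starProjection w + Eᗮ.starProjection w := by
        rw [Submodule.starProjection_orthogonal]
        simp
      have h6 : Eᗮ.starProjection w ∈ Eᗮ ⊓ F := by
        refine ⟨Eᗮ.starProjection_apply_mem _, ?_⟩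
        rw [Submodule.starProjection_orthogonal]
        exact F.sub_mem hw (hEF (E.starProjection_apply_mem _))
      rw [h5, inner_add_right, h3 _ h6, add_zero, inner_eq_zero_symm]
      exact (Submodule.mem_orthogonal _ _).1
        (Eᗮ.sub_mem (Eᗮ.starProjection_apply_mem _) (Eᗮ.smul_mem _ v.2.1)) _
        (E.starProjection_apply_mem _)
    exact hv.2 (Subtype.ext (hηC _ (hWF F hWleF) _ (not_lt.1 hi) _ key))
  have hdet := detFour_compression_eq N E F hEF (map_mem_eigenSum (N : Module.End ℂ H) S) e f he hf
  have hprod : Real.exp (-(ε * c ^ 3)) ≤ ‖∏ i, elemFactor (inner ℂ (f i : H) (N (f i)))‖ := by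
    -- Trading one power of the small eigenvalues for `ε` leaves the `ℓ³` bound, which does not
    -- depend on `F`.
    have h1 : ∑ i, ‖inner ℂ (f i : H) (N (f i))‖ ^ 4 ≤ ε * c ^ 3 := by
      refine le_trans ?_ (mul_le_mul_of_nonneg_left (hc _ (fun i => (f i : H))
        (f.orthonormal.comp_linearIsometry (Eᗮ ⊓ F).subtypeₗᵢ)) hε.le)
      rw [Finset.mul_sum]
      refine Finset.sum_le_sum fun i _ => ?_
      rw [pow_succ']
      exact mul_le_mul_of_nonneg_right (hlam i).le (by positivity)
    rw [norm_prod]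
    refine le_trans ?_ (Finset.prod_le_prod (fun i _ => (Real.exp_pos _).le)
      fun i _ => le_norm_elemFactor ((hlam i).le.trans hε2))
    rw [← Real.exp_sum, Finset.sum_neg_distrib]
    exact Real.exp_le_exp.2 (neg_le_neg h1)
  have hpre : ∏ i, elemFactor (inner ℂ (e i : H) (N (e i))) =
      ∏ μ ∈ S, elemFactor μ ^ algMult N μ := heprod elemFactor
  have hK : ∀ x (_ : x ∈ F) (hNx : N x ∈ F), compression N F ⟨x, ‹_›⟩ = ⟨N x, hNx⟩ :=
    fun x _ hNx => Subtype.ext (Submodule.starProjection_eq_self_iff.2 hNx)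
  have hz0 := hZF z (by simp)
  have hz1 := hZF (N z) (by simp)
  have hz2 := hZF (N (N z)) (by simp)
  have hz3 := hZF (N (N (N z))) (by simp)
  have key := norm_detFour_mul_norm_le hs0 (hs.compression F) ⟨z, hz0⟩
  rw [hK z hz0 hz1, hK _ hz1 hz2, hK _ hz2 hz3, hdet, hpre, norm_mul] at key
  refine le_trans ?_ key
  change _ ≤ _ * ‖N (N (N z))‖
  gcongr

end Hilbert

/-! ### Convergence of the determinant and the abstract resolvent bound. -/

section Determinant

variable {H : Type*} [NormedAddCommGroup H] [InnerProductSpace ℂ H]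

lemma detFactor_eq (N : H →L[ℂ] H) (μ : spectrum ℂ N) :
    detFactor N μ = elemFactor μ ^ algMult N μ := rfl

lemma elemFactor_zero : elemFactor 0 = 1 := by simp [elemFactor]

/-- A product over eigenvalues does not see the eigenvalue zero. -/
lemma exists_finset_prod_eq (N : H →L[ℂ] H) (t : Finset (spectrum ℂ N)) :
    ∃ S : Finset ℂ, (0 : ℂ) ∉ S ∧ (∀ μ : spectrum ℂ N, (μ : ℂ) ≠ 0 → (μ ∈ t ↔ (μ : ℂ) ∈ S)) ∧
      ∏ μ ∈ t, detFactor N μ = ∏ μ ∈ S, elemFactor μ ^ algMult N μ := by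
  classical
  refine ⟨(t.map ⟨_, Subtype.val_injective⟩).erase 0, by simp, fun μ hμ => ?_, ?_⟩
  · simp [hμ]
  · rw [Finset.prod_erase _ (by simp [elemFactor_zero]), Finset.prod_map]
    rfl

lemma summable_algMult_mul {N : H →L[ℂ] H} {s : ℝ} (hs : DiagBound 4 N s) :
    Summable fun μ : spectrum ℂ N => (algMult N μ : ℝ) * ‖(μ : ℂ)‖ ^ 4 := by
  classical
  refine summable_of_sum_le (c := s ^ 4) (fun μ => by positivity) fun t => ?_
  have h := sum_finrank_mul_le (N := (N : Module.End ℂ H)) hs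
    (S := (t.map ⟨_, Subtype.val_injective⟩).erase 0) (by simp)
  rw [Finset.sum_erase _ (by simp), Finset.sum_map] at h
  exact h

lemma one_le_algMult [CompleteSpace H] {N : H →L[ℂ] H} (hN : IsCompactOperator N) {s : ℝ}
    (hs : DiagBound 4 N s) {μ : ℂ} (hμ : μ ∈ spectrum ℂ N) (h0 : μ ≠ 0) : 1 ≤ algMult N μ := by
  have := finiteDimensional_maxGenEigenspace (N := (N : Module.End ℂ H)) hs h0
  rw [← hN.hasEigenvalue_iff_mem_spectrum h0] at hμ
  obtain ⟨v, hv⟩ := hμ.exists_hasEigenvector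
  have : Nontrivial (Module.End.maxGenEigenspace (N : Module.End ℂ H) μ) :=
    ⟨⟨v, (Module.End.genEigenspace (N : Module.End ℂ H) μ).monotone le_top hv.1⟩, 0,
      fun h => hv.2 (congrArg Subtype.val h)⟩
  exact Module.finrank_pos

/-- Each such eigenvalue contributes at least `ε⁴` to a convergent sum. Multiplicity at least `1`
matters here, since `Module.finrank` would vanish on an infinite-dimensional space. -/
lemma finite_setOf_le_norm [CompleteSpace H] {N : H →L[ℂ] H} (hN : IsCompactOperator N) {s : ℝ}
    (hs : DiagBound 4 N s) {ε : ℝ} (hε : 0 < ε) : {μ : spectrum ℂ N | ε ≤ ‖(μ : ℂ)‖}.Finite := by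
  have h := (summable_algMult_mul hs).tendsto_cofinite_zero.eventually
    (gt_mem_nhds (show (0 : ℝ) < ε ^ 4 by positivity))
  refine Set.Finite.subset (Filter.eventually_cofinite.1 h) fun μ hμ => ?_
  have hμ0 : (μ : ℂ) ≠ 0 := norm_pos_iff.1 (hε.trans_le hμ)
  have h1 : (1 : ℝ) ≤ algMult N μ := by exact_mod_cast one_le_algMult hN hs μ.2 hμ0
  have h2 : ε ^ 4 ≤ ‖(μ : ℂ)‖ ^ 4 := pow_le_pow_left₀ hε.le hμ 4
  rw [Set.mem_ofPred_eq, not_lt]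
  nlinarith [pow_pos hε 4]

/-- The product that defines `det₄ (1 + N)` converges to a non-zero limit. -/
theorem hasProd_detFactor [CompleteSpace H] {N : H →L[ℂ] H} (hN : IsCompactOperator N) {s : ℝ}
    (hs : DiagBound 4 N s) (h1 : (-1 : ℂ) ∉ spectrum ℂ N) :
    ∃ d : ℂ, d ≠ 0 ∧ HasProd (detFactor N) d := by
  -- The branch of the logarithm is immaterial for the finitely many eigenvalues of modulus at least
  -- `1 / 2`: only `exp (log (1 + μ)) = 1 + μ` is used there, and the remainder estimate is needed
  -- only for the others.
  set L : spectrum ℂ N → ℂ := fun μ => algMult N μ * (log (1 + μ) - logTaylor 4 μ) with hL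
  have hLs : Summable L := by
    refine Summable.of_norm_bounded_eventually (summable_algMult_mul hs) ?_
    refine (Filter.eventually_cofinite.2 (Set.Finite.subset
      (finite_setOf_le_norm hN hs (ε := 1 / 2) (by norm_num)) fun μ hμ => ?_))
    by_contra h
    refine hμ ?_
    have h2 : ‖(μ : ℂ)‖ < 1 / 2 := not_le.1 h
    have hs : 1 + (μ : ℂ) ∈ slitPlane := mem_slitPlane_of_norm_lt_one (by linarith)
    have h3 := norm_log_sub_logTaylor_four_le (μ := (μ : ℂ)) (δ := 1 / 2) (by norm_num)
      (fun t ht => one_add_mul_mem_slitPlane hs ht) (fun t ht => by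
        have h2 : ‖(t : ℂ) * μ‖ ≤ 1 / 2 := by
          rw [norm_mul, norm_real, Real.norm_of_nonneg ht.1]
          nlinarith [norm_nonneg (μ : ℂ), ht.1, ht.2]
        have h3 := norm_sub_norm_le (1 : ℂ) (-(t * μ))
        rw [norm_neg, sub_neg_eq_add, norm_one] at h3
        linarith)
    rw [hL, norm_mul, norm_natCast]
    refine mul_le_mul_of_nonneg_left (h3.trans ?_) (Nat.cast_nonneg _)
    have : 0 ≤ ‖(μ : ℂ)‖ ^ 4 := by positivity
    linarith
  refine ⟨exp (∑' μ, L μ), exp_ne_zero _, ?_⟩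
  convert! hLs.hasSum.cexp using 1
  funext μ
  have h2 : 1 + (μ : ℂ) ≠ 0 := fun h => h1 (by
    rw [← eq_neg_of_add_eq_zero_right h]
    exact μ.2)
  rw [detFactor_eq, elemFactor_eq_exp h2, ← exp_nat_mul]
  rfl

/-- `‖N³ (1 + N)⁻¹‖ |det₄ (1 + N)| ≤ e^{3 (s + 1)⁴ / 4}` for a compact operator whose diagonals
are bounded by `s` in `ℓ⁴`. -/
theorem norm_det4OneAdd_mul_le [CompleteSpace H] {N : H →L[ℂ] H} (hN : IsCompactOperator N)
    {s c : ℝ} (hs0 : 0 ≤ s) (hs : DiagBound 4 N s) (hc : DiagBound 3 N c)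
    (h1 : (-1 : ℂ) ∉ spectrum ℂ N) (z : H) :
    ‖det4OneAdd N‖ * ‖N (N (N z))‖ ≤ Real.exp (3 / 4 * (s + 1) ^ 4) * ‖z + N z‖ := by
  obtain ⟨d, -, hd⟩ := hasProd_detFactor hN hs h1
  rw [det4OneAdd, hd.tprod_eq]
  have key : ∀ ε : ℝ, 0 < ε → ε ≤ 1 / 2 → ‖d‖ * Real.exp (-(ε * c ^ 3)) * ‖N (N (N z))‖ ≤
      Real.exp (3 / 4 * (s + 1) ^ 4) * ‖z + N z‖ := by
    intro ε hε hε2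
    have hlim : Filter.Tendsto (fun t : Finset (spectrum ℂ N) => ‖∏ μ ∈ t, detFactor N μ‖ *
        Real.exp (-(ε * c ^ 3)) * ‖N (N (N z))‖) Filter.atTop
        (nhds (‖d‖ * Real.exp (-(ε * c ^ 3)) * ‖N (N (N z))‖)) :=
      ((Filter.Tendsto.norm hd).mul_const _).mul_const _
    refine le_of_tendsto hlim ?_
    have hf := finite_setOf_le_norm hN hs hε
    filter_upwards [Filter.eventually_ge_atTop hf.toFinset] with t ht
    obtain ⟨S, hS0, hS, hprod⟩ := exists_finset_prod_eq N t
    rw [hprod]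
    refine norm_prod_mul_norm_le hN hs0 hs hc hS0 hε hε2 (fun μ hμ hμε => ?_) z
    exact (hS ⟨μ, hμ⟩ (norm_pos_iff.1 (hε.trans_le hμε))).1
      (ht (hf.mem_toFinset.2 hμε))
  have hcont : Filter.Tendsto (fun ε : ℝ => ‖d‖ * Real.exp (-(ε * c ^ 3)) * ‖N (N (N z))‖)
      (nhdsWithin 0 (Set.Ioi 0)) (nhds (‖d‖ * ‖N (N (N z))‖)) := by
    have : Continuous fun ε : ℝ => ‖d‖ * Real.exp (-(ε * c ^ 3)) * ‖N (N (N z))‖ := by fun_prop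
    simpa using (this.tendsto 0).mono_left nhdsWithin_le_nhds
  refine le_of_tendsto hcont ?_
  filter_upwards [Ioc_mem_nhdsGT (show (0 : ℝ) < 1 / 2 by norm_num)] with ε hε
  exact key ε hε.1 hε.2

/-- The resolvent estimate for a compact operator of norm at most `r` whose diagonals are bounded
by `s` in `ℓ⁴`. -/
theorem norm_inverse_one_add_le [CompleteSpace H] {N : H →L[ℂ] H} (hN : IsCompactOperator N)
    {r s c : ℝ} (hr : ‖N‖ ≤ r) (hs0 : 0 ≤ s) (hs : DiagBound 4 N s) (hc : DiagBound 3 N c)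
    (h1 : (-1 : ℂ) ∉ spectrum ℂ N) :
    ‖Ring.inverse (1 + N)‖ ≤ (1 + r) ^ 2 + Real.exp (3 * (s + 1) ^ 4 / 4) / ‖det4OneAdd N‖ := by
  obtain ⟨d, hd0, hd⟩ := hasProd_detFactor hN hs h1
  have hdet : det4OneAdd N = d := hd.tprod_eq
  have hpos : 0 < ‖det4OneAdd N‖ := by
    rw [hdet]
    exact norm_pos_iff.2 hd0
  have hr0 : 0 ≤ r := (norm_nonneg _).trans hr
  have hunit : IsUnit (1 + N) := by
    have h2 : IsUnit (algebraMap ℂ (H →L[ℂ] H) (-1) - N) := by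
      by_contra h
      exact h1 h
    have h3 : 1 + N = -(algebraMap ℂ (H →L[ℂ] H) (-1) - N) := by
      rw [map_neg, map_one]
      abel
    rw [h3]
    exact h2.neg
  obtain ⟨u, hu⟩ := hunit
  rw [← hu, Ring.inverse_unit]
  refine ContinuousLinearMap.opNorm_le_bound _ (by positivity) fun x => ?_
  set z := (↑u⁻¹ : H →L[ℂ] H) x with hz
  have hx : z + N z = x := by
    have h2 : ((u : H →L[ℂ] H) * ↑u⁻¹) x = x := by simp
    rw [hu] at h2
    exact h2
  have h2 := norm_det4OneAdd_mul_le hN hs0 hs hc h1 z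
  rw [hx] at h2
  have h3 : ‖N (N (N z))‖ ≤ Real.exp (3 * (s + 1) ^ 4 / 4) / ‖det4OneAdd N‖ * ‖x‖ := by
    rw [div_mul_eq_mul_div, le_div_iff₀ hpos, mul_comm]
    refine h2.trans (le_of_eq ?_)
    congr 2
    ring
  have h4 : z = x - N x + N (N x) - N (N (N z)) := by
    rw [← hx]
    simp only [map_add]
    abel
  have hb : ∀ y, ‖N y‖ ≤ r * ‖y‖ := fun y => N.le_of_opNorm_le hr y
  calc ‖z‖ = ‖x - N x + N (N x) - N (N (N z))‖ := congrArg norm h4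
    _ ≤ ‖x‖ + ‖N x‖ + ‖N (N x)‖ + ‖N (N (N z))‖ :=
        (norm_sub_le _ _).trans (add_le_add_left ((norm_add_le _ _).trans
          (add_le_add_left (norm_sub_le _ _) _)) _)
    _ ≤ ‖x‖ + r * ‖x‖ + r * (r * ‖x‖) +
        Real.exp (3 * (s + 1) ^ 4 / 4) / ‖det4OneAdd N‖ * ‖x‖ := by
        gcongr
        · exact hb x
        · exact (hb _).trans (mul_le_mul_of_nonneg_left (hb x) hr0)
    _ ≤ _ := by nlinarith [mul_nonneg hr0 (norm_nonneg x)]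

end Determinant

section HilbertBasis

variable {ι : Type*} {H : Type*} [NormedAddCommGroup H] [InnerProductSpace ℂ H]
  (b : HilbertBasis ι ℂ H)

include b

lemma hasSum_norm_inner_sq (u : H) : HasSum (fun x => ‖inner ℂ (b x) u‖ ^ 2) (‖u‖ ^ 2) := by
  have h := b.hasSum_inner_mul_inner u u
  rw [inner_self_eq_norm_sq_to_K] at h
  have h2 : ∀ x, inner ℂ u (b x) * inner ℂ (b x) u = ((‖inner ℂ (b x) u‖ ^ 2 : ℝ) : ℂ) := by
    intro x
    rw [← inner_conj_symm u (b x), conj_mul']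
    push_cast
    rfl
  simp only [h2] at h
  refine Complex.hasSum_ofReal.1 ?_
  convert! h using 1
  push_cast
  rfl

lemma eq_of_forall_inner_eq {u v : H} (h : ∀ x, inner ℂ (b x) u = inner ℂ (b x) v) : u = v := by
  refine b.repr.injective ?_
  ext x
  rw [b.repr_apply_apply, b.repr_apply_apply, h]

lemma exists_forall_inner_eq {a : ι → ℂ} (ha : Summable fun x => ‖a x‖ ^ 2) :
    ∃ u : H, ∀ x, inner ℂ (b x) u = a x := by
  have hm : Memℓp a 2 := by
    rw [memℓp_gen_iff (by norm_num)]
    simpa using ha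
  refine ⟨b.repr.symm ⟨a, hm⟩, fun x => ?_⟩
  rw [← b.repr_apply_apply, LinearIsometryEquiv.apply_symm_apply]

lemma norm_le_of_forall_norm_inner_le {u v : H} (h : ∀ x, ‖inner ℂ (b x) u‖ ≤ ‖inner ℂ (b x) v‖) :
    ‖u‖ ≤ ‖v‖ := by
  refine le_of_pow_le_pow_left₀ two_ne_zero (norm_nonneg _) ?_
  exact hasSum_le (fun x => pow_le_pow_left₀ (norm_nonneg _) (h x) 2) (hasSum_norm_inner_sq b u)
    (hasSum_norm_inner_sq b v)

/-- Weighted permutations of a Hilbert basis are bounded operators. -/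
lemma exists_weightedPerm (d : ι → ℂ) {C : ℝ} (hC : 0 ≤ C) (hd : ∀ x, ‖d x‖ ≤ C) (σ : ι ≃ ι) :
    ∃ D : H →L[ℂ] H, ‖D‖ ≤ C ∧ ∀ u x, inner ℂ (b x) (D u) = d x * inner ℂ (b (σ x)) u := by
  have hle : ∀ u x, ‖d x * inner ℂ (b (σ x)) u‖ ^ 2 ≤ C ^ 2 * ‖inner ℂ (b (σ x)) u‖ ^ 2 := by
    intro u x
    rw [norm_mul, mul_pow]
    exact mul_le_mul_of_nonneg_right (pow_le_pow_left₀ (norm_nonneg _) (hd x) 2) (by positivity)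
  have hsum : ∀ u, HasSum (fun x => C ^ 2 * ‖inner ℂ (b (σ x)) u‖ ^ 2) (C ^ 2 * ‖u‖ ^ 2) :=
    fun u => ((σ.hasSum_iff (f := fun x => ‖inner ℂ (b x) u‖ ^ 2)).2
      (hasSum_norm_inner_sq b u)).mul_left _
  have hex : ∀ u, ∃ w : H, ∀ x, inner ℂ (b x) w = d x * inner ℂ (b (σ x)) u := fun u =>
    exists_forall_inner_eq b ((hsum u).summable.of_nonneg_of_le (fun x => by positivity) (hle u))
  choose f hf using hex
  let L : H →ₗ[ℂ] H :=
    { toFun := f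
      map_add' := fun u v => eq_of_forall_inner_eq b fun x => by
        rw [inner_add_right, hf, hf, hf, inner_add_right, mul_add]
      map_smul' := fun c u => eq_of_forall_inner_eq b fun x => by
        rw [RingHom.id_apply, inner_smul_right, hf, hf, inner_smul_right]
        ring }
  have hL : ∀ u, ‖L u‖ ≤ C * ‖u‖ := by
    intro u
    refine le_of_pow_le_pow_left₀ two_ne_zero (by positivity) ?_
    rw [mul_pow]
    refine hasSum_le (fun x => ?_) (hasSum_norm_inner_sq b (L u)) (hsum u)
    change ‖inner ℂ (b x) (f u)‖ ^ 2 ≤ _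
    rw [hf]
    exact hle u x
  exact ⟨L.mkContinuous C hL, L.mkContinuous_norm_le hC hL, fun u x => hf u x⟩

/-- A diagonal operator whose entries tend to zero is compact. -/
lemma isCompactOperator_of_diagonal [CompleteSpace H] {D : H →L[ℂ] H} {d : ι → ℂ}
    (hD : ∀ u x, inner ℂ (b x) (D u) = d x * inner ℂ (b x) u)
    (hd : Filter.Tendsto d Filter.cofinite (nhds 0)) : IsCompactOperator D := by
  classical
  have hfin : ∀ n : ℕ, {x | 1 / ((n : ℝ) + 1) ≤ ‖d x‖}.Finite := by
    intro n
    have h := (tendsto_zero_iff_norm_tendsto_zero.1 hd).eventually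
      (gt_mem_nhds (show (0 : ℝ) < 1 / ((n : ℝ) + 1) by positivity))
    refine (Filter.eventually_cofinite.1 h).subset fun x hx => ?_
    exact not_lt.2 hx
  let R : ℕ → H →L[ℂ] H := fun n => ∑ x ∈ (hfin n).toFinset,
    ContinuousLinearMap.toSpanSingleton ℂ (d x • b x) ∘L innerSL ℂ (b x)
  have hR : ∀ n, IsCompactOperator (R n) := by
    intro n
    refine Submodule.sum_mem (compactOperator (RingHom.id ℂ) H H) fun x _ => ?_
    exact (isCompactOperator_of_locallyCompactSpace_rng
      (ContinuousLinearMap.toSpanSingleton ℂ (d x • b x))).comp_clm (innerSL ℂ (b x))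
  have hRc : ∀ n u y, inner ℂ (b y) (R n u) =
      if y ∈ (hfin n).toFinset then d y * inner ℂ (b y) u else 0 := by
    intro n u y
    have h1 : R n u = ∑ x ∈ (hfin n).toFinset, inner ℂ (b x) u • d x • b x := by
      simp [R]
    rw [h1, inner_sum]
    simp only [inner_smul_right, orthonormal_iff_ite.1 b.orthonormal, mul_ite, mul_one, mul_zero,
      Finset.sum_ite_eq]
    split_ifs <;> ring
  have hlim : Filter.Tendsto R Filter.atTop (nhds D) := by
    rw [tendsto_iff_norm_sub_tendsto_zero]
    refine squeeze_zero (fun n => norm_nonneg _) (fun n => ?_)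
      (tendsto_one_div_add_atTop_nhds_zero_nat (𝕜 := ℝ))
    refine ContinuousLinearMap.opNorm_le_bound _ (by positivity) fun u => ?_
    have hn : (0 : ℝ) ≤ 1 / ((n : ℝ) + 1) := by positivity
    rw [show 1 / ((n : ℝ) + 1) * ‖u‖ = ‖((1 / ((n : ℝ) + 1) : ℝ) : ℂ) • u‖ by
      rw [norm_smul, norm_real, Real.norm_of_nonneg hn]]
    refine norm_le_of_forall_norm_inner_le b fun y => ?_
    rw [sub_apply, inner_sub_right, hRc, hD, inner_smul_right, norm_mul, norm_real,
      Real.norm_of_nonneg hn]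
    split_ifs with hy
    · rw [sub_self, norm_zero]
      positivity
    · rw [zero_sub, norm_neg, norm_mul]
      refine mul_le_mul_of_nonneg_right ?_ (norm_nonneg _)
      rw [Set.Finite.mem_toFinset, Set.mem_ofPred_eq, not_le] at hy
      exact hy.le
  exact isCompactOperator_of_tendsto hlim (Filter.Eventually.of_forall hR)

lemma sum_norm_sq_le_of_orthonormal [CompleteSpace H] (G : H →L[ℂ] H) {A : ℝ} {a : ι → ℝ}
    (ha : HasSum a A) (hG : ∀ x, ‖ContinuousLinearMap.adjoint G (b x)‖ ^ 2 ≤ a x) {n : ℕ}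
    {e : Fin n → H} (he : Orthonormal ℂ e) : ∑ i, ‖G (e i)‖ ^ 2 ≤ A := by
  have h1 : HasSum (fun x => ∑ i, ‖inner ℂ (b x) (G (e i))‖ ^ 2) (∑ i, ‖G (e i)‖ ^ 2) :=
    hasSum_sum fun i _ => hasSum_norm_inner_sq b (G (e i))
  refine hasSum_le (fun x => le_trans ?_ (hG x)) h1 ha
  refine le_trans (Finset.sum_le_sum fun i _ => le_of_eq ?_)
    (he.sum_inner_products_le (s := Finset.univ) (ContinuousLinearMap.adjoint G (b x)))
  rw [ContinuousLinearMap.adjoint_inner_right, norm_inner_symm]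

/-- If `T T*` is Hilbert–Schmidt then the diagonals of `T` are bounded in `ℓ⁴`. -/
lemma diagBound_four_of_hasSum [CompleteSpace H] (T : H →L[ℂ] H) {A s : ℝ} {a : ι → ℝ}
    (ha : HasSum a A) (hT : ∀ x, ‖T (ContinuousLinearMap.adjoint T (b x))‖ ^ 2 ≤ a x)
    (hA : A ≤ s ^ 4) : DiagBound 4 T s := by
  intro n e he
  set G : H →L[ℂ] H := T ∘L ContinuousLinearMap.adjoint T with hG
  have hadj : ContinuousLinearMap.adjoint G = G := by
    rw [hG, ContinuousLinearMap.adjoint_comp, ContinuousLinearMap.adjoint_adjoint]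
  have h1 := sum_norm_sq_le_of_orthonormal b G ha (by rw [hadj]; exact hT) he
  refine le_trans (Finset.sum_le_sum fun i _ => ?_) (h1.trans hA)
  set y := ContinuousLinearMap.adjoint T (e i) with hy
  have h2 : ‖inner ℂ (e i) (T (e i))‖ ≤ ‖y‖ := by
    rw [← ContinuousLinearMap.adjoint_inner_left]
    refine (norm_inner_le_norm _ _).trans ?_
    rw [he.1 i, mul_one]
  have h3 : ‖y‖ ^ 2 ≤ ‖G (e i)‖ := by
    have h4 : inner ℂ y y = inner ℂ (e i) (G (e i)) := by
      rw [hy, ContinuousLinearMap.adjoint_inner_left]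
      rfl
    rw [inner_self_eq_norm_sq_to_K] at h4
    have h5 := norm_inner_le_norm (𝕜 := ℂ) (e i) (G (e i))
    rw [← h4, he.1 i, one_mul, norm_pow] at h5
    simpa using h5
  calc ‖inner ℂ (e i) (T (e i))‖ ^ 4 ≤ ‖y‖ ^ 4 := pow_le_pow_left₀ (norm_nonneg _) h2 4
    _ = (‖y‖ ^ 2) ^ 2 := by ring
    _ ≤ ‖G (e i)‖ ^ 2 := pow_le_pow_left₀ (by positivity) h3 2

/-- The diagonals of a product of a diagonal operator with cube-summable entries and a bounded
operator are bounded in `ℓ³`. -/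
lemma exists_diagBound_three [CompleteSpace H] {D : H →L[ℂ] H} (V : H →L[ℂ] H) {d : ι → ℂ}
    (hD : ∀ u x, inner ℂ (b x) (D u) = d x * inner ℂ (b x) u)
    (hd : Summable fun x => ‖d x‖ ^ 3) : ∃ c, DiagBound 3 (D ∘L V) c := by
  set A := ∑' x, ‖d x‖ ^ 3
  refine ⟨max 1 (‖V‖ ^ 3 * A), fun n e he => ?_⟩
  have hadj : ∀ u x, ‖inner ℂ (b x) (ContinuousLinearMap.adjoint D u)‖ =
      ‖d x‖ * ‖inner ℂ (b x) u‖ := by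
    intro u x
    have h1 : D (b x) = d x • b x := by
      classical
      refine eq_of_forall_inner_eq b fun y => ?_
      rw [hD, inner_smul_right, orthonormal_iff_ite.1 b.orthonormal]
      split_ifs with h
      · rw [h]
      · simp
    rw [ContinuousLinearMap.adjoint_inner_right, h1, inner_smul_left, norm_mul, RCLike.norm_conj]
  have hsum : ∀ i, HasSum (fun x => ‖d x‖ ^ 2 * ‖inner ℂ (b x) (e i)‖ ^ 2)
      (‖ContinuousLinearMap.adjoint D (e i)‖ ^ 2) := by
    intro i
    have h1 := hasSum_norm_inner_sq b (ContinuousLinearMap.adjoint D (e i))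
    simpa only [hadj, mul_pow] using h1
  have hbd : ∀ i x, ‖inner ℂ (b x) (e i)‖ ^ 2 ≤ 1 := by
    intro i x
    have h1 := norm_inner_le_norm (𝕜 := ℂ) (b x) (e i)
    rw [b.orthonormal.1 x, he.1 i, one_mul] at h1
    exact pow_le_one₀ (norm_nonneg _) h1
  have hs3 : ∀ i, Summable fun x => ‖d x‖ ^ 3 * ‖inner ℂ (b x) (e i)‖ ^ 2 := fun i =>
    hd.of_nonneg_of_le (fun x => by positivity)
      fun x => mul_le_of_le_one_right (by positivity) (hbd i x)
  have hcube : ∀ i, ‖ContinuousLinearMap.adjoint D (e i)‖ ^ 3 ≤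
      ∑' x, ‖d x‖ ^ 3 * ‖inner ℂ (b x) (e i)‖ ^ 2 := by
    intro i
    set t := ‖ContinuousLinearMap.adjoint D (e i)‖
    have ht : 0 ≤ t := norm_nonneg _
    have hone := hasSum_norm_inner_sq b (e i)
    rw [he.1 i, one_pow] at hone
    have h1 := ((hsum i).mul_left (3 * t))
    have h2 := ((hs3 i).hasSum.mul_left 2).add (hone.mul_left (t ^ 3))
    have h3 := hasSum_le (fun x => ?_) h1 h2
    · nlinarith
    · have h4 : 3 * t * ‖d x‖ ^ 2 ≤ 2 * ‖d x‖ ^ 3 + t ^ 3 := by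
        have h5 : 0 ≤ (‖d x‖ - t) ^ 2 * (2 * ‖d x‖ + t) := by positivity
        nlinarith
      have h5 := mul_le_mul_of_nonneg_right h4 (sq_nonneg ‖inner ℂ (b x) (e i)‖)
      linarith
  have hterm : ∀ i, ‖inner ℂ (e i) ((D ∘L V) (e i))‖ ^ 3 ≤
      ‖V‖ ^ 3 * ∑' x, ‖d x‖ ^ 3 * ‖inner ℂ (b x) (e i)‖ ^ 2 := by
    intro i
    have h1 : ‖inner ℂ (e i) ((D ∘L V) (e i))‖ ≤ ‖V‖ * ‖ContinuousLinearMap.adjoint D (e i)‖ := by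
      rw [ContinuousLinearMap.comp_apply, ← ContinuousLinearMap.adjoint_inner_left]
      refine (norm_inner_le_norm _ _).trans ?_
      have h2 := V.le_opNorm (e i)
      rw [he.1 i, mul_one] at h2
      rw [mul_comm]
      exact mul_le_mul_of_nonneg_right h2 (norm_nonneg _)
    refine (pow_le_pow_left₀ (norm_nonneg _) h1 3).trans ?_
    rw [mul_pow]
    exact mul_le_mul_of_nonneg_left (hcube i) (by positivity)
  have hA : ∑ i, ∑' x, ‖d x‖ ^ 3 * ‖inner ℂ (b x) (e i)‖ ^ 2 ≤ A := by
    refine hasSum_le (fun x => ?_) (hasSum_sum fun i _ => (hs3 i).hasSum) hd.hasSum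
    rw [← Finset.mul_sum]
    refine mul_le_of_le_one_right (by positivity) ?_
    have h1 := he.sum_inner_products_le (s := Finset.univ) (b x)
    rw [b.orthonormal.1 x, one_pow] at h1
    simpa only [norm_inner_symm (b x)] using h1
  calc ∑ i, ‖inner ℂ (e i) ((D ∘L V) (e i))‖ ^ 3 ≤
        ∑ i, ‖V‖ ^ 3 * ∑' x, ‖d x‖ ^ 3 * ‖inner ℂ (b x) (e i)‖ ^ 2 :=
        Finset.sum_le_sum fun i _ => hterm i
    _ ≤ ‖V‖ ^ 3 * A := by
        rw [← Finset.mul_sum]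
        exact mul_le_mul_of_nonneg_left hA (by positivity)
    _ ≤ max 1 (‖V‖ ^ 3 * A) := le_max_right _ _
    _ ≤ max 1 (‖V‖ ^ 3 * A) ^ 3 := le_self_pow₀ (le_max_left _ _) (by norm_num)

end HilbertBasis

section Hopping

/-- Indices of the Fourier modes: a component and a frequency. -/
abbrev Mode : Type := Fin 2 × ℤ × ℤ

/-- The sign with which the potential shifts the frequency in each component. -/
def sgn (j : Fin 2) : ℤ := if j = 0 then 1 else -1

/-- The frequencies of the three terms of the potential. -/
def freqStep : Fin 3 → ℤ × ℤ := ![(-1, -1), (2, -1), (-1, 2)]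

/-- The action of the `k`-th term of the potential on the Fourier modes. -/
def hop (k : Fin 3) : Mode ≃ Mode :=
  Function.Involutive.toPerm (fun x => (1 - x.1, x.2 - sgn x.1 • freqStep k)) (by
    rintro ⟨j, p⟩
    have h : sgn (1 - j) = -sgn j := by fin_cases j <;> rfl
    ext1
    · fin_cases j <;> rfl
    · simp [h])

lemma hop_apply (k : Fin 3) (x : Mode) : hop k x = (1 - x.1, x.2 - sgn x.1 • freqStep k) := rfl

lemma hop_hop_self (k : Fin 3) (x : Mode) : hop k (hop k x) = x :=
  Function.Involutive.toPerm_involutive _ x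

lemma hop_hop (k l : Fin 3) (x : Mode) :
    hop l (hop k x) = (x.1, x.2 + sgn x.1 • (freqStep l - freqStep k)) := by
  obtain ⟨j, p⟩ := x
  have h : sgn (1 - j) = -sgn j := by fin_cases j <;> rfl
  simp only [hop_apply, h]
  ext1
  · fin_cases j <;> rfl
  · simp only [neg_smul, smul_sub]
    abel

/-- The pairs of terms of the potential with distinct frequency differences. -/
def stepPair : Fin 7 → Fin 3 × Fin 3 := ![(0, 0), (0, 1), (0, 2), (1, 0), (1, 2), (2, 0), (2, 1)]

lemma injective_hop_hop (x : Mode) :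
    Function.Injective fun t => hop (stepPair t).2 (hop (stepPair t).1 x) := by
  have h : Function.Injective fun t : Fin 7 =>
      freqStep (stepPair t).2 - freqStep (stepPair t).1 := by decide
  intro t t' htt
  refine h ?_
  simp only [hop_hop, Prod.mk.injEq, true_and, add_right_inj] at htt
  have hs : sgn x.1 ≠ 0 := by
    unfold sgn
    split_ifs <;> norm_num
  exact smul_right_injective _ hs htt

variable {H : Type*} [NormedAddCommGroup H] [InnerProductSpace ℂ H] [CompleteSpace H]
  (b : HilbertBasis Mode ℂ H)

/-- The diagonals of the weighted hopping operator are bounded in `ℓ⁴`. -/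
theorem diagBound_hopping {T : H →L[ℂ] H} {d : Mode → ℂ} {c : Fin 3 → ℂ} (hc : ∀ k, ‖c k‖ = 1)
    (hT : ∀ u x, inner ℂ (b x) (T u) = d x * ∑ k, c k * inner ℂ (b (hop k x)) u) {A s : ℝ}
    (hA : HasSum (fun x => ‖d x‖ ^ 4) A) (hs : 15 * A ≤ s ^ 4) : DiagBound 4 T s := by
  classical
  have hadj : ∀ x, ContinuousLinearMap.adjoint T (b x) =
      (starRingEnd ℂ) (d x) • ∑ k, (starRingEnd ℂ) (c k) • b (hop k x) := by
    intro x
    refine ext_inner_right ℂ fun u => ?_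
    rw [ContinuousLinearMap.adjoint_inner_left, hT, inner_smul_left, sum_inner, conj_conj]
    simp only [inner_smul_left, conj_conj]
  have hTb : ∀ z, T (b z) = ∑ l, (c l * d (hop l z)) • b (hop l z) := by
    intro z
    refine eq_of_forall_inner_eq b fun y => ?_
    rw [hT, inner_sum, Finset.mul_sum]
    refine Finset.sum_congr rfl fun l _ => ?_
    rw [inner_smul_right, orthonormal_iff_ite.1 b.orthonormal, orthonormal_iff_ite.1 b.orthonormal]
    by_cases h : y = hop l z
    · rw [if_pos h, if_pos (by rw [h, hop_hop_self]), h]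
      ring
    · rw [if_neg h, if_neg (fun h' => h (by rw [← h', hop_hop_self]))]
      ring
  have hcc : ∀ k, (starRingEnd ℂ) (c k) * c k = 1 := fun k => by
    rw [conj_mul', hc]
    simp
  set τ : Fin 7 → Mode → Mode := fun t x => hop (stepPair t).2 (hop (stepPair t).1 x) with hτ
  set w : Fin 7 → ℂ := fun t => if t = 0 then 3 else
    (starRingEnd ℂ) (c (stepPair t).1) * c (stepPair t).2 with hw
  have hTT : ∀ x, T (ContinuousLinearMap.adjoint T (b x)) =
      (starRingEnd ℂ) (d x) • ∑ t, (w t * d (τ t x)) • b (τ t x) := by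
    intro x
    rw [hadj, map_smul, map_sum]
    simp only [map_smul, hTb, Fin.sum_univ_three, Fin.sum_univ_seven, smul_add, smul_smul, hw, hτ,
      stepPair, hop_hop_self, ← mul_assoc, hcc]
    simp only [Matrix.cons_val, hop_hop_self, ↓reduceIte, Fin.reduceEq, ← smul_smul]
    module
  have hnorm : ∀ x, ‖T (ContinuousLinearMap.adjoint T (b x))‖ ^ 2 =
      ‖d x‖ ^ 2 * ∑ t, ‖w t‖ ^ 2 * ‖d (τ t x)‖ ^ 2 := by
    intro x
    rw [hTT, norm_smul, RCLike.norm_conj, mul_pow]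
    congr 1
    have hon : Orthonormal ℂ fun t => b (τ t x) := b.orthonormal.comp _ (injective_hop_hop x)
    have h1 := hon.inner_sum (fun t => w t * d (τ t x)) (fun t => w t * d (τ t x)) Finset.univ
    rw [inner_self_eq_norm_sq_to_K] at h1
    simp only [conj_mul'] at h1
    have h2 : ((‖∑ t, (w t * d (τ t x)) • b (τ t x)‖ ^ 2 : ℝ) : ℂ) =
        ((∑ t, ‖w t * d (τ t x)‖ ^ 2 : ℝ) : ℂ) := by
      push_cast
      exact h1
    simpa only [norm_mul, mul_pow] using ofReal_injective h2
  have hwn : ∑ t, ‖w t‖ ^ 2 = 15 := by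
    have : ∀ t, ‖w t‖ ^ 2 = if t = 0 then 9 else 1 := by
      intro t
      simp only [hw]
      split_ifs
      · norm_num
      · rw [norm_mul, RCLike.norm_conj, hc, hc]
        norm_num
    simp only [this, Fin.sum_univ_seven, Fin.reduceEq, ↓reduceIte]
    norm_num
  have hsum : ∀ t, HasSum (fun x => ‖w t‖ ^ 2 * (1 / 2 * ‖d x‖ ^ 4 + 1 / 2 * ‖d (τ t x)‖ ^ 4))
      (‖w t‖ ^ 2 * A) := by
    intro t
    have h1 : HasSum (fun x => ‖d (τ t x)‖ ^ 4) A :=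
      (((hop (stepPair t).1).trans (hop (stepPair t).2)).hasSum_iff
        (f := fun x => ‖d x‖ ^ 4)).2 hA
    have h2 := ((hA.mul_left (1 / 2)).add (h1.mul_left (1 / 2))).mul_left (‖w t‖ ^ 2)
    convert! h2 using 1
    ring
  refine diagBound_four_of_hasSum b T (hasSum_sum fun t (_ : t ∈ Finset.univ) => hsum t)
    (fun x => ?_) ?_
  · rw [hnorm, Finset.mul_sum]
    refine Finset.sum_le_sum fun t _ => ?_
    have h1 : 0 ≤ ‖w t‖ ^ 2 * (‖d x‖ ^ 2 - ‖d (τ t x)‖ ^ 2) ^ 2 := by positivity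
    nlinarith
  · rw [← Finset.sum_mul, hwn]
    exact hs

end Hopping

section LatticeSum

/-- The momentum of the character with frequency `p`. -/
def momentum (p : ℤ × ℤ) : ℂ :=
  ⟨-((p.1 + p.2 : ℝ) / 2), (p.1 - p.2 : ℝ) / (2 * Real.sqrt 3)⟩

lemma norm_momentum_sq (p : ℤ × ℤ) :
    ‖momentum p‖ ^ 2 = ((p.1 : ℝ) ^ 2 + p.1 * p.2 + (p.2 : ℝ) ^ 2) / 3 := by
  have h : Real.sqrt 3 ^ 2 = 3 := Real.sq_sqrt (by norm_num)
  rw [← normSq_eq_norm_sq, normSq_apply, momentum]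
  field_simp
  rw [h]
  ring

/-- The modes that occur in `L²₁`. -/
def Admissible (x : Mode) : Prop :=
  x.2.1 % 3 = 1 + (x.1 : ℤ) ∧ x.2.2 % 3 = 1 + (x.1 : ℤ)

instance (x : Mode) : Decidable (Admissible x) := by
  unfold Admissible
  infer_instance

lemma admissible_hop (k : Fin 3) (x : Mode) : Admissible (hop k x) ↔ Admissible x := by
  obtain ⟨j, a, b⟩ := x
  simp only [Admissible, hop_apply, sgn, freqStep]
  fin_cases j <;> fin_cases k <;> simp <;> omega

/-- The Fourier multiplier of `(2 D_{z̄})⁻¹` on the admissible modes. -/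
def multiplier (x : Mode) : ℂ := if Admissible x then 1 / (I * momentum x.2) else 0

/-- A parametrization of the admissible modes. -/
def modeOf (y : Fin 2 × ℤ × ℤ) : Mode :=
  (y.1, sgn y.1 * (1 + 3 * y.2.1), sgn y.1 * (1 + 3 * y.2.2))

lemma injective_modeOf : Function.Injective modeOf := by
  rintro ⟨j, m, n⟩ ⟨j', m', n'⟩ h
  simp only [modeOf, Prod.mk.injEq] at h
  obtain ⟨rfl, h1, h2⟩ := h
  fin_cases j <;> simp [sgn] at h1 h2 ⊢ <;> omega

lemma admissible_modeOf (y : Fin 2 × ℤ × ℤ) : Admissible (modeOf y) := by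
  obtain ⟨j, m, n⟩ := y
  fin_cases j <;> simp [Admissible, modeOf, sgn] <;> omega

lemma mem_range_modeOf {x : Mode} (hx : Admissible x) : x ∈ Set.range modeOf := by
  obtain ⟨j, a, b⟩ := x
  refine ⟨(j, (sgn j * a - 1) / 3, (sgn j * b - 1) / 3), ?_⟩
  fin_cases j <;> simp [Admissible, modeOf, sgn] at hx ⊢ <;> omega

lemma multiplier_eq_zero_of_notMem_range {x : Mode} (hx : x ∉ Set.range modeOf) :
    multiplier x = 0 :=
  if_neg fun h => hx (mem_range_modeOf h)

/-- A quadratic weight on the integers. -/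
def quadWeight (m : ℤ) : ℝ := 3 * (m : ℝ) ^ 2 + 3 * m + 1

lemma one_le_quadWeight (m : ℤ) : 1 ≤ quadWeight m := by
  have h : (0 : ℤ) ≤ m * (m + 1) := by
    rcases le_or_gt 0 m with h | h
    · positivity
    · exact mul_nonneg_of_nonpos_of_nonpos h.le (by omega)
  have h2 : (0 : ℝ) ≤ m * (m + 1) := by exact_mod_cast h
  unfold quadWeight
  nlinarith

lemma norm_momentum_modeOf_sq (y : Fin 2 × ℤ × ℤ) :
    (quadWeight y.2.1 + quadWeight y.2.2) / 2 ≤ ‖momentum (modeOf y).2‖ ^ 2 := by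
  obtain ⟨j, m, n⟩ := y
  have h : (0 : ℤ) ≤ (m + n + 1) * (m + n) := by
    rcases le_or_gt 0 (m + n) with h | h
    · positivity
    · exact mul_nonneg_of_nonpos_of_nonpos (by omega) h.le
  have h2 : (0 : ℝ) ≤ (m + n + 1) * (m + n) := by exact_mod_cast h
  have h3 : ((sgn j : ℤ) : ℝ) ^ 2 = 1 := by
    fin_cases j <;> simp [sgn]
  rw [norm_momentum_sq]
  simp only [modeOf, quadWeight]
  push_cast
  have h4 : (((sgn j : ℤ) : ℝ) * (1 + 3 * m)) ^ 2 + (sgn j : ℤ) * (1 + 3 * m) *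
      ((sgn j : ℤ) * (1 + 3 * n)) + (((sgn j : ℤ) : ℝ) * (1 + 3 * n)) ^ 2 =
      ((sgn j : ℤ) : ℝ) ^ 2 *
        ((1 + 3 * m) ^ 2 + (1 + 3 * m) * (1 + 3 * n) + (1 + 3 * n) ^ 2) := by ring
  rw [h4, h3]
  nlinarith

lemma momentum_ne_zero_of_admissible {x : Mode} (hx : Admissible x) : momentum x.2 ≠ 0 := by
  obtain ⟨y, rfl⟩ := mem_range_modeOf hx
  intro h
  have h1 := norm_momentum_modeOf_sq y
  rw [h, norm_zero] at h1
  linarith [one_le_quadWeight y.2.1, one_le_quadWeight y.2.2]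

lemma norm_multiplier_modeOf (y : Fin 2 × ℤ × ℤ) :
    ‖multiplier (modeOf y)‖ = 1 / ‖momentum (modeOf y).2‖ := by
  rw [multiplier, if_pos (admissible_modeOf y), norm_div, norm_mul, norm_I, one_mul, norm_one]

lemma norm_multiplier_pow_four_le (y : Fin 2 × ℤ × ℤ) :
    ‖multiplier (modeOf y)‖ ^ 4 ≤ 1 * ((quadWeight y.2.1)⁻¹ * (quadWeight y.2.2)⁻¹) := by
  have h1 := norm_momentum_modeOf_sq y
  have h2 := one_le_quadWeight y.2.1
  have h3 := one_le_quadWeight y.2.2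
  rw [norm_multiplier_modeOf, one_mul, ← mul_inv, one_div, inv_pow]
  refine inv_anti₀ (by positivity) ?_
  have h4 : ‖momentum (modeOf y).2‖ ^ 4 = (‖momentum (modeOf y).2‖ ^ 2) ^ 2 := by ring
  rw [h4]
  nlinarith [sq_nonneg (quadWeight y.2.1 - quadWeight y.2.2)]

lemma norm_multiplier_le (x : Mode) : ‖multiplier x‖ ≤ 1 := by
  by_cases hx : x ∈ Set.range modeOf
  · obtain ⟨y, rfl⟩ := hx
    refine le_of_pow_le_pow_left₀ (n := 4) (by norm_num) zero_le_one ?_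
    refine (norm_multiplier_pow_four_le y).trans ?_
    rw [one_mul, one_pow]
    exact mul_le_one₀ (inv_le_one_of_one_le₀ (one_le_quadWeight _))
      (inv_nonneg.2 (zero_le_one.trans (one_le_quadWeight _)))
      (inv_le_one_of_one_le₀ (one_le_quadWeight _))
  · rw [multiplier_eq_zero_of_notMem_range hx, norm_zero]
    exact zero_le_one

lemma sum_range_inv_quadWeight_le (n : ℕ) :
    ∑ i ∈ Finset.range (n + 1), (quadWeight i)⁻¹ ≤ 4 / 3 - 1 / (3 * ((n : ℝ) + 1)) := by
  induction n with
  | zero => norm_num [quadWeight]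
  | succ n ih =>
    rw [Finset.sum_range_succ]
    have hn : (0 : ℝ) ≤ n := n.cast_nonneg
    have h1 : (quadWeight ((n + 1 : ℕ) : ℤ))⁻¹ ≤ 1 / (3 * ((n : ℝ) + 1)) -
        1 / (3 * (((n + 1 : ℕ) : ℝ) + 1)) := by
      have h2 : 1 / (3 * ((n : ℝ) + 1)) - 1 / (3 * (((n + 1 : ℕ) : ℝ) + 1)) =
          (3 * ((n : ℝ) + 1) * (n + 2))⁻¹ := by
        push_cast
        field_simp
        ring
      rw [h2]
      refine inv_anti₀ (by positivity) ?_
      simp only [quadWeight]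
      push_cast
      nlinarith
    linarith

lemma hasSum_inv_quadWeight : ∃ B : ℝ, B ≤ 8 / 3 ∧ HasSum (fun m : ℤ => (quadWeight m)⁻¹) B := by
  have hpos : ∀ m, 0 ≤ (quadWeight m)⁻¹ := fun m =>
    inv_nonneg.2 (zero_le_one.trans (one_le_quadWeight m))
  have hb : ∀ n : ℕ, ∑ i ∈ Finset.range n, (quadWeight i)⁻¹ ≤ 4 / 3 := by
    intro n
    refine (Finset.sum_le_sum_of_subset_of_nonneg (Finset.range_mono (Nat.le_succ n))
      fun i _ _ => hpos i).trans ((sum_range_inv_quadWeight_le n).trans ?_)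
    have : 0 ≤ 1 / (3 * ((n : ℝ) + 1)) := by positivity
    linarith
  have h1 : Summable fun n : ℕ => (quadWeight n)⁻¹ :=
    summable_of_sum_range_le (fun n => hpos n) hb
  have h2 : ∑' n : ℕ, (quadWeight n)⁻¹ ≤ 4 / 3 := Real.tsum_le_of_sum_range_le (fun n => hpos n) hb
  have h3 : ∀ n : ℕ, quadWeight (-((n : ℤ) + 1)) = quadWeight n := fun n => by
    simp only [quadWeight]
    push_cast
    ring
  refine ⟨_, ?_, HasSum.of_nat_of_neg_add_one h1.hasSum (f := fun m : ℤ => (quadWeight m)⁻¹)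
    (m' := ∑' n : ℕ, (quadWeight n)⁻¹) (by simpa only [h3] using h1.hasSum)⟩
  linarith

lemma hasSum_prod_of_nonneg {f : ℤ → ℝ} {B : ℝ} (hf : ∀ m, 0 ≤ f m) (h : HasSum f B) :
    HasSum (fun y : Fin 2 × ℤ × ℤ => 1 * (f y.2.1 * f y.2.2)) (2 * (B * B)) := by
  have h1 : HasSum (fun p : ℤ × ℤ => f p.1 * f p.2) (B * B) :=
    h.mul h (h.summable.mul_of_nonneg h.summable hf hf)
  have h2 : HasSum (fun _ : Fin 2 => (1 : ℝ)) 2 := by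
    simpa using hasSum_fintype (fun _ : Fin 2 => (1 : ℝ))
  exact h2.mul h1 (h2.summable.mul_of_nonneg h1.summable (fun _ => zero_le_one)
    fun p => mul_nonneg (hf _) (hf _))

theorem exists_hasSum_norm_multiplier_pow_four :
    ∃ A : ℝ, 15 * A ≤ 4 ^ 4 ∧ HasSum (fun x => ‖multiplier x‖ ^ 4) A := by
  obtain ⟨B, hB, hsum⟩ := hasSum_inv_quadWeight
  have hpos : ∀ m, 0 ≤ (quadWeight m)⁻¹ := fun m =>
    inv_nonneg.2 (zero_le_one.trans (one_le_quadWeight m))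
  have h1 := hasSum_prod_of_nonneg hpos hsum
  have h2 : Summable fun y => ‖multiplier (modeOf y)‖ ^ 4 :=
    h1.summable.of_nonneg_of_le (fun y => by positivity) norm_multiplier_pow_four_le
  refine ⟨_, ?_, (injective_modeOf.hasSum_iff fun x hx => by
    rw [multiplier_eq_zero_of_notMem_range hx]; simp).1 h2.hasSum⟩
  have h3 := hasSum_le norm_multiplier_pow_four_le h2.hasSum h1
  have hB0 : 0 ≤ B := hsum.nonneg hpos
  nlinarith

theorem summable_norm_multiplier_pow_three : Summable fun x => ‖multiplier x‖ ^ 3 := by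
  have hpos : ∀ m, 0 ≤ (quadWeight m)⁻¹ := fun m =>
    inv_nonneg.2 (zero_le_one.trans (one_le_quadWeight m))
  have h0 : Summable fun m : ℤ => ((quadWeight m)⁻¹) ^ (3 / 4 : ℝ) := by
    refine Summable.of_norm_bounded_eventually
      (Real.summable_abs_int_rpow (b := 3 / 2) (by norm_num)) ?_
    refine (Filter.eventually_cofinite.2 (Set.Finite.subset (Set.finite_singleton 0)
      fun m hm => ?_))
    by_contra hm0
    refine hm ?_
    have hm1 : 0 < |(m : ℝ)| := abs_pos.2 (by exact_mod_cast hm0)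
    rw [Real.norm_of_nonneg (Real.rpow_nonneg (hpos m) _)]
    have h1 : |(m : ℝ)| ^ (-(3 / 2) : ℝ) = ((|(m : ℝ)| ^ 2)⁻¹) ^ (3 / 4 : ℝ) := by
      rw [← Real.rpow_natCast, ← Real.rpow_neg hm1.le, ← Real.rpow_mul hm1.le]
      norm_num
    rw [h1]
    refine Real.rpow_le_rpow (hpos m) (inv_anti₀ (by positivity) ?_) (by norm_num)
    rw [sq_abs]
    have h2 : (0 : ℤ) ≤ (2 * m + 1) * (m + 1) := by
      rcases le_or_gt 0 m with h | h
      · positivity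
      · exact mul_nonneg_of_nonpos_of_nonpos (by omega) (by omega)
    have h3 : (0 : ℝ) ≤ (2 * m + 1) * (m + 1) := by exact_mod_cast h2
    unfold quadWeight
    nlinarith
  have h1 := hasSum_prod_of_nonneg (fun m => Real.rpow_nonneg (hpos m) _) h0.hasSum
  refine (injective_modeOf.summable_iff fun x hx => by
    rw [multiplier_eq_zero_of_notMem_range hx]; simp).1 ?_
  refine h1.summable.of_nonneg_of_le (fun y => by simp only [Function.comp_apply]; positivity)
    fun y => ?_
  have h2 : ‖multiplier (modeOf y)‖ ^ 3 = (‖multiplier (modeOf y)‖ ^ 4) ^ (3 / 4 : ℝ) := by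
    rw [← Real.rpow_natCast, ← Real.rpow_natCast, ← Real.rpow_mul (norm_nonneg _)]
    norm_num
  rw [Function.comp_apply, h2, one_mul, ← Real.mul_rpow (hpos _) (hpos _)]
  refine Real.rpow_le_rpow (by positivity) ?_ (by norm_num)
  simpa using norm_multiplier_pow_four_le y

lemma tendsto_multiplier : Filter.Tendsto multiplier Filter.cofinite (nhds 0) := by
  have h := summable_norm_multiplier_pow_three.tendsto_cofinite_zero
  rw [tendsto_zero_iff_norm_tendsto_zero]
  have h2 := (Real.continuousAt_rpow_const 0 (1 / 3) (Or.inr (by norm_num))).tendsto.comp h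
  rw [Real.zero_rpow (by norm_num)] at h2
  refine h2.congr fun x => ?_
  rw [Function.comp_apply, ← Real.rpow_natCast, ← Real.rpow_mul (norm_nonneg _)]
  norm_num

end LatticeSum

section Characters

lemma omega_sq : omega ^ 2 = -(1 / 2) - (Real.sqrt 3 / 2 : ℝ) * I := by
  have hs : ((Real.sqrt 3 : ℝ) : ℂ) ^ 2 = 3 := by
    rw [← ofReal_pow, Real.sq_sqrt (by norm_num)]; norm_num
  rw [omega_eq]
  push_cast
  linear_combination (1 / 4 : ℂ) * (Real.sqrt 3 : ℂ) ^ 2 * I_sq - (1 / 4 : ℂ) * hs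

lemma momentum_add (m n : ℤ × ℤ) : momentum (m + n) = momentum m + momentum n := by
  apply Complex.ext <;> simp [momentum] <;> ring

lemma momentum_neg (n : ℤ × ℤ) : momentum (-n) = -momentum n := by
  apply Complex.ext <;> simp [momentum] <;> ring

lemma momentum_freqStep (k : Fin 3) : momentum (freqStep k) = omega ^ (k : ℕ) := by
  have hs : Real.sqrt 3 * Real.sqrt 3 = 3 := Real.mul_self_sqrt (by norm_num)
  have h0 : Real.sqrt 3 ≠ 0 := by positivity
  have h1 : (3 : ℝ) / (2 * Real.sqrt 3) = Real.sqrt 3 / 2 := by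
    field_simp
    linarith
  fin_cases k
  · apply Complex.ext <;> simp [momentum, freqStep]
  · apply Complex.ext <;> simp [momentum, freqStep, omega_eq] <;> norm_num [h1]
  · apply Complex.ext <;> simp [momentum, freqStep, omega_sq] <;> norm_num
    rw [neg_div, h1]

/-- The phase `Im (z q̄)` of the character with frequency `n`, where `q = momentum n`. -/
def phase (n : ℤ × ℤ) : ℂ →L[ℝ] ℝ :=
  imCLM ∘L (ContinuousLinearMap.mul ℝ ℂ).flip ((starRingEnd ℂ) (momentum n))

lemma phase_apply (n : ℤ × ℤ) (z : ℂ) :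
    phase n z = (z * (starRingEnd ℂ) (momentum n)).im := rfl

lemma phase_add (m n : ℤ × ℤ) (z : ℂ) : phase (m + n) z = phase m z + phase n z := by
  simp only [phase_apply, momentum_add, map_add, mul_add, add_im]

lemma phase_neg (n : ℤ × ℤ) (z : ℂ) : phase (-n) z = -phase n z := by
  simp only [phase_apply, momentum_neg, map_neg, mul_neg, neg_im]

lemma phase_gen (n : ℤ × ℤ) :
    phase n (gen 0) = 2 * Real.pi * n.1 ∧ phase n (gen 1) = 2 * Real.pi * n.2 := by
  have h0 : Real.sqrt 3 ≠ 0 := by positivity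
  have hs : Real.sqrt 3 ^ 2 = 3 := Real.sq_sqrt (by norm_num)
  have hg0 : gen 0 = 4 * Real.pi * I * (-(1 / 2) + (Real.sqrt 3 / 2 : ℝ) * I) := by
    rw [← omega_eq]; rfl
  have hg1 : gen 1 = 4 * Real.pi * I * (-(1 / 2) - (Real.sqrt 3 / 2 : ℝ) * I) := by
    rw [← omega_sq]; rfl
  rw [phase_apply, phase_apply, hg0, hg1]
  constructor <;> simp [momentum] <;> field_simp <;> ring

/-- The character `exp (i Im (z q̄))` of `ℂ / Γ` with frequency `n`, where `q = momentum n`. -/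
def char (n : ℤ × ℤ) (z : ℂ) : ℂ := exp (I * (phase n z : ℝ))

lemma norm_char (n : ℤ × ℤ) (z : ℂ) : ‖char n z‖ = 1 := by
  rw [char, mul_comm, norm_exp_ofReal_mul_I]

lemma char_add_left (m n : ℤ × ℤ) (z : ℂ) : char (m + n) z = char m z * char n z := by
  rw [char, char, char, ← exp_add, phase_add]
  push_cast
  ring_nf

lemma char_add_right (n : ℤ × ℤ) (z w : ℂ) : char n (z + w) = char n z * char n w := by
  rw [char, char, char, ← exp_add, map_add]
  push_cast
  ring_nf

lemma char_neg_right (n : ℤ × ℤ) (z : ℂ) : char n (-z) = char (-n) z := by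
  rw [char, char, map_neg, phase_neg]

lemma char_neg (n : ℤ × ℤ) (z : ℂ) : char (-n) z = (starRingEnd ℂ) (char n z) := by
  rw [char, char, ← exp_conj, phase_neg, map_mul, conj_I, conj_ofReal]
  push_cast
  ring_nf

lemma char_zero_left (z : ℂ) : char 0 z = 1 := by
  have h : momentum 0 = 0 := by simpa using momentum_add 0 0
  simp [char, phase_apply, h]

lemma contDiff_char (n : ℤ × ℤ) : ContDiff ℝ ∞ (char n) := by
  unfold char
  have h1 : ContDiff ℝ ∞ fun z => ((phase n z : ℝ) : ℂ) :=
    (ofRealCLM ∘L phase n).contDiff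
  exact (contDiff_const.mul h1).cexp

lemma fderiv_char (n : ℤ × ℤ) (z e : ℂ) :
    fderiv ℝ (char n) z e = I * (phase n e : ℝ) * char n z := by
  have h1 : HasFDerivAt (fun z => ((phase n z : ℝ) : ℂ)) (ofRealCLM ∘L phase n) z :=
    (ofRealCLM ∘L phase n).hasFDerivAt
  have h2 := (h1.const_mul I).cexp
  have h3 : fderiv ℝ (char n) z = _ := h2.fderiv
  rw [h3]
  simp [char]
  ring

lemma basis_apply (i : Fin 2) : basis i = gen i := by
  rw [basis, coe_basisOfLinearIndependentOfCardEqFinrank]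

lemma eq_repr_add (z : ℂ) :
    z = basis.repr z 0 • gen 0 + basis.repr z 1 • gen 1 := by
  conv_lhs => rw [← basis.sum_repr z]
  rw [Fin.sum_univ_two, basis_apply, basis_apply]

lemma phase_eq_repr (n : ℤ × ℤ) (z : ℂ) :
    phase n z = 2 * Real.pi * (n.1 * basis.repr z 0 + n.2 * basis.repr z 1) := by
  conv_lhs => rw [eq_repr_add z]
  rw [map_add, map_smul, map_smul, (phase_gen n).1, (phase_gen n).2, smul_eq_mul, smul_eq_mul]
  ring

lemma mem_lattice_iff (z : ℂ) : z ∈ lattice ↔ ∀ i, ∃ m : ℤ, (m : ℝ) = basis.repr z i := by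
  change z ∈ Submodule.span ℤ (Set.range basis) ↔ _
  rw [basis.mem_span_iff_repr_mem ℤ]
  simp [Set.mem_range]

lemma char_eq_one_iff (n : ℤ × ℤ) (z : ℂ) :
    char n z = 1 ↔ ∃ m : ℤ, n.1 * basis.repr z 0 + n.2 * basis.repr z 1 = (m : ℝ) := by
  rw [char, exp_eq_one_iff, phase_eq_repr]
  refine exists_congr fun m => ?_
  have hp : (2 * Real.pi * I : ℂ) ≠ 0 := two_pi_I_ne_zero
  have h : I * ((2 * Real.pi * (n.1 * basis.repr z 0 + n.2 * basis.repr z 1) : ℝ) : ℂ) =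
    ((n.1 * basis.repr z 0 + n.2 * basis.repr z 1 : ℝ) : ℂ) * (2 * Real.pi * I) := by
    push_cast; ring
  rw [h, mul_left_inj' hp]
  norm_cast

lemma mem_lattice_iff_char (z : ℂ) : z ∈ lattice ↔ ∀ n, char n z = 1 := by
  rw [mem_lattice_iff]
  constructor
  · intro h n
    obtain ⟨p, hp⟩ := h 0
    obtain ⟨q, hq⟩ := h 1
    rw [char_eq_one_iff, ← hp, ← hq]
    exact ⟨n.1 * p + n.2 * q, by push_cast; ring⟩
  · intro h i
    have h0 := (char_eq_one_iff _ _).1 (h (1, 0))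
    have h1 := (char_eq_one_iff _ _).1 (h (0, 1))
    fin_cases i
    · obtain ⟨m, hm⟩ := h0
      exact ⟨m, by simpa using hm.symm⟩
    · obtain ⟨m, hm⟩ := h1
      exact ⟨m, by simpa using hm.symm⟩

lemma char_add_lattice (n : ℤ × ℤ) {γ : ℂ} (hγ : γ ∈ lattice) (z : ℂ) :
    char n (z + γ) = char n z := by
  rw [char_add_right, (mem_lattice_iff_char γ).1 hγ n, mul_one]

lemma omega_ne_zero : omega ≠ 0 := exp_ne_zero _

lemma omega_zpow_eq_one_iff (m : ℤ) : omega ^ m = 1 ↔ m % 3 = 0 := by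
  have h : IsPrimitiveRoot omega 3 := isPrimitiveRoot_exp 3 (by norm_num)
  rw [h.zpow_eq_one_iff_dvd]
  omega

lemma char_third (p : ℤ × ℤ) (m n : ℤ) : char p (third m n) = omega ^ (p.1 * m + p.2 * n) := by
  have h : third m n = ((m : ℝ) / 3) • gen 0 + ((n : ℝ) / 3) • gen 1 := by
    simp [third, gen]
    ring
  rw [char, h, map_add, map_smul, map_smul, (phase_gen p).1, (phase_gen p).2, omega, ← exp_int_mul]
  congr 1
  simp
  ring

lemma potential_eq (z : ℂ) :
    potential z = ∑ k : Fin 3, omega ^ (k : ℕ) * char (freqStep k) z := by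
  rw [potential, Finset.sum_range]
  refine Finset.sum_congr rfl fun k _ => ?_
  congr 1
  rw [char]
  congr 1
  rw [phase_apply, momentum_freqStep, map_pow]
  set w := (starRingEnd ℂ) omega ^ (k : ℕ) with hw
  have h2 : (starRingEnd ℂ) w = omega ^ (k : ℕ) := by rw [hw, map_pow, conj_conj]
  rw [← h2, ← map_mul]
  apply Complex.ext <;> simp <;> ring

lemma norm_omega : ‖omega‖ = 1 := by
  have h : (2 * Real.pi * I / 3 : ℂ) = ((2 * Real.pi / 3 : ℝ) : ℂ) * I := by push_cast; ring
  rw [omega, h, norm_exp_ofReal_mul_I]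

end Characters

section Torus

open scoped Pointwise

instance : DiscreteTopology lattice :=
  inferInstanceAs (DiscreteTopology (Submodule.span ℤ (Set.range basis)))

instance : Countable lattice := inferInstanceAs (Countable (Submodule.span ℤ (Set.range basis)))

instance : IsClosed (lattice : Set ℂ) := AddSubgroup.isClosed_of_discrete

lemma isAddFundamentalDomain_cell : IsAddFundamentalDomain lattice cell (volume : Measure ℂ) :=
  ZSpan.isAddFundamentalDomain' basis volume

lemma measurableSet_cell : MeasurableSet cell := ZSpan.fundamentalDomain_measurableSet basis

lemma exists_cell_subset : ∃ R : ℝ, cell ⊆ Metric.closedBall 0 R :=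
  (ZSpan.fundamentalDomain_isBounded basis).subset_closedBall 0

lemma continuous_proj : Continuous proj := continuous_quot_mk

lemma proj_add (z w : ℂ) : proj (z + w) = proj z + proj w := rfl

lemma proj_eq_zero_iff (z : ℂ) : proj z = 0 ↔ z ∈ lattice := QuotientAddGroup.eq_zero_iff z

lemma proj_eq_iff (z w : ℂ) : proj z = proj w ↔ w - z ∈ lattice := by
  rw [proj, proj, QuotientAddGroup.eq, neg_add_eq_sub]

lemma proj_surjective : Function.Surjective proj := QuotientAddGroup.mk_surjective

lemma exists_mem_cell (x : Torus) : ∃ z ∈ cell, proj z = x := by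
  obtain ⟨w, rfl⟩ := proj_surjective x
  refine ⟨ZSpan.fract basis w, ZSpan.fract_mem_fundamentalDomain basis w, ?_⟩
  rw [proj_eq_iff, ZSpan.fract_apply, sub_sub_cancel]
  exact (ZSpan.floor basis w).2

instance : CompactSpace Torus := by
  obtain ⟨R, hR⟩ := exists_cell_subset
  refine ⟨?_⟩
  have h : Set.univ = proj '' Metric.closedBall 0 R := by
    refine (Set.eq_univ_of_forall fun x => ?_).symm
    obtain ⟨z, hz, rfl⟩ := exists_mem_cell x
    exact ⟨z, hR hz, rfl⟩
  rw [h]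
  exact (isCompact_closedBall 0 R).image continuous_proj

lemma volume_cell_lt_top : volume cell < ⊤ :=
  (ZSpan.fundamentalDomain_isBounded basis).measure_lt_top

instance : IsFiniteMeasure (volume.restrict cell : Measure ℂ) :=
  isFiniteMeasure_restrict.2 volume_cell_lt_top.ne

instance : IsFiniteMeasure area := by
  unfold area
  infer_instance

lemma volume_cell_ne_zero : (volume : Measure ℂ).real cell ≠ 0 := by
  refine (ENNReal.toReal_pos ?_ volume_cell_lt_top.ne).ne'
  exact ZSpan.measure_fundamentalDomain_ne_zero basis

lemma integral_area (g : Torus → ℂ) (hg : AEStronglyMeasurable g area) :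
    ∫ x, g x ∂area = ∫ z in cell, g (proj z) :=
  integral_map measurable_proj.aemeasurable hg

/-- The integral over the cell of a periodic function is invariant under translations. -/
lemma setIntegral_cell_add {ψ : ℂ → ℂ} (h : ∀ γ ∈ lattice, ∀ z, ψ (z + γ) = ψ z) (a : ℂ) :
    ∫ z in cell, ψ (z + a) = ∫ z in cell, ψ z := by
  have h1 : IsAddFundamentalDomain lattice (a +ᵥ cell) (volume : Measure ℂ) :=
    isAddFundamentalDomain_cell.vadd_of_comm a
  have h2 := isAddFundamentalDomain_cell.setIntegral_eq h1 (f := ψ) fun γ z => by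
    change ψ ((γ : ℂ) + z) = ψ z
    rw [add_comm, h _ γ.2]
  rw [h2]
  have h3 := (measurePreserving_add_right (volume : Measure ℂ) a).setIntegral_preimage_emb
    (measurableEmbedding_addRight a) ψ (a +ᵥ cell)
  rw [← h3]
  congr 2
  ext z
  rw [Set.mem_preimage, Set.mem_vadd_set_iff_neg_vadd_mem]
  simp

lemma measurePreserving_add_proj (a : ℂ) :
    MeasurePreserving (fun x : Torus => x + proj a) area area := by
  refine ⟨measurable_add_const _, ?_⟩
  ext s hs
  rw [Measure.map_apply (measurable_add_const _) hs, area,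
    Measure.map_apply measurable_proj (measurable_add_const _ hs),
    Measure.map_apply measurable_proj hs, Measure.restrict_apply₀' measurableSet_cell.nullMeasurableSet,
    Measure.restrict_apply₀' measurableSet_cell.nullMeasurableSet]
  have h1 : IsAddFundamentalDomain lattice (a +ᵥ cell) (volume : Measure ℂ) :=
    isAddFundamentalDomain_cell.vadd_of_comm a
  have h2 := isAddFundamentalDomain_cell.measure_set_eq h1 (measurable_proj hs) fun γ => by
    ext z
    change proj ((γ : ℂ) + z) ∈ s ↔ proj z ∈ s
    rw [proj_add, (proj_eq_zero_iff _).2 γ.2, zero_add]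
  rw [h2, ← (measurePreserving_add_right (volume : Measure ℂ) a).measure_preimage
    ((measurable_proj hs).nullMeasurableSet.inter h1.nullMeasurableSet)]
  congr 1
  ext z
  simp only [Set.mem_inter_iff, Set.mem_preimage, Set.mem_vadd_set_iff_neg_vadd_mem]
  simp [proj_add]

/-- Two measurable functions agree almost everywhere on the torus as soon as their lifts do. -/
lemma ae_eq_of_ae_proj {f g : Torus → ℂ} (hf : StronglyMeasurable f) (hg : StronglyMeasurable g)
    (h : ∀ᵐ z : ℂ, f (proj z) = g (proj z)) : f =ᵐ[area] g := by
  have h1 : MeasurableSet {x | f x = g x} := measurableSet_eq_fun hf.measurable hg.measurable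
  exact (ae_map_iff measurable_proj.aemeasurable h1).2 (ae_restrict_of_ae h)

/-- The mean value of a directional derivative of a smooth periodic function vanishes. -/
lemma setIntegral_cell_fderiv {ψ : ℂ → ℂ} (hψ : ContDiff ℝ ∞ ψ)
    (h : ∀ γ ∈ lattice, ∀ z, ψ (z + γ) = ψ z) (e : ℂ) :
    ∫ z in cell, fderiv ℝ ψ z e = 0 := by
  obtain ⟨R, hR⟩ := exists_cell_subset
  have hc : Continuous fun z => fderiv ℝ ψ z e :=
    (hψ.continuous_fderiv (by simp)).clm_apply continuous_const
  obtain ⟨C, hC⟩ := (isCompact_closedBall (0 : ℂ) (R + ‖e‖)).exists_bound_of_continuousOn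
    hc.continuousOn
  have hF : ∀ t : ℝ, Continuous fun z => ψ (z + t * e) := fun t =>
    hψ.continuous.comp (continuous_id.add continuous_const)
  have h1 := hasDerivAt_integral_of_dominated_loc_of_deriv_le (μ := volume.restrict cell)
    (F := fun (t : ℝ) z => ψ (z + t * e)) (F' := fun t z => fderiv ℝ ψ (z + t * e) e)
    (x₀ := (0 : ℝ)) (s := Metric.ball 0 1) (bound := fun _ => C) (Metric.ball_mem_nhds 0 one_pos)
    (Filter.Eventually.of_forall fun t => (hF t).aestronglyMeasurable)
    (((hF 0).locallyIntegrable.integrableOn_isCompact (isCompact_closedBall 0 R)).mono_set hR)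
    ((hc.comp (continuous_id.add continuous_const)).aestronglyMeasurable)
    (ae_restrict_of_forall_mem measurableSet_cell fun z hz t ht => by
      refine hC _ ?_
      have h1 := hR hz
      rw [mem_closedBall_zero_iff] at h1 ⊢
      rw [mem_ball_zero_iff, Real.norm_eq_abs] at ht
      refine (norm_add_le _ _).trans (add_le_add h1 ?_)
      rw [norm_mul, norm_real, Real.norm_eq_abs]
      exact mul_le_of_le_one_left (norm_nonneg e) ht.le)
    (integrable_const C)
    (Filter.Eventually.of_forall fun z t _ => by
      have h2 : HasDerivAt (fun t : ℝ => z + t * e) e t := by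
        simpa using ((ofRealCLM.hasDerivAt (x := t)).mul_const e).const_add z
      exact ((hψ.differentiable (by simp)) _).hasFDerivAt.comp_hasDerivAt t h2)
  have h2 := h1.2
  simp only [setIntegral_cell_add h, ofReal_zero, zero_mul, add_zero] at h2
  exact h2.unique (hasDerivAt_const _ _)

end Torus

section FourierBasis

local notation "⟪" x ", " y "⟫" => inner ℂ x y

/-- The characters as functions on the torus. -/
def torusChar (n : ℤ × ℤ) : C(Torus, ℂ) where
  toFun := Quotient.lift (char n) fun z w h => by
    have h1 : proj z = proj w := Quotient.sound h
    rw [proj_eq_iff] at h1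
    rw [← char_add_lattice n h1 z, add_sub_cancel]
  continuous_toFun := (contDiff_char n).continuous.quotient_lift _

lemma torusChar_proj (n : ℤ × ℤ) (z : ℂ) : torusChar n (proj z) = char n z := rfl

lemma torusChar_add_left (m n : ℤ × ℤ) (x : Torus) :
    torusChar (m + n) x = torusChar m x * torusChar n x := by
  obtain ⟨z, rfl⟩ := proj_surjective x
  exact char_add_left m n z

lemma torusChar_neg (n : ℤ × ℤ) (x : Torus) :
    torusChar (-n) x = (starRingEnd ℂ) (torusChar n x) := by
  obtain ⟨z, rfl⟩ := proj_surjective x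
  exact char_neg n z

lemma norm_torusChar (n : ℤ × ℤ) (x : Torus) : ‖torusChar n x‖ = 1 := by
  obtain ⟨z, rfl⟩ := proj_surjective x
  exact norm_char n z

/-- The star algebra of trigonometric polynomials on the torus. -/
def trigPoly : StarSubalgebra ℂ C(Torus, ℂ) where
  toSubalgebra := (Submodule.span ℂ (Set.range torusChar)).toSubalgebra
    (Submodule.subset_span ⟨0, by
      ext x
      obtain ⟨z, rfl⟩ := proj_surjective x
      exact char_zero_left z⟩)
    (fun f g hf hg => by
      have h := Submodule.mul_mem_mul hf hg
      rw [Submodule.span_mul_span] at h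
      refine Submodule.span_mono ?_ h
      rintro _ ⟨_, ⟨m, rfl⟩, _, ⟨n, rfl⟩, rfl⟩
      exact ⟨m + n, ContinuousMap.ext fun x => torusChar_add_left m n x⟩)
  star_mem' := by
    intro f hf
    change star f ∈ Submodule.span ℂ (Set.range torusChar)
    refine Submodule.span_induction (p := fun f _ =>
      star f ∈ Submodule.span ℂ (Set.range torusChar)) ?_ ?_ ?_ ?_ hf
    · rintro _ ⟨n, rfl⟩
      exact Submodule.subset_span ⟨-n, ContinuousMap.ext fun x => torusChar_neg n x⟩
    · rw [star_zero]; exact Submodule.zero_mem _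
    · intro f g _ _ h1 h2
      rw [star_add]; exact Submodule.add_mem _ h1 h2
    · intro c f _ h1
      rw [star_smul]; exact Submodule.smul_mem _ _ h1

lemma trigPoly_separatesPoints : trigPoly.SeparatesPoints := by
  intro x y hxy
  obtain ⟨z, rfl⟩ := proj_surjective x
  obtain ⟨w, rfl⟩ := proj_surjective y
  rw [Ne, proj_eq_iff, mem_lattice_iff_char] at hxy
  push Not at hxy
  obtain ⟨n, hn⟩ := hxy
  refine ⟨torusChar n, ⟨torusChar n, Submodule.subset_span ⟨n, rfl⟩, rfl⟩, fun h => hn ?_⟩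
  have h0 : char n z ≠ 0 := exp_ne_zero _
  rw [torusChar_proj, torusChar_proj] at h
  refine mul_left_cancel₀ h0 ?_
  rw [← char_add_right, add_sub_cancel, mul_one, h]

lemma closure_span_torusChar : (Submodule.span ℂ (Set.range torusChar)).topologicalClosure = ⊤ := by
  have h := ContinuousMap.starSubalgebra_topologicalClosure_eq_top_of_separatesPoints trigPoly
    trigPoly_separatesPoints
  rw [eq_top_iff]
  intro f _
  have h1 : f ∈ trigPoly.topologicalClosure := h ▸ trivial
  exact h1

/-- The scalar Hilbert space `L²(ℂ / Γ)`. -/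
abbrev L2scalar : Type := Lp ℂ 2 area

/-- The characters as elements of `L²(ℂ / Γ)`. -/
def charL2 (n : ℤ × ℤ) : L2scalar := ContinuousMap.toLp (E := ℂ) 2 area ℂ (torusChar n)

lemma coeFn_charL2 (n : ℤ × ℤ) : charL2 n =ᵐ[area] torusChar n :=
  ContinuousMap.coeFn_toLp area (torusChar n)

lemma inner_charL2 (n : ℤ × ℤ) (g : L2scalar) :
    ⟪charL2 n, g⟫ = ∫ x, g x * torusChar (-n) x ∂area := by
  rw [L2.inner_def]
  refine integral_congr_ae ?_
  filter_upwards [coeFn_charL2 n] with x hx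
  rw [hx, torusChar_neg, RCLike.inner_apply]

lemma setIntegral_char (n : ℤ × ℤ) (hn : n ≠ 0) : ∫ z in cell, char n z = 0 := by
  have h1 := fun a => setIntegral_cell_add (fun γ hγ z => char_add_lattice n hγ z) a
  simp only [char_add_right, integral_mul_const] at h1
  by_contra h0
  have h2 : ∀ a, char n a = 1 := fun a => mul_left_cancel₀ h0 ((h1 a).trans (mul_one _).symm)
  refine hn (Prod.ext ?_ ?_)
  · have h3 := (char_eq_one_iff n _).1 (h2 ((1 / (2 * (n.1 : ℝ))) • basis 0))
    obtain ⟨m, hm⟩ := h3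
    by_contra h4
    have h5 : (n.1 : ℝ) ≠ 0 := by exact_mod_cast h4
    simp only [map_smul, Module.Basis.repr_self, Finsupp.smul_apply, smul_eq_mul] at hm
    simp at hm
    field_simp at hm
    have : (1 : ℤ) = 2 * m := by exact_mod_cast hm
    omega
  · have h3 := (char_eq_one_iff n _).1 (h2 ((1 / (2 * (n.2 : ℝ))) • basis 1))
    obtain ⟨m, hm⟩ := h3
    by_contra h4
    have h5 : (n.2 : ℝ) ≠ 0 := by exact_mod_cast h4
    simp only [map_smul, Module.Basis.repr_self, Finsupp.smul_apply, smul_eq_mul] at hm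
    simp at hm
    field_simp at hm
    have : (1 : ℤ) = 2 * m := by exact_mod_cast hm
    omega

lemma inner_charL2_charL2 (m n : ℤ × ℤ) :
    ⟪charL2 m, charL2 n⟫ = if m = n then ((volume : Measure ℂ).real cell : ℂ) else 0 := by
  have h1 : ⟪charL2 m, charL2 n⟫ = ∫ z in cell, char (n - m) z := by
    rw [inner_charL2]
    have h2 : ∫ x, charL2 n x * torusChar (-m) x ∂area = ∫ x, torusChar (n - m) x ∂area := by
      refine integral_congr_ae ?_
      filter_upwards [coeFn_charL2 n] with x hx
      rw [hx, ← torusChar_add_left, sub_eq_add_neg]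
    rw [h2, integral_area _ (torusChar _).continuous.aestronglyMeasurable]
    rfl
  rw [h1]
  split_ifs with h
  · subst h
    simp [char_zero_left]
  · exact setIntegral_char _ (sub_ne_zero.2 (Ne.symm h))

/-- The normalizing constant of the Fourier basis. -/
def normConst : ℝ := (Real.sqrt ((volume : Measure ℂ).real cell))⁻¹

lemma normConst_ne_zero : (normConst : ℂ) ≠ 0 := by
  have h : 0 < (volume : Measure ℂ).real cell :=
    measureReal_nonneg.lt_of_ne volume_cell_ne_zero.symm
  exact ofReal_ne_zero.2 (inv_ne_zero (Real.sqrt_pos.2 h).ne')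

lemma eq_zero_of_inner_charL2 {g : L2scalar} (h : ∀ n, ⟪charL2 n, g⟫ = 0) : g = 0 := by
  have h1 : Dense (ContinuousMap.toLp (E := ℂ) 2 area ℂ '' 
      (Submodule.span ℂ (Set.range torusChar) : Set C(Torus, ℂ))) := by
    refine (ContinuousMap.toLp_denseRange ℂ ℂ (μ := area) (p := 2) (by simp)).dense_image
      (ContinuousMap.toLp (E := ℂ) 2 area ℂ).continuous ?_
    exact Submodule.dense_iff_topologicalClosure_eq_top.2 closure_span_torusChar
  have h2 : ∀ f ∈ Submodule.span ℂ (Set.range torusChar),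
      ⟪ContinuousMap.toLp (E := ℂ) 2 area ℂ f, g⟫ = 0 := by
    intro f hf
    refine Submodule.span_induction (p := fun f _ =>
      ⟪ContinuousMap.toLp (E := ℂ) 2 area ℂ f, g⟫ = 0) ?_ ?_ ?_ ?_ hf
    · rintro _ ⟨n, rfl⟩
      exact h n
    · rw [map_zero, inner_zero_left]
    · intro f f' _ _ h3 h4
      rw [map_add, inner_add_left, h3, h4, add_zero]
    · intro c f _ h3
      rw [map_smul, inner_smul_left, h3, mul_zero]
  refine h1.eq_zero_of_inner_right (𝕜 := ℂ) ?_
  rintro _ ⟨f, hf, rfl⟩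
  exact h2 f hf

/-- The Fourier basis of `L²(ℂ / Γ)`. -/
lemma exists_fourierBasis : ∃ B : HilbertBasis (ℤ × ℤ) ℂ L2scalar,
    ∀ n, B n = (normConst : ℂ) • charL2 n := by
  have hv : 0 < (volume : Measure ℂ).real cell :=
    measureReal_nonneg.lt_of_ne volume_cell_ne_zero.symm
  have ho : Orthonormal ℂ fun n => (normConst : ℂ) • charL2 n := by
    rw [orthonormal_iff_ite]
    intro m n
    rw [inner_smul_left, inner_smul_right, inner_charL2_charL2, conj_ofReal]
    split_ifs
    · rw [← ofReal_mul, ← ofReal_mul, normConst]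
      norm_cast
      rw [← mul_assoc, ← mul_inv, Real.mul_self_sqrt hv.le, inv_mul_cancel₀ hv.ne']
    · simp
  refine ⟨HilbertBasis.mkOfOrthogonalEqBot ho ?_, fun n => ?_⟩
  · rw [Submodule.eq_bot_iff]
    intro g hg
    refine eq_zero_of_inner_charL2 fun n => ?_
    have h1 := (Submodule.mem_orthogonal _ _).1 hg _ (Submodule.subset_span ⟨n, rfl⟩)
    rw [inner_smul_left, conj_ofReal] at h1
    exact (mul_eq_zero.1 h1).resolve_left normConst_ne_zero
  · rw [HilbertBasis.coe_mkOfOrthogonalEqBot]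

end FourierBasis

section Components

local notation "⟪" x ", " y "⟫" => inner ℂ x y

/-- The `j`-th component of an element of `L²(ℂ / Γ; ℂ²)`. -/
def component (j : Fin 2) : L2 →L[ℂ] L2scalar :=
  (EuclideanSpace.proj j : EuclideanSpace ℂ (Fin 2) →L[ℂ] ℂ).compLpL 2 area

lemma coeFn_component (j : Fin 2) (u : L2) : component j u =ᵐ[area] fun x => u x j :=
  ContinuousLinearMap.coeFn_compLpL _ u

/-- The element of `L²(ℂ / Γ; ℂ²)` with a given `j`-th component and the other one zero. -/
def embed (j : Fin 2) : L2scalar →L[ℂ] L2 :=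
  (ContinuousLinearMap.toSpanSingleton ℂ (EuclideanSpace.single j (1 : ℂ))).compLpL 2 area

lemma coeFn_embed (j : Fin 2) (g : L2scalar) :
    embed j g =ᵐ[area] fun x => g x • EuclideanSpace.single j (1 : ℂ) :=
  ContinuousLinearMap.coeFn_compLpL _ g

lemma ext_component {u v : L2} (h : ∀ j, component j u = component j v) : u = v := by
  refine Lp.ext ?_
  filter_upwards [coeFn_component 0 u, coeFn_component 1 u, coeFn_component 0 v,
    coeFn_component 1 v] with x h1 h2 h3 h4
  ext j
  fin_cases j
  · exact h1.symm.trans ((congrArg (fun g : L2scalar => g x) (h 0)).trans h3)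
  · exact h2.symm.trans ((congrArg (fun g : L2scalar => g x) (h 1)).trans h4)

lemma inner_embed (j : Fin 2) (g : L2scalar) (u : L2) : ⟪embed j g, u⟫ = ⟪g, component j u⟫ := by
  rw [L2.inner_def, L2.inner_def]
  refine integral_congr_ae ?_
  filter_upwards [coeFn_embed j g, coeFn_component j u] with x h1 h2
  rw [h1, h2, inner_smul_left, EuclideanSpace.inner_single_left, map_one, one_mul,
    RCLike.inner_apply, mul_comm]

lemma component_embed (i j : Fin 2) (g : L2scalar) :
    component i (embed j g) = if i = j then g else 0 := by
  refine Lp.ext ?_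
  split_ifs with h
  · subst h
    filter_upwards [coeFn_embed i g, coeFn_component i (embed i g)] with x h1 h2
    rw [h2, h1]
    simp
  · filter_upwards [coeFn_embed j g, coeFn_component i (embed j g),
      Lp.coeFn_zero ℂ 2 area] with x h1 h2 h3
    rw [h2, h1, h3]
    simp [h]

/-- The Fourier coefficient of `u` at the mode `x`. -/
def fourierCoeff (u : L2) (x : Mode) : ℂ := ⟪charL2 x.2, component x.1 u⟫

lemma fourierCoeff_add (u v : L2) (x : Mode) :
    fourierCoeff (u + v) x = fourierCoeff u x + fourierCoeff v x := by
  simp only [fourierCoeff, map_add, inner_add_right]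

lemma fourierCoeff_smul (c : ℂ) (u : L2) (x : Mode) :
    fourierCoeff (c • u) x = c * fourierCoeff u x := by
  simp only [fourierCoeff, map_smul, inner_smul_right]

lemma component_ext_of_fourierCoeff {u v : L2} {j : Fin 2}
    (h : ∀ n, fourierCoeff u (j, n) = fourierCoeff v (j, n)) : component j u = component j v := by
  refine sub_eq_zero.1 (eq_zero_of_inner_charL2 fun n => ?_)
  rw [inner_sub_right]
  exact sub_eq_zero.2 (h n)

lemma ext_fourierCoeff {u v : L2} (h : ∀ x, fourierCoeff u x = fourierCoeff v x) : u = v :=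
  ext_component fun j => component_ext_of_fourierCoeff fun n => h (j, n)

/-- The Fourier basis of `L²(ℂ / Γ; ℂ²)`. -/
theorem exists_vectorFourierBasis : ∃ b : HilbertBasis Mode ℂ L2,
    ∀ u x, ⟪b x, u⟫ = normConst * fourierCoeff u x := by
  obtain ⟨B, hB⟩ := exists_fourierBasis
  have ho : Orthonormal ℂ fun x : Mode => embed x.1 (B x.2) := by
    rw [orthonormal_iff_ite]
    intro x y
    rw [inner_embed, component_embed]
    split_ifs with h1 h2 h2
    · subst h2
      exact (orthonormal_iff_ite.1 B.orthonormal _ _).trans (if_pos rfl)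
    · refine (orthonormal_iff_ite.1 B.orthonormal _ _).trans (if_neg fun h3 => h2 ?_)
      exact Prod.ext h1 h3
    · exact absurd (congrArg Prod.fst h2) h1
    · exact inner_zero_right _
  have hc : ∀ u (x : Mode), ⟪embed x.1 (B x.2), u⟫ = normConst * fourierCoeff u x := by
    intro u x
    rw [inner_embed, hB, inner_smul_left, conj_ofReal, fourierCoeff]
  refine ⟨HilbertBasis.mkOfOrthogonalEqBot ho ?_, fun u x => ?_⟩
  · rw [Submodule.eq_bot_iff]
    intro u hu
    refine ext_fourierCoeff fun x => ?_
    have h1 := (Submodule.mem_orthogonal _ _).1 hu _ (Submodule.subset_span ⟨x, rfl⟩)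
    rw [hc] at h1
    rw [(mul_eq_zero.1 h1).resolve_left normConst_ne_zero]
    simp [fourierCoeff]
  · rw [HilbertBasis.coe_mkOfOrthogonalEqBot, hc]

lemma fourierCoeff_eq_setIntegral (u : L2) (x : Mode) :
    fourierCoeff u x = ∫ z in cell, u (proj z) x.1 * char (-x.2) z := by
  rw [fourierCoeff, inner_charL2, integral_area]
  · refine integral_congr_ae ?_
    filter_upwards [ae_restrict_of_ae (ae_proj (coeFn_component x.1 u))] with z hz
    rw [hz, torusChar_proj]
  · exact (Lp.aestronglyMeasurable _).mul (torusChar _).continuous.aestronglyMeasurable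

lemma fourierCoeff_of_hasWeakDeriv {e : ℂ} {v w : L2} (h : HasWeakDeriv e v w) (x : Mode) :
    fourierCoeff w x = I * (phase x.2 e : ℝ) * fourierCoeff v x := by
  have h1 := h (char (-x.2)) (contDiff_char _) (fun γ hγ z => char_add_lattice _ hγ z) x.1
  rw [fourierCoeff_eq_setIntegral, fourierCoeff_eq_setIntegral, ← neg_inj, ← h1,
    ← integral_const_mul, ← integral_neg]
  refine integral_congr_ae (Filter.Eventually.of_forall fun z => ?_)
  simp only [fderiv_char, phase_neg]
  push_cast
  ring

/-- A continuous periodic function as a function on the torus. -/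
def descend (φ : ℂ → ℂ) (hφ : Continuous φ) (h : ∀ γ ∈ lattice, ∀ z, φ (z + γ) = φ z) :
    C(Torus, ℂ) where
  toFun := Quotient.lift φ fun z w hzw => by
    have h1 : proj z = proj w := Quotient.sound hzw
    rw [proj_eq_iff] at h1
    rw [← h _ h1 z, add_sub_cancel]
  continuous_toFun := hφ.quotient_lift _

lemma inner_toLp_component (φ : C(Torus, ℂ)) (u : L2) (j : Fin 2) :
    ⟪ContinuousMap.toLp (E := ℂ) 2 area ℂ (star φ), component j u⟫ =
      ∫ z in cell, u (proj z) j * φ (proj z) := by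
  have h1 : ⟪ContinuousMap.toLp (E := ℂ) 2 area ℂ (star φ), component j u⟫ =
      ∫ x, component j u x * φ x ∂area := by
    rw [L2.inner_def]
    refine integral_congr_ae ?_
    filter_upwards [ContinuousMap.coeFn_toLp (p := 2) (𝕜 := ℂ) area (star φ)] with x hx
    rw [hx, RCLike.inner_apply, ContinuousMap.star_apply]
    simp
  rw [h1, integral_area (fun x => component j u x * φ x) ((Lp.aestronglyMeasurable _).mul φ.continuous.aestronglyMeasurable)]
  refine integral_congr_ae ?_
  filter_upwards [ae_restrict_of_ae (ae_proj (coeFn_component j u))] with z hz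
  rw [hz]

lemma inner_charL2_toLp (φ : C(Torus, ℂ)) (n : ℤ × ℤ) :
    ⟪charL2 n, ContinuousMap.toLp (E := ℂ) 2 area ℂ (star φ)⟫ =
      (starRingEnd ℂ) (∫ z in cell, φ (proj z) * char n z) := by
  rw [inner_charL2, ← integral_conj]
  have h1 : ∫ x, ContinuousMap.toLp (E := ℂ) 2 area ℂ (star φ) x * torusChar (-n) x ∂area =
      ∫ x, (star φ * torusChar (-n)) x ∂area := by
    refine integral_congr_ae ?_
    filter_upwards [ContinuousMap.coeFn_toLp (p := 2) (𝕜 := ℂ) area (star φ)] with x hx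
    rw [hx]
    rfl
  rw [h1, integral_area _ (star φ * torusChar (-n)).continuous.aestronglyMeasurable]
  refine integral_congr_ae (Filter.Eventually.of_forall fun z => ?_)
  simp [torusChar_proj, char_neg]

lemma integrableOn_cell {f : ℂ → ℂ} (hf : Continuous f) : IntegrableOn f cell := by
  obtain ⟨R, hR⟩ := exists_cell_subset
  exact (hf.locallyIntegrable.integrableOn_isCompact (isCompact_closedBall 0 R)).mono_set hR

lemma setIntegral_fderiv_mul_char {φ : ℂ → ℂ} (hφ : ContDiff ℝ ∞ φ)
    (h : ∀ γ ∈ lattice, ∀ z, φ (z + γ) = φ z) (e : ℂ) (n : ℤ × ℤ) :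
    ∫ z in cell, fderiv ℝ φ z e * char n z =
      -(I * (phase n e : ℝ) * ∫ z in cell, φ z * char n z) := by
  have h1 := setIntegral_cell_fderiv (hφ.mul (contDiff_char n))
    (fun γ hγ z => by rw [h γ hγ, char_add_lattice n hγ]) e
  have h2 : ∀ z, fderiv ℝ (fun z => φ z * char n z) z e =
      fderiv ℝ φ z e * char n z + I * (phase n e : ℝ) * (φ z * char n z) := by
    intro z
    rw [fderiv_fun_mul (hφ.differentiable (by simp) z)
      ((contDiff_char n).differentiable (by simp) z)]
    simp [fderiv_char]
    ring
  have hc : Continuous (fun z => fderiv ℝ φ z e) :=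
    (hφ.continuous_fderiv (by simp)).clm_apply continuous_const
  have hch := (contDiff_char n).continuous
  have i1 : IntegrableOn (fun z => fderiv ℝ φ z e * char n z) cell :=
    integrableOn_cell (hc.mul hch)
  have i2 : IntegrableOn (fun z => φ z * char n z) cell :=
    integrableOn_cell (hφ.continuous.mul hch)
  simp only [h2] at h1
  rw [integral_add i1 (i2.const_mul _), integral_const_mul] at h1
  exact eq_neg_of_add_eq_zero_left h1

lemma fderiv_add_lattice {φ : ℂ → ℂ} (h : ∀ γ ∈ lattice, ∀ z, φ (z + γ) = φ z) (e : ℂ) :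
    ∀ γ ∈ lattice, ∀ z, fderiv ℝ φ (z + γ) e = fderiv ℝ φ z e := by
  intro γ hγ z
  rw [← fderiv_comp_add_right]
  simp only [h γ hγ]

lemma hasWeakDeriv_of_fourierCoeff {e : ℂ} {v w : L2}
    (h : ∀ x, fourierCoeff w x = I * (phase x.2 e : ℝ) * fourierCoeff v x) :
    HasWeakDeriv e v w := by
  intro φ hφ hper j
  obtain ⟨B, hB⟩ := exists_fourierBasis
  have hc : Continuous (fun z => fderiv ℝ φ z e) :=
    (hφ.continuous_fderiv (by simp)).clm_apply continuous_const
  have h1 := inner_toLp_component (descend _ hc (fderiv_add_lattice hper e)) v j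
  have h2 := inner_toLp_component (descend φ hφ.continuous hper) w j
  have h3 := fun n => inner_charL2_toLp (descend _ hc (fderiv_add_lattice hper e)) n
  have h4 := fun n => inner_charL2_toLp (descend φ hφ.continuous hper) n
  have h5 := fun n => (setIntegral_fderiv_mul_char hφ hper e n)
  change _ = ∫ z in cell, v (proj z) j * fderiv ℝ φ z e at h1
  change _ = ∫ z in cell, w (proj z) j * φ z at h2
  rw [← h1, ← h2, ← B.tsum_inner_mul_inner, ← B.tsum_inner_mul_inner, ← tsum_neg]
  refine tsum_congr fun n => ?_
  have h6 := h (j, n)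
  simp only [fourierCoeff] at h6
  simp only [hB, inner_smul_left, inner_smul_right]
  rw [h6, ← inner_conj_symm _ (charL2 n), ← inner_conj_symm _ (charL2 n), h3, h4]
  change _ * ((starRingEnd ℂ) ((starRingEnd ℂ) (∫ z in cell, fderiv ℝ φ z e * char n z))) * _ =
    -(_ * (starRingEnd ℂ) ((starRingEnd ℂ) (∫ z in cell, φ z * char n z)) * _)
  rw [h5, conj_conj, conj_conj]
  ring

theorem isTwoDbar_iff (v f : L2) :
    IsTwoDbar v f ↔ ∀ x, fourierCoeff f x = I * momentum x.2 * fourierCoeff v x := by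
  have key : ∀ n, -I * (I * (phase n 1 : ℝ) + I * (I * (phase n I : ℝ))) = I * momentum n := by
    intro n
    apply Complex.ext <;> simp [phase_apply]
  constructor
  · rintro ⟨vx, vy, hx, hy, rfl⟩ x
    rw [fourierCoeff_smul, fourierCoeff_add, fourierCoeff_smul, fourierCoeff_of_hasWeakDeriv hx,
      fourierCoeff_of_hasWeakDeriv hy, ← key]
    ring
  · intro h
    obtain ⟨b, hb⟩ := exists_vectorFourierBasis
    have ex : ∀ e : ℂ, ‖e‖ ≤ 1 → ∃ w : L2, ∀ x,
        fourierCoeff w x = I * (phase x.2 e : ℝ) * fourierCoeff v x := by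
      intro e he
      obtain ⟨w, hw⟩ := exists_forall_inner_eq b
        (a := fun x => I * (phase x.2 e : ℝ) * ⟪b x, v⟫) (by
          refine (hasSum_norm_inner_sq b f).summable.of_nonneg_of_le (fun _ => by positivity)
            fun x => ?_
          have h1 : |phase x.2 e| ≤ ‖momentum x.2‖ := by
            rw [phase_apply]
            refine (abs_im_le_norm _).trans ?_
            rw [norm_mul, RCLike.norm_conj]
            exact mul_le_of_le_one_left (norm_nonneg _) he
          rw [hb, hb, h]
          simp only [norm_mul, norm_I, one_mul, norm_real, Real.norm_eq_abs]
          rw [mul_left_comm]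
          gcongr)
      refine ⟨w, fun x => mul_left_cancel₀ normConst_ne_zero ?_⟩
      rw [← hb, hw, hb]
      ring
    obtain ⟨vx, hx⟩ := ex 1 (by simp)
    obtain ⟨vy, hy⟩ := ex I (by simp)
    refine ⟨vx, vy, hasWeakDeriv_of_fourierCoeff hx, hasWeakDeriv_of_fourierCoeff hy,
      ext_fourierCoeff fun x => ?_⟩
    rw [fourierCoeff_smul, fourierCoeff_add, fourierCoeff_smul, hx, hy, h, ← key]
    ring

end Components

section PotentialAndSymmetry

local notation "⟪" x ", " y "⟫" => inner ℂ x y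

lemma exists_char_mul (m : ℤ × ℤ) (g : L2scalar) : ∃ h : L2scalar,
    (h =ᵐ[area] fun x => torusChar m x * g x) ∧ ∀ n, ⟪charL2 n, h⟫ = ⟪charL2 (n - m), g⟫ := by
  have hm : MemLp (fun x => torusChar m x * g x) 2 area := by
    refine (Lp.memLp g).of_le
      ((torusChar m).continuous.aestronglyMeasurable.mul (Lp.aestronglyMeasurable g))
      (Filter.Eventually.of_forall fun x => ?_)
    rw [norm_mul, norm_torusChar, one_mul]
  refine ⟨hm.toLp _, hm.coeFn_toLp, fun n => ?_⟩
  rw [inner_charL2, inner_charL2]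
  refine integral_congr_ae ?_
  filter_upwards [hm.coeFn_toLp] with x hx
  rw [hx, neg_sub, sub_eq_add_neg, torusChar_add_left]
  ring

lemma potential_sgn_mul (j : Fin 2) (z : ℂ) : potential ((sgn j : ℤ) * z) =
    ∑ k : Fin 3, omega ^ (k : ℕ) * char (sgn j • freqStep k) z := by
  rw [potential_eq]
  refine Finset.sum_congr rfl fun k _ => ?_
  fin_cases j
  · simp [sgn]
  · simp [sgn, char_neg_right]

lemma exists_potential_mul (j : Fin 2) (u : L2) : ∃ g : L2scalar,
    (∀ᵐ z : ℂ, g (proj z) = potential ((sgn j : ℤ) * z) * u (proj z) (1 - j)) ∧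
    ∀ n, ⟪charL2 n, g⟫ = ∑ k : Fin 3, omega ^ (k : ℕ) * fourierCoeff u (hop k (j, n)) := by
  choose h h1 h2 using fun k : Fin 3 =>
    exists_char_mul (sgn j • freqStep k) (component (1 - j) u)
  refine ⟨∑ k : Fin 3, omega ^ (k : ℕ) • h k, ?_, fun n => ?_⟩
  · have hs : ∀ k : Fin 3, ∀ᵐ z : ℂ, (omega ^ (k : ℕ) • h k : L2scalar) (proj z) =
        omega ^ (k : ℕ) * char (sgn j • freqStep k) z * u (proj z) (1 - j) := by
      intro k
      filter_upwards [ae_proj (Lp.coeFn_smul (omega ^ (k : ℕ)) (h k)), ae_proj (h1 k),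
        ae_proj (coeFn_component (1 - j) u)] with z e1 e2 e3
      rw [e1, Pi.smul_apply, e2, e3, torusChar_proj, smul_eq_mul, mul_assoc]
    rw [Fin.sum_univ_three]
    filter_upwards [hs 0, hs 1, hs 2, ae_proj (Lp.coeFn_add (omega ^ ((0 : Fin 3) : ℕ) • h 0 +
      omega ^ ((1 : Fin 3) : ℕ) • h 1) (omega ^ ((2 : Fin 3) : ℕ) • h 2)),
      ae_proj (Lp.coeFn_add (omega ^ ((0 : Fin 3) : ℕ) • h 0)
        (omega ^ ((1 : Fin 3) : ℕ) • h 1))] with z e0 e1 e2 e3 e4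
    rw [e3, Pi.add_apply, e4, Pi.add_apply, e0, e1, e2, potential_sgn_mul, Fin.sum_univ_three]
    ring
  · rw [inner_sum]
    refine Finset.sum_congr rfl fun k _ => ?_
    rw [inner_smul_right, h2, hop_apply, fourierCoeff]

lemma isPotentialMul_iff (u f : L2) : IsPotentialMul u f ↔
    ∀ j : Fin 2, ∀ᵐ z : ℂ, f (proj z) j = potential ((sgn j : ℤ) * z) * u (proj z) (1 - j) := by
  rw [IsPotentialMul, Filter.eventually_and, Fin.forall_fin_two]
  simp [sgn]

theorem fourierCoeff_of_isPotentialMul {u f : L2} (h : IsPotentialMul u f) (x : Mode) :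
    fourierCoeff f x = ∑ k : Fin 3, omega ^ (k : ℕ) * fourierCoeff u (hop k x) := by
  obtain ⟨j, n⟩ := x
  obtain ⟨g, h1, h2⟩ := exists_potential_mul j u
  have h3 : component j f = g := by
    refine Lp.ext (ae_eq_of_ae_proj (Lp.stronglyMeasurable _) (Lp.stronglyMeasurable _) ?_)
    filter_upwards [h1, (isPotentialMul_iff u f).1 h j, ae_proj (coeFn_component j f)]
      with z e1 e2 e3
    rw [e1, e3, e2]
  rw [← h2, fourierCoeff, h3]

theorem exists_isPotentialMul (u : L2) : ∃ f, IsPotentialMul u f := by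
  choose g h1 _ using fun j => exists_potential_mul j u
  refine ⟨embed 0 (g 0) + embed 1 (g 1), (isPotentialMul_iff _ _).2 fun j => ?_⟩
  have h3 : component j (embed 0 (g 0) + embed 1 (g 1)) = g j := by
    rw [map_add, component_embed, component_embed]
    fin_cases j <;> simp
  filter_upwards [h1 j, ae_proj (coeFn_component j (embed 0 (g 0) + embed 1 (g 1)))] with z e1 e2
  rw [← e1, ← e2, h3]

lemma inner_charL2_eq_setIntegral (n : ℤ × ℤ) (g : L2scalar) :
    ⟪charL2 n, g⟫ = ∫ z in cell, g (proj z) * char (-n) z := by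
  rw [inner_charL2]
  exact integral_area (fun x => g x * torusChar (-n) x) ((Lp.aestronglyMeasurable _).mul
    (torusChar _).continuous.aestronglyMeasurable)

lemma exists_translate (a : ℂ) (g : L2scalar) : ∃ h : L2scalar,
    (∀ᵐ z : ℂ, h (proj z) = g (proj (z + a))) ∧
    ∀ n, ⟪charL2 n, h⟫ = char n a * ⟪charL2 n, g⟫ := by
  have h1 := ae_proj (Lp.coeFn_compMeasurePreserving g (measurePreserving_add_proj a))
  refine ⟨Lp.compMeasurePreserving _ (measurePreserving_add_proj a) g, h1, fun n => ?_⟩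
  rw [inner_charL2_eq_setIntegral, inner_charL2_eq_setIntegral]
  have h2 := setIntegral_cell_add (ψ := fun z => g (proj z) * char (-n) z)
    (fun γ hγ z => by
      rw [proj_add, (proj_eq_zero_iff γ).2 hγ, add_zero, char_add_lattice _ hγ]) a
  rw [← h2, ← integral_const_mul]
  refine integral_congr_ae ?_
  filter_upwards [ae_restrict_of_ae h1] with z hz
  have h3 : char n a * char (-n) a = 1 := by
    rw [← char_add_left, add_neg_cancel, char_zero_left]
  rw [hz, char_add_right]
  change g (proj (z + a)) * _ = _
  linear_combination -(g (proj (z + a)) * char (-n) z) * h3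

lemma mem_L2sub_one_iff (u : L2) : u ∈ L2sub 1 ↔ ∀ (m n : ℤ) (j : Fin 2), ∀ᵐ z : ℂ,
    u (proj z) j = omega ^ ((2 - (j : ℤ)) * (m + n)) * u (proj (z + third m n)) j := by
  refine forall_congr' fun m => forall_congr' fun n => ?_
  rw [Filter.eventually_and, Fin.forall_fin_two]
  have h : omega ^ ((2 : ℤ) * (m + n)) = omega ^ (m + n) * omega ^ (m + n) := by
    rw [two_mul, zpow_add₀ omega_ne_zero]
  simp [h, mul_assoc]

lemma ae_quasiperiodic_iff (u : L2) (m n : ℤ) (j : Fin 2) :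
    (∀ᵐ z : ℂ,
      u (proj z) j = omega ^ ((2 - (j : ℤ)) * (m + n)) * u (proj (z + third m n)) j) ↔
    ∀ p : ℤ × ℤ, fourierCoeff u (j, p) =
      omega ^ ((2 - (j : ℤ) + p.1) * m + (2 - (j : ℤ) + p.2) * n) * fourierCoeff u (j, p) := by
  obtain ⟨h, h1, h2⟩ := exists_translate (third m n) (component j u)
  set c := omega ^ ((2 - (j : ℤ)) * (m + n)) with hc
  have h3 : (∀ᵐ z : ℂ, u (proj z) j = c * u (proj (z + third m n)) j) ↔
      component j u = c • h := by
    have e0 : ∀ᵐ z : ℂ, component j u (proj z) = u (proj z) j := ae_proj (coeFn_component j u)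
    have e1 : ∀ᵐ z : ℂ, component j u (proj (z + third m n)) = u (proj (z + third m n)) j :=
      ae_add _ e0
    have e2 : ∀ᵐ z : ℂ, (c • h : L2scalar) (proj z) = c * h (proj z) :=
      ae_proj (Lp.coeFn_smul c h)
    constructor
    · intro h4
      refine Lp.ext (ae_eq_of_ae_proj (Lp.stronglyMeasurable _) (Lp.stronglyMeasurable _) ?_)
      filter_upwards [h4, e0, e1, e2, h1] with z f1 f2 f3 f4 f5
      rw [f2, f4, f5, f3, f1]
    · intro h4
      rw [h4] at e0
      filter_upwards [e0, e1, e2, h1] with z f2 f3 f4 f5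
      rw [← f2, f4, f5, f3]
  rw [h3]
  have h4 : ∀ p : ℤ × ℤ, ⟪charL2 p, c • h⟫ =
      omega ^ ((2 - (j : ℤ) + p.1) * m + (2 - (j : ℤ) + p.2) * n) * fourierCoeff u (j, p) := by
    intro p
    rw [inner_smul_right, h2, char_third, ← mul_assoc, hc, ← zpow_add₀ omega_ne_zero, fourierCoeff]
    congr 2
    ring
  constructor
  · intro h5 p
    rw [← h4, ← h5, fourierCoeff]
  · intro h5
    refine sub_eq_zero.1 (eq_zero_of_inner_charL2 fun p => ?_)
    rw [inner_sub_right, h4, ← h5, fourierCoeff, sub_self]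

theorem mem_L2sub_one_iff_fourierCoeff (u : L2) :
    u ∈ L2sub 1 ↔ ∀ x, ¬ Admissible x → fourierCoeff u x = 0 := by
  rw [mem_L2sub_one_iff]
  simp only [ae_quasiperiodic_iff]
  constructor
  · rintro h ⟨j, p⟩ hx
    by_contra h0
    have h1 : ∀ m n : ℤ, ((2 - (j : ℤ) + p.1) * m + (2 - (j : ℤ) + p.2) * n) % 3 = 0 := by
      intro m n
      rw [← omega_zpow_eq_one_iff]
      exact mul_right_cancel₀ h0 ((one_mul _).trans (h m n j p)).symm
    have h2 := h1 1 0
    have h3 := h1 0 1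
    refine hx ⟨?_, ?_⟩ <;> fin_cases j <;> simp at h2 h3 ⊢ <;> omega
  · intro h m n j p
    by_cases hx : Admissible (j, p)
    · obtain ⟨h1, h2⟩ := hx
      have h3 : (3 : ℤ) ∣ 2 - (j : ℤ) + p.1 := by
        fin_cases j <;> simp at h1 ⊢ <;> omega
      have h4 : (3 : ℤ) ∣ 2 - (j : ℤ) + p.2 := by
        fin_cases j <;> simp at h2 ⊢ <;> omega
      have h5 : omega ^ ((2 - (j : ℤ) + p.1) * m + (2 - (j : ℤ) + p.2) * n) = 1 := by
        rw [omega_zpow_eq_one_iff]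
        exact Int.emod_eq_zero_of_dvd
          ((h3.mul_right m).add (h4.mul_right n))
      rw [h5, one_mul]
    · rw [h _ hx, mul_zero]

end PotentialAndSymmetry

section TunnellingOperator

local notation "⟪" x ", " y "⟫" => inner ℂ x y

lemma DiagBound.smul {H : Type*} [NormedAddCommGroup H] [InnerProductSpace ℂ H] {p : ℕ}
    {A : H →L[ℂ] H} {s : ℝ} (h : DiagBound p A s) (c : ℂ) :
    DiagBound p (c • A : H →L[ℂ] H) (‖c‖ * s) := by
  intro n e he
  have h1 := mul_le_mul_of_nonneg_left (h n e he) (pow_nonneg (norm_nonneg c) p)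
  rw [Finset.mul_sum, ← mul_pow] at h1
  refine le_trans (Finset.sum_le_sum fun i _ => le_of_eq ?_) h1
  rw [smul_apply, inner_smul_right, norm_mul, mul_pow]

theorem norm_inverse_one_sub_smul_le {H : Type*} [NormedAddCommGroup H] [InnerProductSpace ℂ H]
    [CompleteSpace H] {T : H →L[ℂ] H} (hT : IsCompactOperator T) {r s c : ℝ} (hr : ‖T‖ ≤ r)
    (hs0 : 0 ≤ s) (hs : DiagBound 4 T s) (hc : DiagBound 3 T c) {α : ℂ}
    (hα : (1 : ℂ) ∉ spectrum ℂ (α • T)) :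
    Multipliable (detFactor (-(α • T))) ∧ det4OneAdd (-(α • T)) ≠ 0 ∧
      ‖Ring.inverse (1 - α • T)‖ ≤ (1 + r * ‖α‖) ^ 2 +
        Real.exp (3 * (s * ‖α‖ + 1) ^ 4 / 4) / ‖det4OneAdd (-(α • T))‖ := by
  have e : -(α • T) = (-α) • T := (neg_smul α T).symm
  have hNc : IsCompactOperator (-(α • T)) := by
    rw [e]
    exact hT.smul (-α)
  have hN4 : DiagBound 4 (-(α • T)) (s * ‖α‖) := by
    rw [e, mul_comm, ← norm_neg α]
    exact hs.smul (-α)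
  have hN3 : DiagBound 3 (-(α • T)) (‖-α‖ * c) := by
    rw [e]
    exact hc.smul (-α)
  have hN : ‖-(α • T)‖ ≤ r * ‖α‖ := by
    rw [norm_neg, norm_smul, mul_comm]
    exact mul_le_mul_of_nonneg_right hr (norm_nonneg α)
  have h1 : (-1 : ℂ) ∉ spectrum ℂ (-(α • T)) := by
    rw [← spectrum.neg_eq, Set.neg_mem_neg]
    exact hα
  obtain ⟨d, hd0, hd⟩ := hasProd_detFactor hNc hN4 h1
  refine ⟨hd.multipliable, ?_, ?_⟩
  · rw [det4OneAdd, hd.tprod_eq]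
    exact hd0
  · rw [sub_eq_add_neg]
    exact norm_inverse_one_add_le hNc hN (by positivity) hN4 hN3 h1

lemma DiagBound.of_coe_eq {H : Type*} [NormedAddCommGroup H] [InnerProductSpace ℂ H] {p : ℕ}
    {K : Submodule ℂ H} {A : H → H} {B : K → K} {s : ℝ} (h : DiagBound p A s)
    (hAB : ∀ u, (B u : H) = A u) : DiagBound p B s := by
  intro n e he
  have h1 := h n (fun i => (e i : H)) (he.comp_linearIsometry K.subtypeₗᵢ)
  simpa only [← hAB, ← Submodule.coe_inner] using h1

/-- The Birman–Schwinger operator `(2 D_{z̄})⁻¹ (0, U(z); U(-z), 0)`, composed with the projection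
to the admissible modes. -/
theorem exists_tunnelling : ∃ S : L2 →L[ℂ] L2, ‖S‖ ≤ 3 ∧ IsCompactOperator S ∧ DiagBound 4 S 4 ∧
    (∃ c, DiagBound 3 S c) ∧ ∀ u x, fourierCoeff (S u) x =
      multiplier x * ∑ k : Fin 3, omega ^ (k : ℕ) * fourierCoeff u (hop k x) := by
  obtain ⟨b, hb⟩ := exists_vectorFourierBasis
  obtain ⟨D, hD1, hD⟩ := exists_weightedPerm b multiplier zero_le_one norm_multiplier_le
    (Equiv.refl Mode)
  have hω : ∀ k : Fin 3, ‖omega ^ (k : ℕ)‖ = 1 := fun k => by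
    rw [norm_pow, norm_omega, one_pow]
  choose V hV1 hV using fun k : Fin 3 => exists_weightedPerm b (fun _ => omega ^ (k : ℕ))
    zero_le_one (fun _ => (hω k).le) (hop k)
  have hS : ∀ u x, ⟪b x, (D ∘L ∑ k, V k) u⟫ =
      multiplier x * ∑ k : Fin 3, omega ^ (k : ℕ) * ⟪b (hop k x), u⟫ := by
    intro u x
    rw [ContinuousLinearMap.comp_apply, hD, sum_apply, inner_sum]
    simp only [hV, Equiv.refl_apply]
  obtain ⟨A, hA, hsum⟩ := exists_hasSum_norm_multiplier_pow_four
  refine ⟨D ∘L ∑ k, V k, ?_, ?_, diagBound_hopping b hω hS hsum hA,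
    exists_diagBound_three b _ hD summable_norm_multiplier_pow_three, fun u x => ?_⟩
  · have h1 : ‖∑ k, V k‖ ≤ 3 := by
      refine (norm_sum_le _ _).trans ((Finset.sum_le_sum fun k _ => hV1 k).trans ?_)
      simp
    refine (ContinuousLinearMap.opNorm_comp_le _ _).trans ?_
    nlinarith [norm_nonneg D, norm_nonneg (∑ k, V k)]
  · exact (isCompactOperator_of_diagonal b hD tendsto_multiplier).comp_clm _
  · refine mul_left_cancel₀ normConst_ne_zero ?_
    rw [← hb, hS, mul_left_comm, Finset.mul_sum (a := (normConst : ℂ))]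
    simp only [hb, mul_left_comm (normConst : ℂ)]

lemma isClosed_L2sub_one : IsClosed (L2sub 1 : Set L2) := by
  have h : (L2sub 1 : Set L2) = ⋂ x, ⋂ (_ : ¬ Admissible x), {u | fourierCoeff u x = 0} := by
    ext u
    simp only [SetLike.mem_coe, mem_L2sub_one_iff_fourierCoeff, Set.mem_iInter, Set.mem_ofPred_eq]
  rw [h]
  refine isClosed_iInter fun x => isClosed_iInter fun _ => isClosed_eq ?_ continuous_const
  exact continuous_const.inner (component x.1).continuous

instance : CompleteSpace L2one := isClosed_L2sub_one.completeSpace_coe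

section

variable {S : L2 →L[ℂ] L2} (hS : ∀ u x, fourierCoeff (S u) x =
  multiplier x * ∑ k : Fin 3, omega ^ (k : ℕ) * fourierCoeff u (hop k x))

include hS

lemma mem_L2sub_one_of_multiplier (u : L2) : S u ∈ L2sub 1 := by
  rw [mem_L2sub_one_iff_fourierCoeff]
  intro x hx
  rw [hS, multiplier, if_neg hx, zero_mul]

lemma eq_multiplier_iff (u v : L2one) : S u = v ↔
    ∃ f : L2, IsPotentialMul (u : L2) f ∧ IsTwoDbar (v : L2) f := by
  have hu := (mem_L2sub_one_iff_fourierCoeff _).1 u.2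
  have hv := (mem_L2sub_one_iff_fourierCoeff _).1 v.2
  have hne : ∀ {x}, Admissible x → I * momentum x.2 ≠ 0 := fun hx =>
    mul_ne_zero I_ne_zero (momentum_ne_zero_of_admissible hx)
  constructor
  · intro h
    obtain ⟨f, hf⟩ := exists_isPotentialMul (u : L2)
    refine ⟨f, hf, (isTwoDbar_iff _ _).2 fun x => ?_⟩
    rw [fourierCoeff_of_isPotentialMul hf]
    by_cases hx : Admissible x
    · rw [← h, hS, multiplier, if_pos hx, one_div, mul_inv_cancel_left₀ (hne hx)]
    · rw [hv x hx, mul_zero]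
      refine Finset.sum_eq_zero fun k _ => ?_
      rw [hu _ (fun h => hx ((admissible_hop k x).1 h)), mul_zero]
  · rintro ⟨f, hf, hfv⟩
    refine ext_fourierCoeff fun x => ?_
    rw [hS, ← fourierCoeff_of_isPotentialMul hf, (isTwoDbar_iff _ _).1 hfv]
    by_cases hx : Admissible x
    · rw [multiplier, if_pos hx, one_div, inv_mul_cancel_left₀ (hne hx)]
    · rw [multiplier, if_neg hx, zero_mul, hv x hx]

lemma isT0_iff (T : L2one →L[ℂ] L2one) : IsT0 T ↔ ∀ u, (T u : L2) = S u := by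
  constructor
  · intro h u
    exact ((eq_multiplier_iff hS u (T u)).2 ((h u (T u)).1 rfl)).symm
  · intro h u v
    rw [← eq_multiplier_iff hS, ← h, Subtype.coe_inj]

end

end TunnellingOperator

end Moire

end

theorem lemma2 :
    (∃ T : Moire.L2one →L[ℂ] Moire.L2one, Moire.IsT0 T) ∧
    ∀ T : Moire.L2one →L[ℂ] Moire.L2one, Moire.IsT0 T →
      ∀ α : ℂ, (1 : ℂ) ∉ spectrum ℂ (α • T) →
        Multipliable (Moire.detFactor (-(α • T))) ∧
        Moire.det4OneAdd (-(α • T)) ≠ 0 ∧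
        ‖Ring.inverse (1 - α • T)‖ ≤
          (1 + 3 * ‖α‖) ^ 2 +
            Real.exp (3 * (4 * ‖α‖ + 1) ^ 4 / 4) / ‖Moire.det4OneAdd (-(α • T))‖ := by
  obtain ⟨S, hS3, hSc, hS4, ⟨c, hc⟩, hS⟩ := Moire.exists_tunnelling
  have hmem : ∀ u : Moire.L2one, S u ∈ Moire.L2sub 1 := fun u =>
    Moire.mem_L2sub_one_of_multiplier hS u
  refine ⟨⟨(S ∘L (Moire.L2sub 1).subtypeL).codRestrict (Moire.L2sub 1) hmem,
    (Moire.isT0_iff hS _).2 fun u => rfl⟩, fun T hT α hα => ?_⟩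
  rw [Moire.isT0_iff hS] at hT
  have hTc : IsCompactOperator T := by
    have h1 := (hSc.comp_clm (Moire.L2sub 1).subtypeL).codRestrict hmem Moire.isClosed_L2sub_one
    have h2 : (T : Moire.L2one → Moire.L2one) =
        Set.codRestrict (S ∘ (Moire.L2sub 1).subtypeL) (Moire.L2sub 1) hmem :=
      funext fun u => Subtype.ext (hT u)
    rw [h2]
    exact h1
  have hT3 : ‖T‖ ≤ 3 := by
    refine T.opNorm_le_bound (by norm_num) fun u => ?_
    have h1 := S.le_of_opNorm_le hS3 u
    rw [← hT] at h1
    exact h1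
  exact Moire.norm_inverse_one_sub_smul_le hTc hT3 (by norm_num) (hS4.of_coe_eq hT)
    (hc.of_coe_eq hT) hα
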